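/- Let $p,q\in\mathbb{R}$ with $p\neq 0$, and let $P:\mathbb{R}\to\mathbb{R}$ be a Schwartz function of compact support. Write $\check P(\xi)=\int_{\mathbb{R}}e^{2\pi i k\xi}P(k)\,dk$ and, for $X\in\mathbb{R}$, $t\ge 0$ and $\operatorname{Re}\omega>0$, $$h(X,t)=2q\,\sin(2\pi^2pX^2t)\,\check P(2\pi pXt),\qquad \tilde h(X,\omega)=\int_0^\infty e^{-\omega t}h(X,t)\,dt .$$ Call $P$ stable with constant $\kappa>0$ if $$\inf_{\operatorname{Re}\omega>0,\;X\in\mathbb{R}}|1-\tilde h(X,\omega)|\ \ge\ \kappa ,$$ and assume that $P$ is stable with some constant $\kappa>0$. For $w_0\in\mathcal{S}(\mathbb{R}^2)$ consider solutions $w\in C([0,\infty);\mathcal{S}(\mathbb{R}^2))$ (complex-valued, differentiable in $t$ at each $(x,k)$ and $t>0$) of the linearised Alber equation $$\partial_t w+2\pi p k\,\partial_x w-qi\int_{\mathbb{R}}\Big(\int_{\mathbb{R}} e^{-2\pi i\lambda y}\big[n(x+\tfrac y2,t)-n(x-\tfrac y2,t)\big]dy\Big)P(k-\lambda)\,d\lambda=0,$$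 $$n(x,t)=\int_{\mathbb{R}}w(x,\xi,t)\,d\xi,\qquad w(x,k,0)=w_0(x,k).$$ For $r\in\mathbb{N}$ let $$\|w_0\|_{\Sigma^{r,\infty}}=\sum_{a+b+c+d\le r}\|x^ak^b\partial_x^c\partial_k^d w_0\|_{L^\infty(\mathbb{R}^2)} .$$ Then: (i) There are $r\in\mathbb{N}$ and $C>0$, depending only on $p,q,P$, such that for every $\kappa$ with which $P$ is stable, every $w_0\in\mathcal{S}(\mathbb{R}^2)$ and every such solution $w$ with initial datum $w_0$, $$\|\partial_x n\|_{L^2(\mathbb{R}_x\times(0,\infty)_t)}\le\frac{C}{\kappa}\,\|w_0\|_{\Sigma^{r,\infty}} .$$ (ii) Let $(E(t)g)(x,k)=g(x-2\pi pkt,k)$ be the free-space propagator. There is a linear operator $\mathbb{W}:\mathcal{S}(\mathbb{R}^2)\to L^\infty(\mathbb{R}^2)$ (the wave operator) such that for every $w_0\in\mathcal{S}(\mathbb{R}^2)$ and every such solution $w$ with initial datum $w_0$, $$\lim_{t\to\infty}\|w(t)-E(t)\mathbb{W}(w_0)\|_{L^\infty(\mathbb{R}^2)}=0 .$$ -/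

import Mathlib

open MeasureTheory
open scoped SchwartzMap FourierTransform ENNReal

noncomputable section

namespace Alber

/-- The `Σ^{s,p}` norm on functions of phase space `(x, k) ∈ ℝ × ℝ`:
the sum over `a + b + c + d ≤ s` of the `L^p(ℝ²)` norms of `x^a k^b ∂_x^c ∂_k^d f`. -/
def sigmaNorm (s : ℕ) (p : ℝ≥0∞) (f : ℝ × ℝ → ℂ) : ℝ≥0∞ :=
  ∑ a ∈ Finset.range (s + 1), ∑ b ∈ Finset.range (s + 1),
    ∑ c ∈ Finset.range (s + 1), ∑ d ∈ Finset.range (s + 1),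
      if a + b + c + d ≤ s then
        eLpNorm (fun z : ℝ × ℝ => (z.1 : ℂ) ^ a * (z.2 : ℂ) ^ b *
          iteratedDeriv c (fun x => iteratedDeriv d (fun k => f (x, k)) z.2) z.1) p volume
      else 0

/-- The Laplace transform `ω ↦ ∫_0^∞ e^{-ω t} u(t) dt`. -/
def laplace (u : ℝ → ℂ) (ω : ℂ) : ℂ :=
  ∫ t in Set.Ioi (0 : ℝ), Complex.exp (-ω * t) * u t

/-- The kernel `h(X,t) = 2 q sin(2π² p X² t) P̌(2π p X t)`,
where `P̌(ξ) = ∫ e^{2π i k ξ} P(k) dk`. -/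
def kernelH (p q : ℝ) (P : ℝ → ℝ) (X t : ℝ) : ℂ :=
  2 * q * Real.sin (2 * Real.pi ^ 2 * p * X ^ 2 * t) *
    𝓕⁻ (fun k : ℝ => (P k : ℂ)) (2 * Real.pi * p * X * t)

/-- The spectrum `P` is stable with constant `κ`:
`κ > 0` and `inf_{Re ω > 0, X ∈ ℝ} |1 - h̃(X,ω)| ≥ κ`. -/
def StableWith (p q : ℝ) (P : ℝ → ℝ) (κ : ℝ) : Prop :=
  0 < κ ∧ ∀ (X : ℝ) (ω : ℂ), 0 < ω.re → κ ≤ ‖1 - laplace (kernelH p q P X) ω‖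

/-- The position density `n(x) = ∫ w(x,ξ) dξ` of a phase-space function. -/
def density (w : ℝ × ℝ → ℂ) (x : ℝ) : ℂ :=
  ∫ ξ : ℝ, w (x, ξ)

/-- The interaction term
`∫_λ (∫_y e^{-2π i λ y} [n(x + y/2) - n(x - y/2)] dy) P(k - λ) dλ`. -/
def interaction (P : ℝ → ℝ) (n : ℝ → ℂ) (x k : ℝ) : ℂ :=
  ∫ l : ℝ, (∫ y : ℝ, Complex.exp (-2 * Real.pi * Complex.I * l * y) *
    (n (x + y / 2) - n (x - y / 2))) * P (k - l)

/-- `w ∈ C([0,∞); 𝓢(ℝ²))` is a classical solution of the linearised Alber equation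
`∂_t w + 2π p k ∂_x w - q i ∫∫ e^{-2π i λ y} [n(x+y/2,t) - n(x-y/2,t)] dy P(k-λ) dλ = 0`,
`n(x,t) = ∫ w(x,ξ,t) dξ`, with initial datum `w₀`.  Only the times `t ≥ 0` matter. -/
structure IsSolution (p q : ℝ) (P : ℝ → ℝ) (w₀ : 𝓢(ℝ × ℝ, ℂ)) (w : ℝ → 𝓢(ℝ × ℝ, ℂ)) :
    Prop where
  continuousOn : ContinuousOn w (Set.Ici 0)
  initial : w 0 = w₀
  equation : ∀ t : ℝ, 0 < t → ∀ x k : ℝ,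
    DifferentiableAt ℝ (fun τ => w τ (x, k)) t ∧
    deriv (fun τ => w τ (x, k)) t
      + 2 * Real.pi * p * k * deriv (fun y => w t (y, k)) x
      - q * Complex.I * interaction P (density (w t)) x k = 0

/-- The free-space propagator `E(t) : g(x,k) ↦ g(x - 2π p k t, k)`. -/
def freeTransport (p t : ℝ) (g : ℝ × ℝ → ℂ) : ℝ × ℝ → ℂ :=
  fun z => g (z.1 - 2 * Real.pi * p * z.2 * t, z.2)

end Alber

end

/-! ### Plancherel, Young's inequality and coercivity of convolution equations on the line -/

namespace Alber

open scoped Convolution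

/-! Fourier transform in x turns the interaction into multiplication of n̂(X,t) by P(k-X/2) -
P(k+X/2) (`interaction_eq_fourierInv`), so each wavenumber obeys a scalar ODE in t with an explicit
Duhamel formula. Integrating that formula over k closes it on the density: for each X, u(t) =
n̂(X,t) solves the Volterra equation u = f + h(-X,·) * u (`IsSolution.volterra`), where f(t) is the
phase-space Fourier transform of w₀ at (X, 2πpXt). Free transport thus converts smoothness in k into
decay in t on the time scale 1/|X|.

The analytic core is `volterra_eLpNorm_le`: if |1 - h̃| ≥ κ on Re ω > 0, then ‖u‖ ≤ κ⁻¹‖f‖ in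
L²(0,∞), for any continuous u with no growth assumption. If e^{-σt}u is in L¹ ∩ L², this is
Plancherel on the line Re ω = σ. That integrability holds for large σ because the weighted kernel
has L¹ norm at most 1/2. It is then pushed down to every σ > 0 in small steps: lowering the weight
by ρ produces a commutator of size ρ‖t h‖₁, absorbed by coercivity once ρ is small. Finally σ tends
to 0.

For (i), ‖f‖² is of order (1+X²)⁻²/|X|; the factor X² coming from ∂ₓ removes the singularity at X =
0, and integration over X finishes the bound.

For (ii), t u solves the same Volterra equation with forcing t f + (t h) * u, and ‖t h‖₁ is
O(1/|X|). The L² bounds on u and t u combine to an L¹ bound in time of order (1+X²)⁻¹/|X|. Since the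
multiplier is O(|X|), the Duhamel integrand is absolutely integrable over all frequencies and
positive times, uniformly in (x,k). The wave operator is w₀ plus this full integral, and the error
at time t is its tail. To have a linear operator on all data, whether or not a solution is given, u
is first constructed linearly from w₀ by a resolvent (`exists_volterra_solution`) and then
identified with the density of any actual solution by uniqueness. -/

/-- On `L¹ ∩ L²` the `L²` Fourier transform is given by the Fourier integral. -/
theorem fourier_toLp_ae_eq {f : ℝ → ℂ} (h1 : Integrable f) (h2 : MemLp f 2) :
    (𝓕 (h2.toLp f) : Lp ℂ 2 (volume : Measure ℝ)) =ᵐ[volume] 𝓕 f := by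
  have hcont : Continuous (𝓕 f) := by
    exact VectorFourier.fourierIntegral_continuous Real.continuous_fourierChar
      (by exact continuous_inner) h1
  -- Both sides are tested against smooth compactly supported functions: the transform moves onto
  -- the test function by the distributional definition on the L² side and by Fubini on the L¹ side.
  refine ae_eq_of_integral_contDiff_smul_eq ?_ hcont.locallyIntegrable ?_
  · exact (Lp.memLp _).locallyIntegrable (by norm_num)
  intro g hg hgc
  have hG : HasCompactSupport (fun x => (g x : ℂ)) := hgc.comp_left (g := fun r : ℝ => (r : ℂ)) (by simp)
  have hG' : ContDiff ℝ ((⊤ : ℕ∞) : WithTop ℕ∞) (fun x => (g x : ℂ)) := Complex.ofRealCLM.contDiff.comp hg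
  set G : 𝓢(ℝ, ℂ) := hG.toSchwartzMap hG' with hGdef
  have hGx : ∀ x, G x = (g x : ℂ) := fun x => rfl
  have e1 := congrArg (fun T : 𝓢'(ℝ, ℂ) => T G) (Lp.fourier_toTemperedDistribution_eq (h2.toLp f))
  simp only [TemperedDistribution.fourier_apply, Lp.toTemperedDistribution_apply] at e1
  have e2 : ∫ x, (𝓕 G) x • (h2.toLp f) x = ∫ x, (𝓕 G) x • f x :=
    integral_congr_ae (by filter_upwards [h2.coeFn_toLp] with x hx; rw [hx])
  have e3 : ∫ x, (𝓕 G) x • f x = ∫ x, G x • (𝓕 f) x := by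
    have := VectorFourier.integral_fourierIntegral_smul_eq_flip (μ := volume) (ν := volume)
      (L := innerₗ ℝ) Real.continuous_fourierChar (by exact continuous_inner)
      (G.integrable (μ := volume)) h1
    rw [flip_innerₗ] at this
    exact this
  have key := e1.symm.trans (e2.trans e3)
  simpa only [hGx, Complex.real_smul, smul_eq_mul] using key

/-- Plancherel's identity for functions in `L¹ ∩ L²`. -/
theorem eLpNorm_fourier_two {f : ℝ → ℂ} (h1 : Integrable f) (h2 : MemLp f 2) :
    eLpNorm (𝓕 f) 2 volume = eLpNorm f 2 volume := by
  rw [← eLpNorm_congr_ae (fourier_toLp_ae_eq h1 h2), ← eLpNorm_congr_ae h2.coeFn_toLp]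
  have := Lp.norm_fourier_eq (h2.toLp f)
  rw [Lp.norm_def, Lp.norm_def, ENNReal.toReal_eq_toReal_iff' (Lp.eLpNorm_ne_top _)
    (Lp.eLpNorm_ne_top _)] at this
  exact this

/-- The squared form of Young's inequality `L¹ * L² ⊆ L²` for nonnegative functions. -/
theorem lintegral_sq_conv_le {A B : ℝ → ℝ≥0∞} (hA : Measurable A) (hB : Measurable B) :
    ∫⁻ t, (∫⁻ s, A (t - s) * B s) ^ 2 ≤ (∫⁻ t, A t) ^ 2 * ∫⁻ t, B t ^ 2 := by
  have key : ∀ t, (∫⁻ s, A (t - s) * B s) ^ 2 ≤ (∫⁻ s, A s) * ∫⁻ s, A (t - s) * B s ^ 2 := by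
    intro t
    have hAt : Measurable fun s => A (t - s) := hA.comp (measurable_const.sub measurable_id)
    -- Cauchy–Schwarz with the kernel split evenly, A B = A^{1/2} · (A^{1/2} B).
    have h := ENNReal.lintegral_mul_le_Lp_mul_Lq volume Real.HolderConjugate.two_two
      (f := fun s => A (t - s) ^ (1 / 2 : ℝ)) (g := fun s => A (t - s) ^ (1 / 2 : ℝ) * B s)
      (hAt.pow_const _).aemeasurable ((hAt.pow_const _).mul hB).aemeasurable
    have e1 : ∀ s, ((fun s => A (t - s) ^ (1 / 2 : ℝ)) * fun s => A (t - s) ^ (1 / 2 : ℝ) * B s) s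
        = A (t - s) * B s := by
      intro s
      simp only [Pi.mul_apply, ← mul_assoc]
      rw [← ENNReal.rpow_add_of_nonneg _ _ (by norm_num) (by norm_num)]
      norm_num
    have e2 : ∀ s, (A (t - s) ^ (1 / 2 : ℝ)) ^ (2 : ℝ) = A (t - s) := by
      intro s; rw [← ENNReal.rpow_mul]; norm_num
    have e3 : ∀ s, (A (t - s) ^ (1 / 2 : ℝ) * B s) ^ (2 : ℝ) = A (t - s) * B s ^ 2 := by
      intro s
      rw [ENNReal.mul_rpow_of_nonneg _ _ (by norm_num), e2 s, ENNReal.rpow_two]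
    simp only [e1, e2, e3] at h
    calc (∫⁻ s, A (t - s) * B s) ^ 2
        ≤ ((∫⁻ s, A (t - s)) ^ (1 / 2 : ℝ) * (∫⁻ s, A (t - s) * B s ^ 2) ^ (1 / 2 : ℝ)) ^ 2 := by
          gcongr
      _ = (∫⁻ s, A (t - s)) * ∫⁻ s, A (t - s) * B s ^ 2 := by
          rw [mul_pow, ← ENNReal.rpow_natCast, ← ENNReal.rpow_natCast, ← ENNReal.rpow_mul,
            ← ENNReal.rpow_mul]
          norm_num
      _ = _ := by rw [lintegral_sub_left_eq_self A t]
  have hm : Measurable fun z : ℝ × ℝ => A (z.1 - z.2) * B z.2 ^ 2 := by fun_prop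
  calc ∫⁻ t, (∫⁻ s, A (t - s) * B s) ^ 2
      ≤ ∫⁻ t, (∫⁻ s, A s) * ∫⁻ s, A (t - s) * B s ^ 2 := lintegral_mono key
    _ = (∫⁻ s, A s) * ∫⁻ t, ∫⁻ s, A (t - s) * B s ^ 2 :=
        lintegral_const_mul _ hm.lintegral_prod_right'
    _ = (∫⁻ s, A s) * ∫⁻ s, ∫⁻ t, A (t - s) * B s ^ 2 := by
        rw [lintegral_lintegral_swap hm.aemeasurable]
    _ = (∫⁻ s, A s) * ∫⁻ s, (∫⁻ t, A t) * B s ^ 2 := by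
        congr 1
        refine lintegral_congr fun s => ?_
        rw [lintegral_mul_const _ (by fun_prop), lintegral_sub_right_eq_self A s]
    _ = _ := by
        rw [lintegral_const_mul _ (by fun_prop)]; ring

theorem eLpNorm_two_sq (f : ℝ → ℂ) (μ : Measure ℝ) :
    eLpNorm f 2 μ ^ 2 = ∫⁻ t, ‖f t‖ₑ ^ 2 ∂μ := by
  have := eLpNorm_nnreal_pow_eq_lintegral (f := f) (μ := μ) (p := 2) (by norm_num)
  simpa using this

/-- Young's inequality for a function dominated by a convolution. -/
theorem eLpNorm_two_le_of_enorm_le_conv {A : ℝ → ℝ≥0∞} (hA : Measurable A) {V G : ℝ → ℂ}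
    (hV : Measurable V) (hG : ∀ t, ‖G t‖ₑ ≤ ∫⁻ s, A (t - s) * ‖V s‖ₑ) :
    eLpNorm G 2 volume ≤ (∫⁻ t, A t) * eLpNorm V 2 volume := by
  rw [← ENNReal.pow_le_pow_left_iff (n := 2) (by norm_num), mul_pow, eLpNorm_two_sq, eLpNorm_two_sq]
  refine le_trans (lintegral_mono fun t => ?_) (lintegral_sq_conv_le hA hV.enorm)
  gcongr
  exact hG t

/-- A convolution equation with symbol bounded away from zero is coercive on `L²`. -/
theorem eLpNorm_two_le_of_symbol {H V : ℝ → ℂ} (hHm : Measurable H) (hVm : Measurable V)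
    (hH : Integrable H) (hV1 : Integrable V) (hV2 : MemLp V 2) {κ : ℝ} (hκ : 0 < κ)
    (hs : ∀ y, κ ≤ ‖1 - 𝓕 H y‖) :
    ENNReal.ofReal κ * eLpNorm V 2 volume ≤
      eLpNorm (fun t => V t - ∫ s, H (t - s) * V s) 2 volume := by
  have hconv : (fun t => ∫ s, H (t - s) * V s) = V ⋆[ContinuousLinearMap.mul ℂ ℂ] H := by
    ext t
    simp only [convolution, ContinuousLinearMap.mul_apply', mul_comm]
  have hc1 : Integrable (fun t => ∫ s, H (t - s) * V s) := by
    rw [hconv]; exact hV1.integrable_convolution _ hH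
  have hc2 : MemLp (fun t => ∫ s, H (t - s) * V s) 2 := by
    refine ⟨hc1.aestronglyMeasurable, ?_⟩
    refine (eLpNorm_two_le_of_enorm_le_conv (A := fun t => ‖H t‖ₑ) hHm.enorm hVm
      fun t => ?_).trans_lt ?_
    · refine (enorm_integral_le_lintegral_enorm _).trans (lintegral_mono fun s => ?_)
      rw [enorm_mul]
    · exact ENNReal.mul_lt_top hH.2 hV2.2
  have hF : ∀ y, 𝓕 (fun t => V t - ∫ s, H (t - s) * V s) y = (1 - 𝓕 H y) * 𝓕 V y := by
    intro y
    have h1 := Real.fourier_mul_convolution_eq hV1 hH y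
    rw [← hconv] at h1
    have h2 : 𝓕 (fun t => V t - ∫ s, H (t - s) * V s) y
        = 𝓕 V y - 𝓕 (fun t => ∫ s, H (t - s) * V s) y := by
      simp only [Real.fourier_real_eq, smul_sub]
      exact integral_sub (by simpa [mul_comm] using (Real.fourierIntegral_convergent_iff (V := ℝ) y).2 hV1)
        (by simpa [mul_comm] using (Real.fourierIntegral_convergent_iff (V := ℝ) y).2 hc1)
    rw [h2, h1]; ring
  have hsub := eLpNorm_fourier_two (hV1.sub hc1) (hV2.sub hc2)
  simp only [Pi.sub_def] at hsub
  rw [← eLpNorm_fourier_two hV1 hV2, ← hsub]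
  calc ENNReal.ofReal κ * eLpNorm (𝓕 V) 2 volume
      = eLpNorm ((κ : ℂ) • 𝓕 V) 2 volume := by
        rw [eLpNorm_const_smul, ← ofReal_norm]; simp [abs_of_pos hκ]
    _ ≤ _ := by
        refine eLpNorm_mono fun y => ?_
        rw [hF y, norm_mul, Pi.smul_apply, norm_smul]
        simp only [Complex.norm_real, Real.norm_eq_abs, abs_of_pos hκ]
        gcongr
        exact hs y

end Alber

/-! ### L² theory of causal Volterra equations under a spectral gap -/

namespace Alber

/-- A Volterra convolution equation `u = f + h * u` for functions vanishing on `(-∞, 0]`. -/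
structure CausalVolterra (h u f : ℝ → ℂ) : Prop where
  h_meas : Measurable h
  u_meas : Measurable u
  f_meas : Measurable f
  h_causal : ∀ t ≤ 0, h t = 0
  u_causal : ∀ t ≤ 0, u t = 0
  h_int : Integrable h
  u_bdd : ∀ T, ∃ B, ∀ t ≤ T, ‖u t‖ ≤ B
  eq : ∀ t, u t = f t + ∫ s, h (t - s) * u s

/-- Causality of h cuts off s > t, and below t the function v is bounded; no global bound on v is
needed. -/
theorem integrable_causal_conv {h v : ℝ → ℂ} (hv_meas : Measurable v)
    (hh : ∀ t ≤ 0, h t = 0) (hInt : Integrable h)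
    (hv : ∀ T, ∃ B, ∀ t ≤ T, ‖v t‖ ≤ B) (t : ℝ) : Integrable fun s => h (t - s) * v s := by
  obtain ⟨B, hB⟩ := hv t
  have h1 : Integrable fun s => h (t - s) := hInt.comp_sub_left t
  refine (h1.norm.mul_const B).mono' (h1.aestronglyMeasurable.mul hv_meas.aestronglyMeasurable) ?_
  refine Filter.Eventually.of_forall fun s => ?_
  rw [norm_mul]
  rcases le_or_gt s t with hs | hs
  · gcongr; exact hB s hs
  · rw [hh (t - s) (by linarith)]; simp

/-- A pointwise limit of functions with uniformly bounded `L²` norm has the same bound. -/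
theorem eLpNorm_two_le_of_tendsto {v : ℕ → ℝ → ℂ} {u : ℝ → ℂ} (hv : ∀ n, Measurable (v n))
    (hlim : ∀ t, Filter.Tendsto (fun n => v n t) Filter.atTop (nhds (u t))) {C : ℝ≥0∞}
    (hC : ∀ n, eLpNorm (v n) 2 volume ≤ C) : eLpNorm u 2 volume ≤ C := by
  refine (Lp.eLpNorm_lim_le_liminf_eLpNorm (fun n => (hv n).aestronglyMeasurable) u
    (Filter.Eventually.of_forall hlim)).trans ?_
  exact Filter.liminf_le_of_le (by isBoundedDefault) fun b hb => by
    obtain ⟨n, hn⟩ := hb.exists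
    exact hn.trans (hC n)

/-- Cauchy–Schwarz against e^{-εt} on the half line. This recovers the L¹ information needed for the
Fourier argument after each lowering of the weight. -/
theorem integrable_exp_weight_mul {v : ℝ → ℂ} (hv0 : ∀ t ≤ 0, v t = 0)
    (hv : MemLp v 2) {ε : ℝ} (hε : 0 < ε) :
    Integrable fun t : ℝ => (Real.exp (-ε * t) : ℂ) * v t := by
  have hE : MemLp (fun t : ℝ => Set.indicator (Set.Ioi 0) (fun t => (Real.exp (-ε * t) : ℂ)) t) 2 := by
    have hm : AEStronglyMeasurable (fun t : ℝ => (Real.exp (-ε * t) : ℂ))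
        (volume.restrict (Set.Ioi 0)) := by
      exact Continuous.aestronglyMeasurable (by fun_prop)
    rw [memLp_indicator_iff_restrict measurableSet_Ioi, memLp_two_iff_integrable_sq_norm hm]
    have : ∀ t : ℝ, ‖(Real.exp (-ε * t) : ℂ)‖ ^ 2 = Real.exp (-(2 * ε) * t) := by
      intro t
      rw [Complex.norm_real, Real.norm_eq_abs, Real.abs_exp, ← Real.exp_nat_mul]
      congr 1; push_cast; ring
    simp only [this]
    exact integrableOn_exp_mul_Ioi (by linarith) 0
  have := hE.integrable_mul hv
  refine this.congr (Filter.Eventually.of_forall fun t => ?_)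
  simp only [Pi.mul_apply]
  rcases le_or_gt t 0 with ht | ht
  · simp [hv0 t ht]
  · rw [Set.indicator_of_mem (show t ∈ Set.Ioi (0:ℝ) from ht)]

namespace CausalVolterra

variable {h u f : ℝ → ℂ}

theorem f_causal (hV : CausalVolterra h u f) {t : ℝ} (ht : t ≤ 0) : f t = 0 := by
  have h1 := hV.eq t
  rw [hV.u_causal t ht] at h1
  have h2 : ∫ s, h (t - s) * u s = 0 := by
    rw [← integral_zero ℝ ℂ]
    congr 1
    ext s
    rcases le_or_gt s 0 with hs | hs
    · simp [hV.u_causal s hs]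
    · simp [hV.h_causal (t - s) (by linarith)]
  rw [h2, add_zero] at h1
  exact h1.symm

/-- Multiplication by a locally bounded weight preserves local boundedness. -/
theorem bdd_weight (hV : CausalVolterra h u f) {m : ℝ → ℝ}
    (hm : ∀ T, ∃ B, ∀ t, 0 < t → t ≤ T → |m t| ≤ B) (T : ℝ) :
    ∃ B, ∀ t ≤ T, ‖(m t : ℂ) * u t‖ ≤ B := by
  obtain ⟨B, hB⟩ := hV.u_bdd T
  obtain ⟨B', hB'⟩ := hm T
  refine ⟨|B'| * |B|, fun t ht => ?_⟩
  rw [norm_mul, Complex.norm_real, Real.norm_eq_abs]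
  rcases le_or_gt t 0 with h0 | h0
  · rw [hV.u_causal t h0]; simp; positivity
  · exact mul_le_mul ((hB' t h0 ht).trans (le_abs_self _)) ((hB t ht).trans (le_abs_self _))
      (norm_nonneg _) (abs_nonneg _)

/-- The equation for `m u` and the kernel `e^{-τ t} h`, up to a commutator. -/
theorem weighted_eq (hV : CausalVolterra h u f) {m : ℝ → ℝ} (hmm : Measurable m)
    (hm : ∀ T, ∃ B, ∀ t, 0 < t → t ≤ T → |m t| ≤ B) {τ : ℝ} (hτ : 0 ≤ τ) (t : ℝ) :
    (m t : ℂ) * u t - ∫ s, ((Real.exp (-τ * (t - s)) : ℂ) * h (t - s)) * ((m s : ℂ) * u s)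
      = m t * f t + ∫ s, ((m t : ℂ) - Real.exp (-τ * (t - s)) * m s) * (h (t - s) * u s) := by
  have i1 : Integrable fun s => (m t : ℂ) * (h (t - s) * u s) :=
    (integrable_causal_conv hV.u_meas hV.h_causal hV.h_int hV.u_bdd t).const_mul _
  have hh2 : Integrable fun r : ℝ => (Real.exp (-τ * r) : ℂ) * h r := by
    refine hV.h_int.norm.mono' ?_ (Filter.Eventually.of_forall fun r => ?_)
    · exact ((by fun_prop : Continuous fun r : ℝ => (Real.exp (-τ * r) : ℂ)).measurable.mul
        hV.h_meas).aestronglyMeasurable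
    · rcases le_or_gt r 0 with hr | hr
      · simp [hV.h_causal r hr]
      · rw [norm_mul, Complex.norm_real, Real.norm_eq_abs, Real.abs_exp]
        have : Real.exp (-τ * r) ≤ 1 := Real.exp_le_one_iff.2 (by nlinarith)
        nlinarith [norm_nonneg (h r)]
  have i2 : Integrable fun s => ((Real.exp (-τ * (t - s)) : ℂ) * h (t - s)) * ((m s : ℂ) * u s) :=
    integrable_causal_conv (h := fun r : ℝ => (Real.exp (-τ * r) : ℂ) * h r)
      ((Complex.measurable_ofReal.comp hmm).mul hV.u_meas)
      (fun r hr => by simp [hV.h_causal r hr]) hh2 (hV.bdd_weight hm) t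
  have : ∫ s, ((m t : ℂ) - Real.exp (-τ * (t - s)) * m s) * (h (t - s) * u s)
      = (∫ s, (m t : ℂ) * (h (t - s) * u s)) -
        ∫ s, ((Real.exp (-τ * (t - s)) : ℂ) * h (t - s)) * ((m s : ℂ) * u s) := by
    rw [← integral_sub i1 i2]
    congr 1; ext s; ring
  rw [this, integral_const_mul]
  conv_lhs => rw [hV.eq t]
  ring

/-- Absorption is legitimate only for a finite quantity, which is why it is always applied to
truncated weights. -/
theorem absorb_half {κ : ℝ} (hκ : 0 < κ) {a b : ℝ≥0∞} (ha : a ≠ ∞)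
    (h : ENNReal.ofReal κ * a ≤ b + ENNReal.ofReal (κ / 2) * a) :
    a ≤ ENNReal.ofReal (2 / κ) * b := by
  have h2 : ENNReal.ofReal (κ / 2) * a ≤ b := by
    have e : ENNReal.ofReal κ = ENNReal.ofReal (κ / 2) + ENNReal.ofReal (κ / 2) := by
      rw [← ENNReal.ofReal_add (by positivity) (by positivity)]; congr 1; ring
    rw [e, add_mul] at h
    exact (ENNReal.add_le_add_iff_right (ENNReal.mul_ne_top ENNReal.ofReal_ne_top ha)).1 h
  calc a = ENNReal.ofReal (2 / κ) * (ENNReal.ofReal (κ / 2) * a) := by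
        rw [← mul_assoc, ← ENNReal.ofReal_mul (by positivity)]
        have : 2 / κ * (κ / 2) = 1 := by field_simp
        rw [this]; simp
    _ ≤ _ := by gcongr

/-- The truncated exponential weight. -/
noncomputable def truncWeight (τ ρ R t : ℝ) : ℝ :=
  Real.exp (-τ * t) * min (Real.exp (ρ * t)) (Real.exp (ρ * R))

theorem truncWeight_nonneg (τ ρ R t : ℝ) : 0 ≤ truncWeight τ ρ R t := by
  unfold truncWeight; positivity

theorem continuous_truncWeight (τ ρ R : ℝ) : Continuous (truncWeight τ ρ R) := by
  unfold truncWeight; fun_prop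

/-- For fixed R the weight is dominated by a multiple of e^{-τt}, so what is known at weight τ makes
the truncated quantity finite. The next bound, at weight τ-ρ, is the one uniform in R. -/
theorem truncWeight_le (τ ρ R t : ℝ) :
    truncWeight τ ρ R t ≤ Real.exp (ρ * R) * Real.exp (-τ * t) := by
  unfold truncWeight
  rw [mul_comm]
  gcongr
  exact min_le_right _ _

theorem truncWeight_le' (τ ρ R t : ℝ) :
    truncWeight τ ρ R t ≤ Real.exp (-(τ - ρ) * t) := by
  unfold truncWeight
  calc _ ≤ Real.exp (-τ * t) * Real.exp (ρ * t) := by gcongr; exact min_le_left _ _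
    _ = _ := by rw [← Real.exp_add]; congr 1; ring

/-- The factor e^{-τt} comes out, leaving the increment b - a of the capped exponential. Capping
only slows growth, so b ≤ e^{ρ(t-s)}a; with ρ ≤ τ the commutator is at most (1 - e^{-ρ(t-s)})a, up
to e^{-τs}, and 1 - e^{-r} ≤ r. The bound does not depend on R. -/
theorem truncWeight_commutator {τ ρ R s t : ℝ} (hρ : 0 ≤ ρ) (hτ : ρ ≤ τ) (hst : s ≤ t) :
    |truncWeight τ ρ R t - Real.exp (-τ * (t - s)) * truncWeight τ ρ R s|
      ≤ ρ * (t - s) * truncWeight τ ρ R s := by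
  set a := min (Real.exp (ρ * s)) (Real.exp (ρ * R)) with ha
  set b := min (Real.exp (ρ * t)) (Real.exp (ρ * R)) with hb
  have ha0 : 0 ≤ a := by positivity
  have hab : a ≤ b := min_le_min_right _ (Real.exp_le_exp.2 (by nlinarith))
  have hba : b ≤ Real.exp (ρ * (t - s)) * a := by
    have h1 : 1 ≤ Real.exp (ρ * (t - s)) := Real.one_le_exp (by nlinarith)
    rw [ha, mul_min_of_nonneg _ _ (Real.exp_pos _).le]
    refine min_le_min ?_ ?_
    · rw [← Real.exp_add]; exact Real.exp_le_exp.2 (by linarith)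
    · nlinarith [Real.exp_pos (ρ * R)]
  have e1 : truncWeight τ ρ R t - Real.exp (-τ * (t - s)) * truncWeight τ ρ R s
      = Real.exp (-τ * t) * (b - a) := by
    unfold truncWeight
    rw [← ha, ← hb, ← mul_assoc, ← Real.exp_add]
    have : -τ * (t - s) + -τ * s = -τ * t := by ring
    rw [this]; ring
  have e2 : Real.exp (-τ * (t - s)) ≤ Real.exp (-ρ * (t - s)) :=
    Real.exp_le_exp.2 (by nlinarith)
  have e3 : 1 - ρ * (t - s) ≤ Real.exp (-ρ * (t - s)) := by
    have := Real.add_one_le_exp (-ρ * (t - s)); linarith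
  have e4 : Real.exp (-ρ * (t - s)) * Real.exp (ρ * (t - s)) = 1 := by
    rw [← Real.exp_add]; simp
  have e5 : 1 ≤ Real.exp (ρ * (t - s)) := Real.one_le_exp (by nlinarith)
  rw [e1, abs_of_nonneg (mul_nonneg (Real.exp_pos _).le (by linarith))]
  have e6 : Real.exp (-τ * t) = Real.exp (-τ * s) * Real.exp (-τ * (t - s)) := by
    rw [← Real.exp_add]; congr 1; ring
  have key : Real.exp (-τ * (t - s)) * (b - a) ≤ ρ * (t - s) * a := by
    calc Real.exp (-τ * (t - s)) * (b - a)
        ≤ Real.exp (-τ * (t - s)) * (Real.exp (ρ * (t - s)) * a - a) := by gcongr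
      _ = Real.exp (-τ * (t - s)) * ((Real.exp (ρ * (t - s)) - 1) * a) := by ring
      _ ≤ Real.exp (-ρ * (t - s)) * ((Real.exp (ρ * (t - s)) - 1) * a) := by
          have := mul_nonneg (by linarith : 0 ≤ Real.exp (ρ * (t - s)) - 1) ha0
          gcongr
      _ = (1 - Real.exp (-ρ * (t - s))) * a := by linear_combination a * e4
      _ ≤ _ := by gcongr; linarith
  rw [e6, mul_assoc]
  unfold truncWeight
  calc _ ≤ Real.exp (-τ * s) * (ρ * (t - s) * a) := by gcongr
    _ = _ := by ring

/-- One step of the bootstrap lowering the exponential weight. -/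
theorem memLp_step (hV : CausalVolterra h u f) {κ : ℝ} (hκ : 0 < κ)
    (hs : ∀ σ : ℝ, 0 < σ → ∀ y, κ ≤ ‖1 - 𝓕 (fun t : ℝ => (Real.exp (-σ * t) : ℂ) * h t) y‖)
    (hf : MemLp f 2) {ρ τ : ℝ} (hρ : 0 < ρ) (hτ : ρ ≤ τ)
    (hsmall : ENNReal.ofReal ρ * ∫⁻ t : ℝ, ‖(t : ℂ) * h t‖ₑ ≤ ENNReal.ofReal (κ / 2))
    (h1 : Integrable fun t : ℝ => (Real.exp (-τ * t) : ℂ) * u t)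
    (h2 : MemLp (fun t : ℝ => (Real.exp (-τ * t) : ℂ) * u t) 2) :
    MemLp (fun t : ℝ => (Real.exp (-(τ - ρ) * t) : ℂ) * u t) 2 := by
  have hτ0 : 0 < τ := hρ.trans_le hτ
  have hu := hV.u_meas
  have hh := hV.h_meas
  -- Coercivity on Re ω = τ costs κ; the commutator is a convolution with ρ t h, of L¹ norm at most
  -- κ/2, and is absorbed. The resulting bound is free of R, so Fatou applies as R grows.
  have hbound : ∀ R : ℝ, eLpNorm (fun t => (truncWeight τ ρ R t : ℂ) * u t) 2 volume
      ≤ ENNReal.ofReal (2 / κ) * eLpNorm f 2 volume := by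
    intro R
    set m := truncWeight τ ρ R with hm
    have hmc : Continuous m := continuous_truncWeight τ ρ R
    have hmm : Measurable m := hmc.measurable
    have hvm : Measurable fun t => (m t : ℂ) * u t := by fun_prop
    have hdom : ∀ t, ‖(m t : ℂ) * u t‖
        ≤ ‖(Real.exp (ρ * R) : ℂ) * ((Real.exp (-τ * t) : ℂ) * u t)‖ := by
      intro t
      simp only [norm_mul, Complex.norm_real, Real.norm_eq_abs, Real.abs_exp, ← mul_assoc,
        abs_of_nonneg (truncWeight_nonneg τ ρ R t), hm]
      gcongr
      exact truncWeight_le τ ρ R t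
    have hv1 : Integrable fun t => (m t : ℂ) * u t :=
      (h1.const_mul (Real.exp (ρ * R) : ℂ)).mono hvm.aestronglyMeasurable
        (Filter.Eventually.of_forall hdom)
    have hv2 : MemLp (fun t => (m t : ℂ) * u t) 2 :=
      (h2.const_mul (Real.exp (ρ * R) : ℂ)).mono hvm.aestronglyMeasurable
        (Filter.Eventually.of_forall hdom)
    have hmB : ∀ T, ∃ B, ∀ t, 0 < t → t ≤ T → |m t| ≤ B := by
      intro T
      obtain ⟨B, hB⟩ := (isCompact_Icc (a := (0:ℝ)) (b := T)).exists_bound_of_continuousOn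
        hmc.continuousOn
      exact ⟨B, fun t h0 hT => hB t ⟨h0.le, hT⟩⟩
    have hHint : Integrable fun t : ℝ => (Real.exp (-τ * t) : ℂ) * h t := by
      refine hV.h_int.norm.mono' (by fun_prop : Measurable _).aestronglyMeasurable
        (Filter.Eventually.of_forall fun r => ?_)
      rcases le_or_gt r 0 with hr | hr
      · simp [hV.h_causal r hr]
      · rw [norm_mul, Complex.norm_real, Real.norm_eq_abs, Real.abs_exp]
        have : Real.exp (-τ * r) ≤ 1 := Real.exp_le_one_iff.2 (by nlinarith)
        nlinarith [norm_nonneg (h r)]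
    have hA := eLpNorm_two_le_of_symbol (H := fun t : ℝ => (Real.exp (-τ * t) : ℂ) * h t)
      (by fun_prop) hvm hHint hv1 hv2 hκ (hs τ hτ0)
    refine absorb_half hκ hv2.2.ne (hA.trans ?_)
    have heq : (fun t => (m t : ℂ) * u t - ∫ s, ((Real.exp (-τ * (t - s)) : ℂ) * h (t - s)) *
        ((m s : ℂ) * u s)) = (fun t => (m t : ℂ) * f t) + fun t =>
          ∫ s, ((m t : ℂ) - Real.exp (-τ * (t - s)) * m s) * (h (t - s) * u s) := by
      ext t
      exact hV.weighted_eq hmm hmB hτ0.le t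
    have hmf : Measurable fun t => (m t : ℂ) * f t := by
      have := hV.f_meas
      fun_prop
    have hEm : AEStronglyMeasurable (fun t =>
        ∫ s, ((m t : ℂ) - Real.exp (-τ * (t - s)) * m s) * (h (t - s) * u s)) volume := by
      refine StronglyMeasurable.aestronglyMeasurable ?_
      have : StronglyMeasurable fun z : ℝ × ℝ =>
          ((m z.1 : ℂ) - Real.exp (-τ * (z.1 - z.2)) * m z.2) * (h (z.1 - z.2) * u z.2) :=
        (by fun_prop : Measurable _).stronglyMeasurable
      exact this.integral_prod_right'
    rw [heq]
    refine (eLpNorm_add_le hmf.aestronglyMeasurable hEm (by norm_num)).trans ?_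
    gcongr
    · refine eLpNorm_mono fun t => ?_
      rcases le_or_gt t 0 with ht | ht
      · simp [hV.f_causal ht]
      · rw [norm_mul, Complex.norm_real, Real.norm_eq_abs,
          abs_of_nonneg (truncWeight_nonneg τ ρ R t)]
        have : truncWeight τ ρ R t ≤ 1 := (truncWeight_le' τ ρ R t).trans
          (Real.exp_le_one_iff.2 (by nlinarith))
        nlinarith [norm_nonneg (f t)]
    · refine (eLpNorm_two_le_of_enorm_le_conv
        (A := fun r : ℝ => ENNReal.ofReal ρ * ‖(r : ℂ) * h r‖ₑ) (by fun_prop) hvm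
        fun t => ?_).trans ?_
      · refine (enorm_integral_le_lintegral_enorm _).trans (lintegral_mono fun s => ?_)
        rcases le_or_gt (t - s) 0 with hts | hts
        · simp [hV.h_causal _ hts]
        have hc := truncWeight_commutator (R := R) hρ.le hτ (by linarith : s ≤ t)
        rw [← hm] at hc
        have hρe : ENNReal.ofReal ρ = ‖(ρ : ℂ)‖ₑ := by
          rw [← ofReal_norm, Complex.norm_real, Real.norm_eq_abs, abs_of_pos hρ]
        rw [hρe]
        simp only [← enorm_mul]
        rw [enorm_le_iff_norm_le]
        simp only [norm_mul]
        have e : ‖((m t : ℂ) - Real.exp (-τ * (t - s)) * m s)‖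
            = |m t - Real.exp (-τ * (t - s)) * m s| := by
          rw [← Real.norm_eq_abs, ← Complex.norm_real]; push_cast; rfl
        rw [e]
        simp only [Complex.norm_real, Real.norm_eq_abs, abs_of_pos hρ,
          abs_of_nonneg (truncWeight_nonneg τ ρ R s), hm, abs_of_pos hts]
        calc _ ≤ ρ * (t - s) * truncWeight τ ρ R s * (‖h (t - s)‖ * ‖u s‖) := by gcongr
          _ = _ := by ring
      · rw [lintegral_const_mul _ (by fun_prop)]
        gcongr
  refine ⟨(by fun_prop : Measurable _).aestronglyMeasurable, ?_⟩
  refine (eLpNorm_two_le_of_tendsto (v := fun n : ℕ => fun t =>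
    (truncWeight τ ρ n t : ℂ) * u t) (fun n => ?_) (fun t => ?_) (fun n => hbound n)).trans_lt
    (ENNReal.mul_lt_top ENNReal.ofReal_lt_top hf.2)
  · have := (continuous_truncWeight τ ρ n).measurable
    fun_prop
  -- Once n ≥ t the cap is inactive, so the sequence is eventually constant.
  · refine tendsto_const_nhds.congr' ?_
    filter_upwards [Filter.eventually_ge_atTop ⌈t⌉₊] with n hn
    have htn : t ≤ n := (Nat.le_ceil t).trans (by exact_mod_cast hn)
    congr 2
    unfold truncWeight
    rw [min_eq_left (Real.exp_le_exp.2 (by nlinarith)), ← Real.exp_add]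
    congr 1; ring

/-- For a large exponential weight the solution is square integrable. -/
theorem memLp_of_large_weight (hV : CausalVolterra h u f) {M : ℝ} (hM0 : 0 < M)
    (hM : ∀ t, ‖h t‖ ≤ M) (hf : MemLp f 2) :
    MemLp (fun t : ℝ => (Real.exp (-(2 * M) * t) : ℂ) * u t) 2 := by
  have hu := hV.u_meas
  have hh := hV.h_meas
  have hf_meas := hV.f_meas
  -- The weight 2M makes the kernel mass at most M/(2M) = 1/2: a contraction that needs no
  -- stability.
  have hH : ∫⁻ t : ℝ, ‖(Real.exp (-(2 * M) * t) : ℂ) * h t‖ₑ ≤ ENNReal.ofReal (1 / 2) := by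
    have e : ∫ t in Set.Ioi (0:ℝ), M * Real.exp (-(2 * M) * t) = 1 / 2 := by
      rw [integral_const_mul, integral_exp_mul_Ioi (by linarith)]
      simp; field_simp
    calc ∫⁻ t : ℝ, ‖(Real.exp (-(2 * M) * t) : ℂ) * h t‖ₑ
        ≤ ∫⁻ t : ℝ, Set.indicator (Set.Ioi 0)
            (fun t => ENNReal.ofReal (M * Real.exp (-(2 * M) * t))) t := by
          refine lintegral_mono fun t => ?_
          rcases le_or_gt t 0 with ht | ht
          · simp [hV.h_causal t ht]
          · rw [Set.indicator_of_mem (show t ∈ Set.Ioi (0:ℝ) from ht), ← ofReal_norm, norm_mul,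
              Complex.norm_real, Real.norm_eq_abs, Real.abs_exp, mul_comm]
            gcongr
            exact hM t
      _ = ENNReal.ofReal (1 / 2) := by
          rw [lintegral_indicator measurableSet_Ioi, ← e,
            ofReal_integral_eq_lintegral_ofReal]
          · exact (integrableOn_exp_mul_Ioi (by linarith) 0).const_mul M
          · exact Filter.Eventually.of_forall fun t => by positivity
      _ ≤ _ := le_rfl
  have hbound : ∀ T : ℝ, eLpNorm (fun t => ((Set.indicator (Set.Iic T)
      (fun t => Real.exp (-(2 * M) * t)) t : ℝ) : ℂ) * u t) 2 volume
      ≤ ENNReal.ofReal (2 / 1) * eLpNorm f 2 volume := by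
    intro T
    set m : ℝ → ℝ := Set.indicator (Set.Iic T) (fun t => Real.exp (-(2 * M) * t)) with hm
    have hmm : Measurable m := (by fun_prop : Measurable _).indicator measurableSet_Iic
    have hm0 : ∀ t, 0 ≤ m t := fun t => Set.indicator_nonneg (fun _ _ => (Real.exp_pos _).le) t
    have hm1 : ∀ t, 0 < t → m t ≤ 1 := by
      intro t ht
      rw [hm, Set.indicator_apply]
      split_ifs
      · exact Real.exp_le_one_iff.2 (by nlinarith)
      · exact zero_le_one
    have hvm : Measurable fun t => (m t : ℂ) * u t := by fun_prop
    obtain ⟨B, hB⟩ := hV.u_bdd T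
    have hsupp : (fun t => (m t : ℂ) * u t)
        = Set.indicator (Set.Ioc 0 T) fun t => (m t : ℂ) * u t := by
      ext t
      rw [Set.indicator_apply]
      split_ifs with ht
      · rfl
      · rcases le_or_gt t 0 with h0 | h0
        · simp [hV.u_causal t h0]
        · have hT : t ∉ Set.Iic T := fun h' => ht ⟨h0, h'⟩
          simp [hm, Set.indicator_of_notMem hT]
    have hv2 : MemLp (fun t => (m t : ℂ) * u t) 2 := by
      rw [hsupp, memLp_indicator_iff_restrict measurableSet_Ioc]
      refine MemLp.of_bound hvm.aestronglyMeasurable B ?_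
      filter_upwards [ae_restrict_mem measurableSet_Ioc] with t ht
      rw [norm_mul, Complex.norm_real, Real.norm_eq_abs, abs_of_nonneg (hm0 t)]
      calc m t * ‖u t‖ ≤ 1 * ‖u t‖ := by gcongr; exact hm1 t ht.1
        _ ≤ B := by rw [one_mul]; exact hB t ht.2
    have heq : (fun t => (m t : ℂ) * u t) = (fun t => (m t : ℂ) * f t) + fun t =>
        ∫ s, (m t : ℂ) * (h (t - s) * u s) := by
      ext t
      simp only [Pi.add_apply]
      rw [integral_const_mul, ← mul_add, ← hV.eq t]
    -- Taking κ = 1 makes the absorbed fraction exactly the 1/2 gained above. The cutoff at T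
    -- commutes harmlessly with the kernel: by causality, times t ≤ T only see s < t ≤ T.
    refine absorb_half one_pos hv2.2.ne ?_
    rw [ENNReal.ofReal_one, one_mul]
    have hmf : Measurable fun t => (m t : ℂ) * f t := by fun_prop
    have hEm : AEStronglyMeasurable (fun t => ∫ s, (m t : ℂ) * (h (t - s) * u s)) volume := by
      refine StronglyMeasurable.aestronglyMeasurable ?_
      have : StronglyMeasurable fun z : ℝ × ℝ => (m z.1 : ℂ) * (h (z.1 - z.2) * u z.2) :=
        (by fun_prop : Measurable _).stronglyMeasurable
      exact this.integral_prod_right'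
    conv_lhs => rw [heq]
    refine (eLpNorm_add_le hmf.aestronglyMeasurable hEm (by norm_num)).trans ?_
    refine add_le_add ?_ ?_
    · refine eLpNorm_mono fun t => ?_
      rcases le_or_gt t 0 with ht | ht
      · simp [hV.f_causal ht]
      · rw [norm_mul, Complex.norm_real, Real.norm_eq_abs, abs_of_nonneg (hm0 t)]
        nlinarith [norm_nonneg (f t), hm1 t ht]
    · refine (eLpNorm_two_le_of_enorm_le_conv
        (A := fun r : ℝ => ‖(Real.exp (-(2 * M) * r) : ℂ) * h r‖ₑ) (by fun_prop) hvm
        fun t => ?_).trans (by gcongr)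
      refine (enorm_integral_le_lintegral_enorm _).trans (lintegral_mono fun s => ?_)
      rw [← enorm_mul]
      rcases le_or_gt (t - s) 0 with hts | hts
      · simp [hV.h_causal _ hts]
      by_cases htT : t ∈ Set.Iic T
      · have hsT : s ∈ Set.Iic T := by
          have : t ≤ T := htT
          exact (by linarith : s ≤ T)
        refine le_of_eq (congrArg _ ?_)
        simp only [hm, Set.indicator_of_mem htT, Set.indicator_of_mem hsT]
        have : Real.exp (-(2 * M) * t) = Real.exp (-(2 * M) * (t - s)) * Real.exp (-(2 * M) * s) := by
          rw [← Real.exp_add]; congr 1; ring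
        rw [this]; push_cast; ring
      · simp [hm, Set.indicator_of_notMem htT]
  refine ⟨(by fun_prop : Measurable _).aestronglyMeasurable, ?_⟩
  refine (eLpNorm_two_le_of_tendsto (v := fun n : ℕ => fun t => ((Set.indicator (Set.Iic (n : ℝ))
      (fun t => Real.exp (-(2 * M) * t)) t : ℝ) : ℂ) * u t) (fun n => ?_) (fun t => ?_)
      (fun n => hbound n)).trans_lt
    (ENNReal.mul_lt_top ENNReal.ofReal_lt_top hf.2)
  · have : Measurable (Set.indicator (Set.Iic (n : ℝ)) (fun t => Real.exp (-(2 * M) * t))) :=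
      (by fun_prop : Measurable _).indicator measurableSet_Iic
    fun_prop
  · refine tendsto_const_nhds.congr' ?_
    filter_upwards [Filter.eventually_ge_atTop ⌈t⌉₊] with n hn
    have htn : t ∈ Set.Iic (n : ℝ) := (Nat.le_ceil t).trans (by exact_mod_cast hn)
    rw [Set.indicator_of_mem htn]

/-- The solution is integrable and square integrable for every positive exponential weight. -/
theorem integrable_memLp_weight (hV : CausalVolterra h u f) {κ M : ℝ} (hκ : 0 < κ) (hM0 : 0 < M)
    (hM : ∀ t, ‖h t‖ ≤ M) (hmom : Integrable fun t : ℝ => (t : ℂ) * h t)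
    (hs : ∀ σ : ℝ, 0 < σ → ∀ y, κ ≤ ‖1 - 𝓕 (fun t : ℝ => (Real.exp (-σ * t) : ℂ) * h t) y‖)
    (hf : MemLp f 2) {σ : ℝ} (hσ : 0 < σ) :
    Integrable (fun t : ℝ => (Real.exp (-σ * t) : ℂ) * u t) ∧
      MemLp (fun t : ℝ => (Real.exp (-σ * t) : ℂ) * u t) 2 := by
  have hu := hV.u_meas
  -- Any strict increase of the weight keeps L² and also gives back L¹.
  have mono : ∀ {a b : ℝ}, a < b → MemLp (fun t : ℝ => (Real.exp (-a * t) : ℂ) * u t) 2 →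
      Integrable (fun t : ℝ => (Real.exp (-b * t) : ℂ) * u t) ∧
      MemLp (fun t : ℝ => (Real.exp (-b * t) : ℂ) * u t) 2 := by
    intro a b hab h2
    constructor
    · have := integrable_exp_weight_mul (fun t ht => by simp [hV.u_causal t ht]) h2
        (sub_pos.2 hab)
      refine this.congr (Filter.Eventually.of_forall fun t => ?_)
      simp only [← mul_assoc, ← Complex.ofReal_mul, ← Real.exp_add]
      congr 3; ring
    · refine h2.mono (by fun_prop : Measurable _).aestronglyMeasurable
        (Filter.Eventually.of_forall fun t => ?_)
      rcases le_or_gt t 0 with ht | ht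
      · simp [hV.u_causal t ht]
      · simp only [norm_mul, Complex.norm_real, Real.norm_eq_abs, Real.abs_exp]
        gcongr
  -- The first moment of h fixes the step size. The minimum with σ lets the descent, which stays at
  -- weights at least ρ/2, reach σ; I + 1 avoids dividing by a vanishing moment.
  obtain ⟨ρ, hρ, hρσ, hsmall⟩ : ∃ ρ : ℝ, 0 < ρ ∧ ρ / 2 ≤ σ ∧
      ENNReal.ofReal ρ * ∫⁻ t : ℝ, ‖(t : ℂ) * h t‖ₑ ≤ ENNReal.ofReal (κ / 2) := by
    set I := ∫ t : ℝ, ‖(t : ℂ) * h t‖ with hI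
    have hI0 : 0 ≤ I := integral_nonneg fun _ => norm_nonneg _
    refine ⟨min σ (κ / 2 / (I + 1)), by positivity, ?_, ?_⟩
    · linarith [min_le_left σ (κ / 2 / (I + 1))]
    · rw [← ofReal_integral_norm_eq_lintegral_enorm hmom, ← ENNReal.ofReal_mul (by positivity)]
      refine ENNReal.ofReal_le_ofReal ?_
      calc min σ (κ / 2 / (I + 1)) * I ≤ κ / 2 / (I + 1) * (I + 1) := by
            gcongr
            · exact min_le_right _ _
            · linarith
        _ = κ / 2 := by field_simp
  -- One round starts at τ + ρ/2, which is at least ρ, drops by ρ to τ - ρ/2, then climbs to τ to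
  -- restore L¹: a net gain of ρ/2. The start 2M + 1 lies strictly above 2M so that `mono` applies
  -- there too.
  have ind : ∀ n : ℕ, ∀ τ : ℝ, ρ / 2 ≤ τ → 2 * M + 1 - n * (ρ / 2) ≤ τ →
      Integrable (fun t : ℝ => (Real.exp (-τ * t) : ℂ) * u t) ∧
      MemLp (fun t : ℝ => (Real.exp (-τ * t) : ℂ) * u t) 2 := by
    intro n
    induction n with
    | zero =>
      intro τ _ hτ
      exact mono (by push_cast at hτ; linarith) (hV.memLp_of_large_weight hM0 hM hf)
    | succ n ih =>
      intro τ hτ hτ'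
      obtain ⟨i1, i2⟩ := ih (τ + ρ / 2) (by linarith) (by push_cast at hτ'; linarith)
      exact mono (by linarith) (hV.memLp_step hκ hs hf hρ (by linarith) hsmall i1 i2)
  obtain ⟨n, hn⟩ := exists_nat_gt ((2 * M + 1) / (ρ / 2))
  refine ind n σ hρσ ?_
  rw [div_lt_iff₀ (by positivity)] at hn
  linarith

/-- The `L²` stability estimate for causal Volterra equations. -/
theorem eLpNorm_le (hV : CausalVolterra h u f) {κ M : ℝ} (hκ : 0 < κ) (hM0 : 0 < M)
    (hM : ∀ t, ‖h t‖ ≤ M) (hmom : Integrable fun t : ℝ => (t : ℂ) * h t)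
    (hs : ∀ σ : ℝ, 0 < σ → ∀ y, κ ≤ ‖1 - 𝓕 (fun t : ℝ => (Real.exp (-σ * t) : ℂ) * h t) y‖) :
    eLpNorm u 2 volume ≤ ENNReal.ofReal (1 / κ) * eLpNorm f 2 volume := by
  by_cases hf : eLpNorm f 2 volume = ∞
  · rw [hf, ENNReal.mul_top (by simpa using hκ)]; exact le_top
  have hf : MemLp f 2 := ⟨hV.f_meas.aestronglyMeasurable, lt_top_iff_ne_top.2 hf⟩
  have hu := hV.u_meas
  have hh := hV.h_meas
  -- Conjugation by a pure exponential is exact for convolutions. There is no commutator, hence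
  -- nothing to absorb, and the constant is 1/κ instead of 2/κ.
  have hbound : ∀ σ : ℝ, 0 < σ → eLpNorm (fun t : ℝ => (Real.exp (-σ * t) : ℂ) * u t) 2 volume
      ≤ ENNReal.ofReal (1 / κ) * eLpNorm f 2 volume := by
    intro σ hσ
    obtain ⟨i1, i2⟩ := hV.integrable_memLp_weight hκ hM0 hM hmom hs hf hσ
    have hHint : Integrable fun t : ℝ => (Real.exp (-σ * t) : ℂ) * h t := by
      refine hV.h_int.norm.mono' (by fun_prop : Measurable _).aestronglyMeasurable
        (Filter.Eventually.of_forall fun r => ?_)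
      rcases le_or_gt r 0 with hr | hr
      · simp [hV.h_causal r hr]
      · rw [norm_mul, Complex.norm_real, Real.norm_eq_abs, Real.abs_exp]
        have : Real.exp (-σ * r) ≤ 1 := Real.exp_le_one_iff.2 (by nlinarith)
        nlinarith [norm_nonneg (h r)]
    have hA := eLpNorm_two_le_of_symbol (H := fun t : ℝ => (Real.exp (-σ * t) : ℂ) * h t)
      (by fun_prop) (by fun_prop) hHint i1 i2 hκ (hs σ hσ)
    have heq : (fun t : ℝ => (Real.exp (-σ * t) : ℂ) * u t -
        ∫ s, ((Real.exp (-σ * (t - s)) : ℂ) * h (t - s)) * ((Real.exp (-σ * s) : ℂ) * u s))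
        = fun t => (Real.exp (-σ * t) : ℂ) * f t := by
      ext t
      have : (∫ s, ((Real.exp (-σ * (t - s)) : ℂ) * h (t - s)) * ((Real.exp (-σ * s) : ℂ) * u s))
          = ∫ s, (Real.exp (-σ * t) : ℂ) * (h (t - s) * u s) := by
        congr 1; ext s
        have : Real.exp (-σ * t) = Real.exp (-σ * (t - s)) * Real.exp (-σ * s) := by
          rw [← Real.exp_add]; congr 1; ring
        rw [this]; push_cast; ring
      rw [this, integral_const_mul]
      conv_lhs => rw [hV.eq t]
      ring
    rw [heq] at hA
    have hf1 : eLpNorm (fun t : ℝ => (Real.exp (-σ * t) : ℂ) * f t) 2 volume ≤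
        eLpNorm f 2 volume := by
      refine eLpNorm_mono fun t => ?_
      rcases le_or_gt t 0 with ht | ht
      · simp [hV.f_causal ht]
      · rw [norm_mul, Complex.norm_real, Real.norm_eq_abs, Real.abs_exp]
        have : Real.exp (-σ * t) ≤ 1 := Real.exp_le_one_iff.2 (by nlinarith)
        nlinarith [norm_nonneg (f t)]
    calc eLpNorm (fun t : ℝ => (Real.exp (-σ * t) : ℂ) * u t) 2 volume
        = ENNReal.ofReal (1 / κ) * (ENNReal.ofReal κ *
            eLpNorm (fun t : ℝ => (Real.exp (-σ * t) : ℂ) * u t) 2 volume) := by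
          rw [← mul_assoc, ← ENNReal.ofReal_mul (by positivity), one_div_mul_cancel hκ.ne',
            ENNReal.ofReal_one, one_mul]
      _ ≤ _ := by gcongr; exact hA.trans hf1
  refine eLpNorm_two_le_of_tendsto (v := fun n : ℕ => fun t : ℝ =>
    (Real.exp (-(1 / ((n : ℝ) + 1)) * t) : ℂ) * u t) (fun n => by fun_prop) (fun t => ?_)
    (fun n => hbound _ (by positivity))
  have h1 : Filter.Tendsto (fun n : ℕ => -(1 / ((n : ℝ) + 1)) * t) Filter.atTop (nhds (-0 * t)) :=
    (tendsto_one_div_add_atTop_nhds_zero_nat.neg).mul_const t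
  have h2 : Filter.Tendsto (fun n : ℕ => (Real.exp (-(1 / ((n : ℝ) + 1)) * t) : ℂ) * u t)
      Filter.atTop (nhds ((Real.exp (-0 * t) : ℂ) * u t)) :=
    ((Complex.continuous_ofReal.comp Real.continuous_exp).continuousAt.tendsto.comp h1).mul_const _
  simpa using h2

end CausalVolterra

/-- The `L²(0,∞)` stability estimate for Volterra equations with a kernel whose Laplace transform
stays away from `1`. -/
theorem volterra_eLpNorm_le {h u f : ℝ → ℂ} (hh : Continuous h) (hu : ContinuousOn u (Set.Ici 0))
    {κ M : ℝ} (hκ : 0 < κ) (hM : ∀ t, ‖h t‖ ≤ M) (hInt : IntegrableOn h (Set.Ioi 0))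
    (hmom : IntegrableOn (fun t : ℝ => (t : ℂ) * h t) (Set.Ioi 0))
    (hs : ∀ ω : ℂ, 0 < ω.re → κ ≤ ‖1 - laplace h ω‖)
    (heq : ∀ t, 0 < t → u t = f t + ∫ s in (0 : ℝ)..t, h (t - s) * u s) :
    eLpNorm u 2 (volume.restrict (Set.Ioi 0)) ≤
      ENNReal.ofReal (1 / κ) * eLpNorm f 2 (volume.restrict (Set.Ioi 0)) := by
  set I : Set ℝ := Set.Ioi 0 with hI
  have hIm : MeasurableSet I := measurableSet_Ioi
  have hHm : Measurable (I.indicator h) := hh.measurable.indicator hIm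
  have hUm : Measurable (I.indicator u) := by
    rw [← Set.piecewise_eq_indicator]
    exact (hu.mono Set.Ioi_subset_Ici_self).measurable_piecewise continuousOn_const hIm
  have hconv : ∀ t, 0 < t → ∫ s, I.indicator h (t - s) * I.indicator u s
      = ∫ s in (0 : ℝ)..t, h (t - s) * u s := by
    intro t ht
    rw [intervalIntegral.integral_of_le ht.le, integral_Ioc_eq_integral_Ioo,
      ← integral_indicator measurableSet_Ioo]
    congr 1; ext s
    by_cases h1 : s ∈ Set.Ioo 0 t
    · rw [Set.indicator_of_mem h1, Set.indicator_of_mem (show t - s ∈ I from sub_pos.2 h1.2),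
        Set.indicator_of_mem (show s ∈ I from h1.1)]
    · rw [Set.indicator_of_notMem h1]
      by_cases h2 : s ∈ I
      · have : t - s ∉ I := fun h3 => h1 ⟨h2, sub_pos.1 h3⟩
        rw [Set.indicator_of_notMem this, zero_mul]
      · rw [Set.indicator_of_notMem h2, mul_zero]
  have hconv0 : ∀ t, t ≤ 0 → ∫ s, I.indicator h (t - s) * I.indicator u s = 0 := by
    intro t ht
    rw [← integral_zero ℝ ℂ]
    congr 1; ext s
    by_cases h2 : s ∈ I
    · have h2' : 0 < s := h2
      have : t - s ∉ I := fun h3 => by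
        have h3' : 0 < t - s := h3
        linarith
      rw [Set.indicator_of_notMem this, zero_mul]
    · rw [Set.indicator_of_notMem h2, mul_zero]
  have hEq : ∀ t, I.indicator u t = I.indicator f t + ∫ s, I.indicator h (t - s) * I.indicator u s := by
    intro t
    rcases le_or_gt t 0 with ht | ht
    · have : t ∉ I := not_lt.2 ht
      rw [hconv0 t ht, Set.indicator_of_notMem this, Set.indicator_of_notMem this, zero_add]
    · have : t ∈ I := ht
      rw [hconv t ht, Set.indicator_of_mem this, Set.indicator_of_mem this, heq t ht]
  have hV : CausalVolterra (I.indicator h) (I.indicator u) (I.indicator f) := by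
    refine ⟨hHm, hUm, ?_, fun t ht => Set.indicator_of_notMem (not_lt.2 ht) _,
      fun t ht => Set.indicator_of_notMem (not_lt.2 ht) _,
      (integrable_indicator_iff hIm).2 hInt, fun T => ?_, hEq⟩
    · have : I.indicator f = fun t =>
          I.indicator u t - ∫ s, I.indicator h (t - s) * I.indicator u s := by
        ext t; rw [hEq t]; ring
      rw [this]
      have h2 : StronglyMeasurable fun z : ℝ × ℝ => I.indicator h (z.1 - z.2) * I.indicator u z.2 :=
        (by fun_prop : Measurable _).stronglyMeasurable
      exact hUm.sub h2.integral_prod_right'.measurable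
    · obtain ⟨B, hB⟩ := (isCompact_Icc (a := (0:ℝ)) (b := T)).exists_bound_of_continuousOn
        (hu.mono Set.Icc_subset_Ici_self)
      refine ⟨|B|, fun t ht => ?_⟩
      by_cases h2 : t ∈ I
      · rw [Set.indicator_of_mem h2]
        exact (hB t ⟨le_of_lt h2, ht⟩).trans (le_abs_self _)
      · rw [Set.indicator_of_notMem h2]; simp
  have hM0 : 0 ≤ M := (norm_nonneg _).trans (hM 0)
  -- M may be 0, while the large-weight step needs a strictly positive bound.
  have := hV.eLpNorm_le (M := M + 1) hκ (by linarith) (fun t => ?_) ?_ ?_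
  · rwa [eLpNorm_indicator_eq_eLpNorm_restrict hIm, eLpNorm_indicator_eq_eLpNorm_restrict hIm] at this
  · exact (norm_indicator_le_norm_self _ _).trans ((hM t).trans (by linarith))
  · have e : (fun t : ℝ => (t : ℂ) * I.indicator h t) = I.indicator fun t : ℝ => (t : ℂ) * h t := by
      ext t; by_cases h2 : t ∈ I <;> simp [h2]
    rw [e]
    exact (integrable_indicator_iff hIm).2 hmom
  · intro σ hσ y
    -- The Fourier transform of the damped kernel is the Laplace transform on the vertical line Re ω
    -- = σ.
    have hω := hs (σ + 2 * Real.pi * y * Complex.I) (by simpa using hσ)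
    have : 𝓕 (fun t : ℝ => (Real.exp (-σ * t) : ℂ) * I.indicator h t) y
        = laplace h (σ + 2 * Real.pi * y * Complex.I) := by
      rw [Real.fourier_real_eq_integral_exp_smul, laplace, ← integral_indicator hIm]
      congr 1; ext t
      by_cases h2 : t ∈ I
      · simp only [Set.indicator_of_mem h2, smul_eq_mul]
        rw [← mul_assoc]
        push_cast
        rw [← Complex.exp_add]
        congr 2; ring
      · simp [h2]
    rw [this]; exact hω

end Alber

/-! ### Slices and position density of Schwartz functions on phase space -/

namespace Alber

open scoped LineDeriv

/-- The position derivative of a Schwartz function on phase space. -/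
noncomputable def dX (w : 𝓢(ℝ × ℝ, ℂ)) : 𝓢(ℝ × ℝ, ℂ) := ∂_{((1 : ℝ), (0 : ℝ))} w

/-- The wavenumber derivative of a Schwartz function on phase space. -/
noncomputable def dK (w : 𝓢(ℝ × ℝ, ℂ)) : 𝓢(ℝ × ℝ, ℂ) := ∂_{((0 : ℝ), (1 : ℝ))} w

/-- The restriction of a Schwartz function on phase space to the line of fixed wavenumber `k`. -/
noncomputable def sliceX (k : ℝ) : 𝓢(ℝ × ℝ, ℂ) →L[ℂ] 𝓢(ℝ, ℂ) :=
  SchwartzMap.compCLMOfAntilipschitz (K := 1) (g := fun x : ℝ => (x, k)) ℂ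
    (by
      have : (fun x : ℝ => (x, k)) = fun x : ℝ => ContinuousLinearMap.inl ℝ ℝ ℝ x + ((0 : ℝ), k) := by
        ext x <;> simp
      rw [this]
      exact (ContinuousLinearMap.inl ℝ ℝ ℝ).hasTemperateGrowth.add (.const _))
    (AntilipschitzWith.of_le_mul_dist fun x y => by simp [Prod.dist_eq])

/-- The restriction of a Schwartz function on phase space to the line of fixed position `x`. -/
noncomputable def sliceK (x : ℝ) : 𝓢(ℝ × ℝ, ℂ) →L[ℂ] 𝓢(ℝ, ℂ) :=
  SchwartzMap.compCLMOfAntilipschitz (K := 1) (g := fun k : ℝ => (x, k)) ℂ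
    (by
      have : (fun k : ℝ => (x, k)) = fun k : ℝ => ContinuousLinearMap.inr ℝ ℝ ℝ k + (x, (0 : ℝ)) := by
        ext k <;> simp
      rw [this]
      exact (ContinuousLinearMap.inr ℝ ℝ ℝ).hasTemperateGrowth.add (.const _))
    (AntilipschitzWith.of_le_mul_dist fun x y => by simp [Prod.dist_eq])

@[simp] theorem sliceX_apply (k : ℝ) (w : 𝓢(ℝ × ℝ, ℂ)) (x : ℝ) : sliceX k w x = w (x, k) := rfl

theorem hasDerivAt_fst (w : 𝓢(ℝ × ℝ, ℂ)) (x k : ℝ) :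
    HasDerivAt (fun y => w (y, k)) ((dX w) (x, k)) x := by
  rw [dX, SchwartzMap.lineDerivOp_apply_eq_fderiv]
  have h1 : HasDerivAt (fun y : ℝ => (y, k)) ((1 : ℝ), (0 : ℝ)) x :=
    (hasDerivAt_id x).prodMk (hasDerivAt_const x k)
  exact (w.hasFDerivAt (x, k)).comp_hasDerivAt x h1

theorem hasDerivAt_snd (w : 𝓢(ℝ × ℝ, ℂ)) (x k : ℝ) :
    HasDerivAt (fun y => w (x, y)) ((dK w) (x, k)) k := by
  rw [dK, SchwartzMap.lineDerivOp_apply_eq_fderiv]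
  have h1 : HasDerivAt (fun y : ℝ => (x, y)) ((0 : ℝ), (1 : ℝ)) k :=
    (hasDerivAt_const k x).prodMk (hasDerivAt_id k)
  exact (w.hasFDerivAt (x, k)).comp_hasDerivAt k h1

theorem derivCLM_sliceX (k : ℝ) (w : 𝓢(ℝ × ℝ, ℂ)) :
    SchwartzMap.derivCLM ℂ ℂ (sliceX k w) = sliceX k (dX w) := by
  ext x
  exact (hasDerivAt_fst w x k).deriv

theorem derivCLM_sliceK (x : ℝ) (w : 𝓢(ℝ × ℝ, ℂ)) :
    SchwartzMap.derivCLM ℂ ℂ (sliceK x w) = sliceK x (dK w) := by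
  ext k
  exact (hasDerivAt_snd w x k).deriv

/-- Two extra powers of the phase-space norm buy the factor (1+k²)⁻¹, a majorant integrable in k and
uniform in x. -/
theorem pow_mul_norm_le (w : 𝓢(ℝ × ℝ, ℂ)) (j n : ℕ) (x k : ℝ) :
    |x| ^ j * ‖(dX^[n] w) (x, k)‖ ≤
      (SchwartzMap.seminorm ℂ j n w + SchwartzMap.seminorm ℂ (j + 2) n w) * (1 + k ^ 2)⁻¹ := by
  have hb : ‖(dX^[n] w) (x, k)‖ ≤ ‖iteratedFDeriv ℝ n w (x, k)‖ := by
    have hd : dX = LineDeriv.lineDerivOp (((1 : ℝ), (0 : ℝ))) := rfl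
    rw [hd, ← LineDeriv.iteratedLineDerivOp_const_eq_iter_lineDerivOp,
      SchwartzMap.iteratedLineDerivOp_eq_iteratedFDeriv]
    refine (ContinuousMultilinearMap.le_opNorm _ _).trans ?_
    simp [Prod.norm_def]
  have h1 := SchwartzMap.le_seminorm ℂ j n w (x, k)
  have h2 := SchwartzMap.le_seminorm ℂ (j + 2) n w (x, k)
  have hx : |x| ≤ ‖(x, k)‖ := norm_fst_le (x, k)
  have hk : |k| ≤ ‖(x, k)‖ := norm_snd_le (x, k)
  rw [← div_eq_mul_inv, le_div_iff₀ (by positivity)]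
  set N := ‖(x, k)‖
  set D := ‖iteratedFDeriv ℝ n w (x, k)‖
  have hxj : |x| ^ j ≤ N ^ j := by gcongr
  have hk2 : k ^ 2 ≤ N ^ 2 := by rw [← sq_abs]; gcongr
  calc |x| ^ j * ‖(dX^[n] w) (x, k)‖ * (1 + k ^ 2)
      ≤ N ^ j * D * (1 + N ^ 2) := by gcongr
    _ = N ^ j * D + N ^ (j + 2) * D := by ring
    _ ≤ _ := add_le_add h1 h2

theorem hasDerivAt_density (w : 𝓢(ℝ × ℝ, ℂ)) (x : ℝ) :
    HasDerivAt (density w) (density (dX w) x) x := by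
  exact (hasDerivAt_integral_of_dominated_loc_of_deriv_le (s := Set.univ)
    (F := fun y ξ => w (y, ξ)) (F' := fun y ξ => (dX w) (y, ξ))
    (bound := fun ξ => (SchwartzMap.seminorm ℂ 0 1 w + SchwartzMap.seminorm ℂ (0 + 2) 1 w) *
      (1 + ξ ^ 2)⁻¹) Filter.univ_mem
    (Filter.Eventually.of_forall fun y => (sliceK y w).continuous.aestronglyMeasurable)
    (sliceK x w).integrable (sliceK x (dX w)).continuous.aestronglyMeasurable
    (Filter.Eventually.of_forall fun ξ y _ => by simpa using pow_mul_norm_le w 0 1 y ξ)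
    (integrable_inv_one_add_sq.const_mul _)
    (Filter.Eventually.of_forall fun ξ y _ => hasDerivAt_fst w y ξ)).2

theorem iteratedDeriv_density (w : 𝓢(ℝ × ℝ, ℂ)) (n : ℕ) :
    iteratedDeriv n (density w) = density (dX^[n] w) := by
  induction n with
  | zero => simp
  | succ n ih =>
    rw [iteratedDeriv_succ, ih, Function.iterate_succ_apply']
    ext x
    exact (hasDerivAt_density _ x).deriv

/-- The position density as a continuous linear map between Schwartz spaces. -/
noncomputable def densityCLM : 𝓢(ℝ × ℝ, ℂ) →L[ℂ] 𝓢(ℝ, ℂ) :=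
  SchwartzMap.mkCLM (σ := RingHom.id ℂ) (fun w => density w)
    (fun f g x => integral_add (sliceK x f).integrable (sliceK x g).integrable)
    (fun a f x => integral_const_mul a _)
    (fun f => contDiff_of_differentiable_iteratedDeriv fun n _ => by
      rw [iteratedDeriv_density]
      exact fun x => (hasDerivAt_density _ x).differentiableAt)
    (fun n => by
      -- The factor 2 counts the two seminorms in `pow_mul_norm_le`, and π is the integral of
      -- (1+ξ²)⁻¹.
      refine ⟨{n, (n.1 + 2, n.2)}, 2 * Real.pi, by positivity, fun w x => ?_⟩
      rw [norm_iteratedFDeriv_eq_norm_iteratedDeriv, iteratedDeriv_density]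
      set S := (({n, (n.1 + 2, n.2)} : Finset (ℕ × ℕ)).sup
        (schwartzSeminormFamily ℂ (ℝ × ℝ) ℂ)) w with hS
      have s1 : SchwartzMap.seminorm ℂ n.1 n.2 w ≤ S :=
        Seminorm.le_def.1 (Finset.le_sup (f := schwartzSeminormFamily ℂ (ℝ × ℝ) ℂ)
          (show n ∈ ({n, (n.1 + 2, n.2)} : Finset (ℕ × ℕ)) by simp)) w
      have s2 : SchwartzMap.seminorm ℂ (n.1 + 2) n.2 w ≤ S :=
        Seminorm.le_def.1 (Finset.le_sup (f := schwartzSeminormFamily ℂ (ℝ × ℝ) ℂ)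
          (show (n.1 + 2, n.2) ∈ ({n, (n.1 + 2, n.2)} : Finset (ℕ × ℕ)) by simp)) w
      calc ‖x‖ ^ n.1 * ‖density (dX^[n.2] w) x‖
          = ‖∫ ξ : ℝ, ((‖x‖ ^ n.1 : ℝ) : ℂ) * (dX^[n.2] w) (x, ξ)‖ := by
            rw [integral_const_mul, norm_mul, Complex.norm_real]
            simp [density]
        _ ≤ ∫ ξ : ℝ, 2 * S * (1 + ξ ^ 2)⁻¹ := by
            refine norm_integral_le_of_norm_le (integrable_inv_one_add_sq.const_mul _)
              (Filter.Eventually.of_forall fun ξ => ?_)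
            rw [norm_mul, Complex.norm_real, norm_pow, norm_norm]
            refine (pow_mul_norm_le w n.1 n.2 x ξ).trans ?_
            gcongr
            linarith
        _ = 2 * Real.pi * S := by
            rw [integral_const_mul, integral_univ_inv_one_add_sq]; ring)

theorem densityCLM_apply (w : 𝓢(ℝ × ℝ, ℂ)) (x : ℝ) : densityCLM w x = density w x := rfl

theorem coe_densityCLM (w : 𝓢(ℝ × ℝ, ℂ)) : ⇑(densityCLM w) = density w := rfl

end Alber

/-! ### The interaction as a Fourier multiplier; Fourier transform of the time evolution -/

namespace Alber

theorem fourier_eq_integral (f : ℝ → ℂ) (X : ℝ) :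
    𝓕 f X = ∫ x : ℝ, Complex.exp (-2 * Real.pi * Complex.I * X * x) * f x := by
  rw [Real.fourier_real_eq_integral_exp_smul]
  congr 1; ext x
  rw [smul_eq_mul]; congr 2; push_cast; ring

theorem fourierInv_eq_integral (f : ℝ → ℂ) (x : ℝ) :
    𝓕⁻ f x = ∫ X : ℝ, Complex.exp (2 * Real.pi * Complex.I * X * x) * f X := by
  rw [Real.fourierInv_eq_fourier_neg, fourier_eq_integral]
  congr 1; ext y; congr 2; push_cast; ring

theorem norm_exp_of_re_eq_zero {z : ℂ} (hz : z.re = 0) : ‖Complex.exp z‖ = 1 := by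
  rw [Complex.norm_exp, hz, Real.exp_zero]

/-- The divided spectrum `P(k - X/2) - P(k + X/2)`. -/
noncomputable def gap (P : ℝ → ℝ) (k X : ℝ) : ℂ := ((P (k - X / 2) - P (k + X / 2) : ℝ) : ℂ)

/-- Makes multiplication by `gap P k` in the frequency variable a continuous operator on Schwartz
space. -/
theorem gap_hasTemperateGrowth (P : 𝓢(ℝ, ℝ)) (k : ℝ) :
    Function.HasTemperateGrowth (gap P k) := by
  have hP := P.hasTemperateGrowth
  have h1 : Function.HasTemperateGrowth fun X : ℝ => k - X / 2 := by
    simp only [div_eq_mul_inv]; fun_prop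
  have h2 : Function.HasTemperateGrowth fun X : ℝ => k + X / 2 := by
    simp only [div_eq_mul_inv]; fun_prop
  have := (hP.comp h1).sub (hP.comp h2)
  exact (Complex.ofRealCLM.hasTemperateGrowth).comp this

/-- Each half is a dilation by ε = ±1/2 followed by a translation by x. The dilation contributes the
Jacobian 2 and the frequency l/ε = ±2l, the translation the phase. -/
theorem integral_shift_diff (n : 𝓢(ℝ, ℂ)) (x l : ℝ) :
    ∫ y : ℝ, Complex.exp (-2 * Real.pi * Complex.I * l * y) * (n (x + y / 2) - n (x - y / 2))
      = 2 * Complex.exp (4 * Real.pi * Complex.I * l * x) * 𝓕 (n : ℝ → ℂ) (2 * l)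
        - 2 * Complex.exp (-4 * Real.pi * Complex.I * l * x) * 𝓕 (n : ℝ → ℂ) (-2 * l) := by
  have key : ∀ (ε : ℝ), ε ≠ 0 → ∀ g : ℝ → ℂ, ∫ y : ℝ, g (x + ε * y) = |ε⁻¹| • ∫ y, g y := by
    intro ε _ g
    rw [Measure.integral_comp_mul_left (fun y => g (x + y)) ε, integral_add_left_eq_self g x]
  have A : ∀ (ε : ℝ), ε ≠ 0 → ∀ (y : ℝ), Complex.exp (-2 * Real.pi * Complex.I * l * y) *
      n (x + ε * y) = (fun s : ℝ => Complex.exp (2 * Real.pi * Complex.I * l * (x / ε)) *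
        (Complex.exp (-2 * Real.pi * Complex.I * (l / ε : ℝ) * s) * n s)) (x + ε * y) := by
    intro ε hε y
    simp only
    rw [← mul_assoc, ← Complex.exp_add]
    congr 2
    have : (ε : ℂ) ≠ 0 := by exact_mod_cast hε
    push_cast
    field_simp
    ring
  have hInt : ∀ (ε : ℝ), ε ≠ 0 → Integrable fun y : ℝ =>
      Complex.exp (-2 * Real.pi * Complex.I * l * y) * n (x + ε * y) := by
    intro ε hε
    have h1 : Integrable fun y : ℝ => n (x + ε * y) :=
      ((n.integrable (μ := volume)).comp_add_left x).comp_mul_left' hε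
    refine h1.norm.mono' ?_ (Filter.Eventually.of_forall fun y => ?_)
    · have := n.continuous
      exact Continuous.aestronglyMeasurable (by fun_prop)
    · rw [norm_mul, norm_exp_of_re_eq_zero (by simp), one_mul]
  have B : ∀ (ε : ℝ), ε ≠ 0 → ∫ y : ℝ, Complex.exp (-2 * Real.pi * Complex.I * l * y) *
      n (x + ε * y) = |ε⁻¹| • (Complex.exp (2 * Real.pi * Complex.I * l * (x / ε)) *
        𝓕 (n : ℝ → ℂ) (l / ε)) := by
    intro ε hε
    rw [fourier_eq_integral, ← integral_const_mul, ← key ε hε]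
    exact integral_congr_ae (Filter.Eventually.of_forall (A ε hε))
  have e1 : ∀ y : ℝ, x + y / 2 = x + (1 / 2) * y := fun y => by ring
  have e2 : ∀ y : ℝ, x - y / 2 = x + (-1 / 2) * y := fun y => by ring
  simp only [e1, e2, mul_sub]
  rw [integral_sub (hInt _ (by norm_num)) (hInt _ (by norm_num)), B _ (by norm_num),
    B _ (by norm_num)]
  have a1 : |((1 : ℝ) / 2)⁻¹| = 2 := by norm_num
  have a2 : |((-1 : ℝ) / 2)⁻¹| = 2 := by norm_num
  have a3 : l / (1 / 2) = 2 * l := by ring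
  have a4 : l / (-1 / 2) = -2 * l := by ring
  rw [a1, a2, a3, a4, Complex.real_smul, Complex.real_smul]
  push_cast
  rw [← mul_assoc, ← mul_assoc]
  congr 4
  · ring
  · ring

/-- Substituting X = 2l in one half and X = -2l in the other turns both into inverse Fourier
integrals of n̂(X), against P(k - X/2) and P(k + X/2); the Jacobians 1/2 cancel the factors 2. -/
theorem interaction_eq_fourierInv (P : 𝓢(ℝ, ℝ)) (n : 𝓢(ℝ, ℂ)) (x k : ℝ) :
    interaction P n x k
      = (𝓕⁻ (SchwartzMap.smulLeftCLM ℂ (gap P k) (𝓕 n)) : 𝓢(ℝ, ℂ)) x := by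
  have hN : Integrable fun X => 𝓕 (n : ℝ → ℂ) X := by
    rw [← SchwartzMap.fourier_coe]; exact (𝓕 n).integrable
  have hNc : Continuous fun X => 𝓕 (n : ℝ → ℂ) X := by
    rw [← SchwartzMap.fourier_coe]; exact (𝓕 n).continuous
  have hInt : ∀ ε : ℝ, Integrable fun X : ℝ =>
      Complex.exp (2 * Real.pi * Complex.I * X * x) * 𝓕 (n : ℝ → ℂ) X * P (k + ε * X) := by
    intro ε
    have hc := P.continuous
    refine (hN.norm.mul_const (SchwartzMap.seminorm ℝ 0 0 P)).mono'
      (Continuous.aestronglyMeasurable (by fun_prop)) (Filter.Eventually.of_forall fun X => ?_)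
    rw [norm_mul, norm_mul, norm_exp_of_re_eq_zero (by simp), one_mul, Complex.norm_real]
    gcongr
    exact SchwartzMap.norm_le_seminorm ℝ P _
  have hsub : ∀ ε : ℝ, ε ≠ 0 → ∀ l : ℝ,
      Complex.exp (2 * Real.pi * Complex.I * (ε * l : ℝ) * x) * 𝓕 (n : ℝ → ℂ) (ε * l) * P (k - l)
      = (fun X : ℝ => Complex.exp (2 * Real.pi * Complex.I * X * x) * 𝓕 (n : ℝ → ℂ) X *
        P (k + (-1 / ε) * X)) (ε * l) := by
    intro ε hε l
    simp only
    congr 3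
    field_simp
    ring
  have hI : ∀ ε : ℝ, ε ≠ 0 → ∫ l : ℝ,
      Complex.exp (2 * Real.pi * Complex.I * (ε * l : ℝ) * x) * 𝓕 (n : ℝ → ℂ) (ε * l) * P (k - l)
      = |ε⁻¹| • ∫ X : ℝ, Complex.exp (2 * Real.pi * Complex.I * X * x) * 𝓕 (n : ℝ → ℂ) X *
        P (k + (-1 / ε) * X) := by
    intro ε hε
    rw [← Measure.integral_comp_mul_left]
    exact integral_congr_ae (Filter.Eventually.of_forall (hsub ε hε))
  have hIint : ∀ ε : ℝ, ε ≠ 0 → Integrable fun l : ℝ =>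
      Complex.exp (2 * Real.pi * Complex.I * (ε * l : ℝ) * x) * 𝓕 (n : ℝ → ℂ) (ε * l) *
        P (k - l) := by
    intro ε hε
    simp_rw [hsub ε hε]
    exact (hInt (-1 / ε)).comp_mul_left' hε
  rw [SchwartzMap.fourierInv_coe, fourierInv_eq_integral]
  simp only [SchwartzMap.smulLeftCLM_apply_apply (gap_hasTemperateGrowth P k), interaction,
    integral_shift_diff, SchwartzMap.fourier_coe]
  calc ∫ l : ℝ, (2 * Complex.exp (4 * Real.pi * Complex.I * l * x) * 𝓕 (n : ℝ → ℂ) (2 * l)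
        - 2 * Complex.exp (-4 * Real.pi * Complex.I * l * x) * 𝓕 (n : ℝ → ℂ) (-2 * l)) * P (k - l)
      = ∫ l : ℝ, (2 * (Complex.exp (2 * Real.pi * Complex.I * (2 * l : ℝ) * x) *
          𝓕 (n : ℝ → ℂ) (2 * l) * P (k - l)) -
          2 * (Complex.exp (2 * Real.pi * Complex.I * (-2 * l : ℝ) * x) *
          𝓕 (n : ℝ → ℂ) (-2 * l) * P (k - l))) := by
        congr 1; ext l
        have e1 : (4 * Real.pi * Complex.I * l * x : ℂ)
          = 2 * Real.pi * Complex.I * (2 * l : ℝ) * x := by push_cast; ring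
        have e2 : (-4 * Real.pi * Complex.I * l * x : ℂ)
          = 2 * Real.pi * Complex.I * (-2 * l : ℝ) * x := by push_cast; ring
        rw [e1, e2]; ring
    _ = (∫ X : ℝ, Complex.exp (2 * Real.pi * Complex.I * X * x) * 𝓕 (n : ℝ → ℂ) X *
          P (k + (-1 / 2) * X)) - ∫ X : ℝ, Complex.exp (2 * Real.pi * Complex.I * X * x) *
          𝓕 (n : ℝ → ℂ) X * P (k + (-1 / -2) * X) := by
        rw [integral_sub ((hIint 2 (by norm_num)).const_mul 2)
          ((hIint (-2) (by norm_num)).const_mul 2), integral_const_mul, integral_const_mul,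
          hI 2 (by norm_num), hI (-2) (by norm_num)]
        simp only [Complex.real_smul]
        norm_num
        ring
    _ = _ := by
        rw [← integral_sub (hInt _) (hInt _)]
        congr 1; ext X
        simp only [gap, smul_eq_mul]
        have e1 : k + (-1 / 2) * X = k - X / 2 := by ring
        have e2 : k + (-1 / -2) * X = k + X / 2 := by ring
        rw [e1, e2]; push_cast; ring

/-- The Schwartz topology is finer than the uniform one, and evaluation is jointly continuous on
bounded continuous functions. -/
theorem continuousOn_schwartz_uncurry {E : Type*} [NormedAddCommGroup E] [NormedSpace ℝ E]
    {G : ℝ → 𝓢(E, ℂ)} {S : Set ℝ} (hG : ContinuousOn G S) :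
    ContinuousOn (fun z : E × ℝ => G z.2 z.1) (Set.univ ×ˢ S) := by
  have h1 : ContinuousOn (fun t => SchwartzMap.toBoundedContinuousFunctionCLM ℂ E ℂ (G t)) S :=
    (ContinuousLinearMap.continuous _).comp_continuousOn hG
  have h2 : ContinuousOn (fun z : E × ℝ =>
      (SchwartzMap.toBoundedContinuousFunctionCLM ℂ E ℂ (G z.2), z.1)) (Set.univ ×ˢ S) :=
    (h1.comp continuousOn_snd fun z hz => hz.2).prodMk continuousOn_fst
  exact continuous_eval.comp_continuousOn h2

theorem continuousOn_schwartz_apply {E : Type*} [NormedAddCommGroup E] [NormedSpace ℝ E]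
    {G : ℝ → 𝓢(E, ℂ)} {S : Set ℝ} (hG : ContinuousOn G S) (x : E) :
    ContinuousOn (fun t => G t x) S :=
  (continuousOn_schwartz_uncurry hG).comp (f := fun t : ℝ => (x, t)) (by fun_prop)
    fun t ht => ⟨trivial, ht⟩

/-- Seminorms of a continuous curve are bounded on compact sets; orders 0 and 2 in x give a majorant
for exchanging the x and t integrals. -/
theorem exists_bound_of_continuousOn_schwartz {G : ℝ → 𝓢(ℝ, ℂ)} {K : Set ℝ} (hK : IsCompact K)
    (hG : ContinuousOn G K) : ∃ C, ∀ t ∈ K, ∀ x, ‖G t x‖ ≤ C * (1 + x ^ 2)⁻¹ := by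
  have hc : ∀ j : ℕ, Continuous fun f : 𝓢(ℝ, ℂ) => SchwartzMap.seminorm ℂ j 0 f := fun j =>
    (schwartz_withSeminorms ℂ ℝ ℂ).continuous_seminorm (j, 0)
  obtain ⟨C, hC⟩ := hK.exists_bound_of_continuousOn
    ((((hc 0).add (hc 2))).comp_continuousOn hG)
  refine ⟨C, fun t ht x => ?_⟩
  have h := (le_abs_self _).trans (hC t ht)
  simp only [Function.comp, Pi.add_apply] at h
  have h0 := SchwartzMap.norm_pow_mul_le_seminorm ℂ (G t) 0 x
  have h2 := SchwartzMap.norm_pow_mul_le_seminorm ℂ (G t) 2 x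
  rw [← div_eq_mul_inv, le_div_iff₀ (by positivity)]
  simp only [Real.norm_eq_abs, pow_zero, one_mul, sq_abs] at h0 h2
  linarith

/-- Differentiation in time commutes with the Fourier transform in space. -/
theorem fourier_eq_add_integral {v G : ℝ → 𝓢(ℝ, ℂ)} (hv : ContinuousOn v (Set.Ici 0))
    (hG : ContinuousOn G (Set.Ici 0))
    (hd : ∀ t, 0 < t → ∀ x, HasDerivAt (fun τ => v τ x) (G t x) t) (X : ℝ) {t : ℝ} (ht : 0 ≤ t) :
    𝓕 (v t) X = 𝓕 (v 0) X + ∫ s in (0 : ℝ)..t, 𝓕 (G s) X := by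
  have hIcc : Set.Icc 0 t ⊆ Set.Ici (0 : ℝ) := Set.Icc_subset_Ici_self
  have hftc : ∀ x, v t x - v 0 x = ∫ s in (0 : ℝ)..t, G s x := by
    intro x
    refine (intervalIntegral.integral_eq_sub_of_hasDerivAt_of_le ht
      ((continuousOn_schwartz_apply hv x).mono hIcc) (fun s hs => hd s hs.1 x) ?_).symm
    exact ((continuousOn_schwartz_apply hG x).mono hIcc).intervalIntegrable_of_Icc ht
  obtain ⟨C, hC⟩ := exists_bound_of_continuousOn_schwartz isCompact_Icc (hG.mono hIcc)
  have hInt : Integrable (fun z : ℝ × ℝ => Complex.exp (-2 * Real.pi * Complex.I * X * z.1) *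
      G z.2 z.1) (volume.prod (volume.restrict (Set.Ioc 0 t))) := by
    have hb : Integrable (fun z : ℝ × ℝ => (C * (1 + z.1 ^ 2)⁻¹) * (1 : ℝ))
        (volume.prod (volume.restrict (Set.Ioc 0 t))) :=
      (integrable_inv_one_add_sq.const_mul C).mul_prod (integrable_const 1)
    have hm : volume.prod (volume.restrict (Set.Ioc 0 t))
        = ((volume : Measure (ℝ × ℝ))).restrict (Set.univ ×ˢ Set.Ioc 0 t) := by
      rw [Measure.volume_eq_prod, ← Measure.prod_restrict, Measure.restrict_univ]
    refine hb.mono' ?_ ?_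
    · rw [hm]
      refine ContinuousOn.aestronglyMeasurable ?_ (MeasurableSet.univ.prod measurableSet_Ioc)
      refine ContinuousOn.mul (Continuous.continuousOn (by fun_prop)) ?_
      exact (continuousOn_schwartz_uncurry hG).mono
        (Set.prod_mono_right fun s hs => hs.1.le)
    · rw [hm]
      filter_upwards [ae_restrict_mem (MeasurableSet.univ.prod measurableSet_Ioc)] with z hz
      rw [norm_mul, norm_exp_of_re_eq_zero (by simp), one_mul, mul_one]
      exact hC z.2 ⟨hz.2.1.le, hz.2.2⟩ z.1
  have hFint : ∀ f : 𝓢(ℝ, ℂ), Integrable fun x : ℝ =>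
      Complex.exp (-2 * Real.pi * Complex.I * X * x) * f x := by
    intro f
    refine (f.integrable (μ := volume)).norm.mono' ?_ (Filter.Eventually.of_forall fun x => ?_)
    · have := f.continuous
      exact Continuous.aestronglyMeasurable (by fun_prop)
    · rw [norm_mul, norm_exp_of_re_eq_zero (by simp), one_mul]
  rw [← sub_eq_iff_eq_add']
  simp only [SchwartzMap.fourier_coe, fourier_eq_integral]
  rw [← integral_sub (hFint _) (hFint _), intervalIntegral.integral_of_le ht,
    ← integral_integral_swap hInt]
  congr 1; ext x
  rw [← mul_sub, hftc, integral_const_mul, intervalIntegral.integral_of_le ht]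

end Alber

/-! ### Duhamel formula and the Volterra equation for the density -/

namespace Alber

theorem fourier_derivCLM_apply (f : 𝓢(ℝ, ℂ)) (X : ℝ) :
    𝓕 (SchwartzMap.derivCLM ℂ ℂ f) X = 2 * Real.pi * Complex.I * X * 𝓕 f X := by
  have h := Real.fourier_deriv (f := f) f.integrable f.differentiable
    ((SchwartzMap.derivCLM ℂ ℂ f).integrable)
  have h2 := congrFun h X
  rw [smul_eq_mul] at h2
  exact h2

theorem fourier_fourierInv_apply (f : 𝓢(ℝ, ℂ)) : 𝓕 (𝓕⁻ f) = f :=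
  FourierTransform.fourier_fourierInv_eq f

/-- Integrating factor for a scalar linear equation in integrated form. -/
theorem exp_mul_eq_of_integral_eq {y g : ℝ → ℂ} {θ : ℂ} (hy : ContinuousOn y (Set.Ici 0))
    (hg : ContinuousOn g (Set.Ici 0))
    (h : ∀ t, 0 ≤ t → y t = y 0 + ∫ s in (0 : ℝ)..t, (-θ * y s + g s)) {t : ℝ} (ht : 0 ≤ t) :
    Complex.exp (θ * t) * y t = y 0 + ∫ s in (0 : ℝ)..t, Complex.exp (θ * s) * g s := by
  have hIcc : Set.Icc 0 t ⊆ Set.Ici (0 : ℝ) := Set.Icc_subset_Ici_self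
  have hc : ContinuousOn (fun s => -θ * y s + g s) (Set.Ici 0) :=
    (continuousOn_const.mul hy).add hg
  have hd : ∀ s ∈ Set.Ioo 0 t, HasDerivAt y (-θ * y s + g s) s := by
    intro s hs
    have hnhds : Set.Ici (0 : ℝ) ∈ nhds s := Ici_mem_nhds hs.1
    have h1 : HasDerivAt (fun r => ∫ τ in (0 : ℝ)..r, (-θ * y τ + g τ)) (-θ * y s + g s) s := by
      refine intervalIntegral.integral_hasDerivAt_right ?_ ?_ (hc.continuousAt hnhds)
      · exact (hc.mono Set.Icc_subset_Ici_self).intervalIntegrable_of_Icc hs.1.le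
      · exact ContinuousOn.stronglyMeasurableAtFilter_nhdsWithin hc measurableSet_Ici s
          |>.filter_mono (by rw [nhdsWithin_eq_nhds.2 hnhds])
    refine (h1.const_add (y 0)).congr_of_eventuallyEq ?_
    filter_upwards [hnhds] with r hr using h r hr
  have hE : ∀ s : ℝ, HasDerivAt (fun s : ℝ => Complex.exp (θ * s)) (Complex.exp (θ * s) * θ) s := by
    intro s
    have := ((hasDerivAt_id s).ofReal_comp.const_mul θ).cexp
    simpa using this
  have hEc : Continuous fun s : ℝ => Complex.exp (θ * s) := by fun_prop
  have key := intervalIntegral.integral_eq_sub_of_hasDerivAt_of_le ht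
    (f := fun s : ℝ => Complex.exp (θ * s) * y s) (f' := fun s => Complex.exp (θ * s) * g s)
    (hEc.continuousOn.mul (hy.mono hIcc))
    (fun s hs => by
      refine ((hE s).mul (hd s hs)).congr_deriv ?_
      ring)
    ((hEc.continuousOn.mul (hg.mono hIcc)).intervalIntegrable_of_Icc ht)
  rw [key]
  simp

section Solution

variable {p q : ℝ} {P : 𝓢(ℝ, ℝ)} {w₀ : 𝓢(ℝ × ℝ, ℂ)} {w : ℝ → 𝓢(ℝ × ℝ, ℂ)}

theorem IsSolution.continuousOn_fourier_density (hw : IsSolution p q P w₀ w) :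
    ContinuousOn (fun t => 𝓕 (densityCLM (w t))) (Set.Ici 0) :=
  (FourierTransform.fourierCLM ℂ 𝓢(ℝ, ℂ) ∘L densityCLM).continuous.comp_continuousOn hw.continuousOn

/-- The Duhamel formula on the Fourier side. -/
theorem IsSolution.duhamel (hw : IsSolution p q P w₀ w) (k X : ℝ) {t : ℝ} (ht : 0 ≤ t) :
    Complex.exp (4 * Real.pi ^ 2 * p * k * X * Complex.I * t) * 𝓕 (sliceX k (w t)) X
      = 𝓕 (sliceX k w₀) X + ∫ s in (0 : ℝ)..t,
        Complex.exp (4 * Real.pi ^ 2 * p * k * X * Complex.I * s) *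
          (q * Complex.I * gap P k X * 𝓕 (densityCLM (w s)) X) := by
  have hv : ContinuousOn (fun t => sliceX k (w t)) (Set.Ici 0) :=
    (sliceX k).continuous.comp_continuousOn hw.continuousOn
  set G : ℝ → 𝓢(ℝ, ℂ) := fun t =>
    (-(2 * Real.pi * p * k : ℂ)) • SchwartzMap.derivCLM ℂ ℂ (sliceX k (w t)) +
      (q * Complex.I : ℂ) • 𝓕⁻ (SchwartzMap.smulLeftCLM ℂ (gap P k) (𝓕 (densityCLM (w t))))
    with hGdef
  have hG : ContinuousOn G (Set.Ici 0) := by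
    have h1 : Continuous fun v : 𝓢(ℝ × ℝ, ℂ) =>
        (-(2 * Real.pi * p * k : ℂ)) • SchwartzMap.derivCLM ℂ ℂ (sliceX k v) :=
      ((-(2 * Real.pi * p * k : ℂ)) • (SchwartzMap.derivCLM ℂ ℂ ∘L sliceX k)).continuous
    have h2 : Continuous fun v : 𝓢(ℝ × ℝ, ℂ) => (q * Complex.I : ℂ) •
        𝓕⁻ (SchwartzMap.smulLeftCLM ℂ (gap P k) (𝓕 (densityCLM v))) :=
      ((q * Complex.I : ℂ) • (FourierTransform.fourierInvCLM ℂ 𝓢(ℝ, ℂ) ∘L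
        SchwartzMap.smulLeftCLM ℂ (gap P k) ∘L FourierTransform.fourierCLM ℂ 𝓢(ℝ, ℂ) ∘L
        densityCLM)).continuous
    exact (h1.add h2).comp_continuousOn hw.continuousOn
  have hd : ∀ t, 0 < t → ∀ x, HasDerivAt (fun τ => sliceX k (w τ) x) (G t x) t := by
    intro t ht x
    obtain ⟨h1, h2⟩ := hw.equation t ht x k
    have h3 : deriv (fun τ => w τ (x, k)) t = G t x := by
      have e1 : SchwartzMap.derivCLM ℂ ℂ (sliceX k (w t)) x = deriv (fun y => w t (y, k)) x := rfl
      have e2 := interaction_eq_fourierInv P (densityCLM (w t)) x k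
      rw [coe_densityCLM] at e2
      rw [e2] at h2
      simp only [hGdef, add_apply, smul_apply, e1, smul_eq_mul]
      linear_combination h2
    rw [← h3]
    exact h1.hasDerivAt
  have hN := continuousOn_schwartz_apply hw.continuousOn_fourier_density X
  have hy : ContinuousOn (fun t => 𝓕 (sliceX k (w t)) X) (Set.Ici 0) :=
    continuousOn_schwartz_apply ((FourierTransform.fourierCLM ℂ 𝓢(ℝ, ℂ)).continuous.comp_continuousOn hv) X
  have key := exp_mul_eq_of_integral_eq (y := fun t => 𝓕 (sliceX k (w t)) X)
    (g := fun s => q * Complex.I * gap P k X * 𝓕 (densityCLM (w s)) X)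
    (θ := 4 * Real.pi ^ 2 * p * k * X * Complex.I) hy (continuousOn_const.mul hN)
    (fun t ht => by
      have := fourier_eq_add_integral hv hG hd X ht
      rw [this]
      congr 1
      refine intervalIntegral.integral_congr fun s _ => ?_
      have hGs : 𝓕 (G s) = (-(2 * Real.pi * p * k : ℂ)) •
          𝓕 (SchwartzMap.derivCLM ℂ ℂ (sliceX k (w s))) +
          (q * Complex.I : ℂ) • SchwartzMap.smulLeftCLM ℂ (gap P k) (𝓕 (densityCLM (w s))) := by
        rw [hGdef]
        simp only [FourierTransform.fourier_add, FourierTransform.fourier_smul,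
          fourier_fourierInv_apply]
      simp only [hGs, add_apply, smul_apply, smul_eq_mul,
        fourier_derivCLM_apply, SchwartzMap.smulLeftCLM_apply_apply (gap_hasTemperateGrowth P k)]
      linear_combination (0 : ℂ) * Complex.I_sq) ht
  rw [key, hw.initial]

end Solution

theorem integrable_exp_mul_prod (w : 𝓢(ℝ × ℝ, ℂ)) (X η : ℝ) :
    Integrable (fun z : ℝ × ℝ => Complex.exp (-2 * Real.pi * Complex.I * η * z.2) *
      (Complex.exp (-2 * Real.pi * Complex.I * X * z.1) * w z))
      ((volume : Measure ℝ).prod volume) := by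
  have hw : Integrable w ((volume : Measure ℝ).prod volume) := w.integrable (μ := volume)
  refine hw.norm.mono' ?_ (Filter.Eventually.of_forall fun z => ?_)
  · have := w.continuous
    exact Continuous.aestronglyMeasurable (by fun_prop)
  · rw [norm_mul, norm_mul, norm_exp_of_re_eq_zero (by simp), norm_exp_of_re_eq_zero (by simp),
      one_mul, one_mul]

/-- The Fourier transform on phase space, as an iterated integral. -/
noncomputable def fourier₂ (w : 𝓢(ℝ × ℝ, ℂ)) (X η : ℝ) : ℂ :=
  ∫ k : ℝ, Complex.exp (-2 * Real.pi * Complex.I * η * k) * 𝓕 (sliceX k w) X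

theorem fourier_sliceX_apply (w : 𝓢(ℝ × ℝ, ℂ)) (k X : ℝ) :
    𝓕 (sliceX k w) X = ∫ x : ℝ, Complex.exp (-2 * Real.pi * Complex.I * X * x) * w (x, k) := by
  rw [SchwartzMap.fourier_coe, fourier_eq_integral]; rfl

theorem fourier_sliceK_apply (w : 𝓢(ℝ × ℝ, ℂ)) (x η : ℝ) :
    𝓕 (sliceK x w) η = ∫ k : ℝ, Complex.exp (-2 * Real.pi * Complex.I * η * k) * w (x, k) := by
  rw [SchwartzMap.fourier_coe, fourier_eq_integral]; rfl

theorem integrable_exp_mul_fourier_sliceX (w : 𝓢(ℝ × ℝ, ℂ)) (X η : ℝ) :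
    Integrable fun k : ℝ => Complex.exp (-2 * Real.pi * Complex.I * η * k) *
      𝓕 (sliceX k w) X := by
  have := (integrable_exp_mul_prod w X η).integral_prod_right
  refine this.congr (Filter.Eventually.of_forall fun k => ?_)
  simp only
  rw [integral_const_mul, fourier_sliceX_apply]

/-- Fubini. With both orders of integration available, ∂ₓ and ∂ₖ each act on an inner
one-dimensional transform. -/
theorem fourier₂_eq (w : 𝓢(ℝ × ℝ, ℂ)) (X η : ℝ) :
    fourier₂ w X η = ∫ x : ℝ, Complex.exp (-2 * Real.pi * Complex.I * X * x) *
      𝓕 (sliceK x w) η := by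
  have h := integral_integral_swap (f := fun x k : ℝ =>
    Complex.exp (-2 * Real.pi * Complex.I * η * k) *
      (Complex.exp (-2 * Real.pi * Complex.I * X * x) * w (x, k))) (integrable_exp_mul_prod w X η)
  simp only [fourier₂, fourier_sliceX_apply, fourier_sliceK_apply]
  simp only [← integral_const_mul]
  rw [← h]
  congr 1; ext x; congr 1; ext k; ring

theorem fourier_density_eq (w : 𝓢(ℝ × ℝ, ℂ)) (X : ℝ) :
    𝓕 (densityCLM w) X = fourier₂ w X 0 := by
  rw [fourier₂_eq, SchwartzMap.fourier_coe, fourier_eq_integral]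
  congr 1; ext x
  rw [fourier_sliceK_apply, densityCLM_apply, density]
  simp

theorem integrable_gap (P : 𝓢(ℝ, ℝ)) (X : ℝ) : Integrable fun k : ℝ => gap P k X := by
  have hP := P.integrable (μ := volume)
  have h1 : Integrable fun k : ℝ => P (k - X / 2) - P (k + X / 2) :=
    (hP.comp_sub_right (X / 2)).sub (hP.comp_add_right (X / 2))
  exact h1.ofReal

theorem continuous_gap (P : 𝓢(ℝ, ℝ)) : Continuous fun z : ℝ × ℝ => gap P z.1 z.2 := by
  have := P.continuous
  unfold gap
  fun_prop

/-- Shifting P by ±X/2 multiplies its transform by conjugate phases whose difference is -2i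
sin(πXη); the factor iq makes this 2q sin. The kernel appears at -X because it is built on the
inverse transform of P. -/
theorem integral_exp_mul_gap (p q : ℝ) (P : 𝓢(ℝ, ℝ)) (X τ : ℝ) :
    q * Complex.I * ∫ k : ℝ, Complex.exp (-2 * Real.pi * Complex.I * (2 * Real.pi * p * X * τ : ℝ) * k) *
      gap P k X = kernelH p q P (-X) τ := by
  set η : ℝ := 2 * Real.pi * p * X * τ with hη
  have hP : Integrable fun k : ℝ => (P k : ℂ) := (P.integrable (μ := volume)).ofReal
  have hE : ∀ a : ℝ, Integrable fun k : ℝ =>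
      Complex.exp (-2 * Real.pi * Complex.I * η * k) * P (k + a) := by
    intro a
    refine (hP.comp_add_right a).norm.mono' ?_ (Filter.Eventually.of_forall fun x => ?_)
    · have := P.continuous
      exact Continuous.aestronglyMeasurable (by fun_prop)
    · rw [norm_mul, norm_exp_of_re_eq_zero (by simp), one_mul]
  have hS : ∀ a : ℝ, ∫ k : ℝ, Complex.exp (-2 * Real.pi * Complex.I * η * k) * P (k + a)
      = Complex.exp (2 * Real.pi * Complex.I * η * a) * 𝓕 (fun k : ℝ => (P k : ℂ)) η := by
    intro a
    rw [fourier_eq_integral, ← integral_const_mul, ← integral_add_right_eq_self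
      (fun k : ℝ => Complex.exp (2 * Real.pi * Complex.I * η * a) *
        (Complex.exp (-2 * Real.pi * Complex.I * η * k) * (P k : ℂ))) a]
    congr 1; ext k
    rw [← mul_assoc, ← Complex.exp_add]
    congr 2; push_cast; ring
  have e0 : ∀ k : ℝ, Complex.exp (-2 * Real.pi * Complex.I * η * k) * gap P k X
      = Complex.exp (-2 * Real.pi * Complex.I * η * k) * P (k + (-X / 2)) -
        Complex.exp (-2 * Real.pi * Complex.I * η * k) * P (k + X / 2) := by
    intro k
    have : k + -X / 2 = k - X / 2 := by ring
    rw [this, gap]; push_cast; ring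
  simp only [e0]
  rw [integral_sub (hE _) (hE _), hS, hS, kernelH]
  have e1 : (2 * Real.pi * p * (-X) * τ : ℝ) = -η := by rw [hη]; ring
  rw [e1, Real.fourierInv_eq_fourier_neg, neg_neg]
  have e2 : (2 * Real.pi ^ 2 * p * (-X) ^ 2 * τ : ℝ) = Real.pi * X * η := by rw [hη]; ring
  rw [e2, Complex.ofReal_sin, Complex.sin]
  have e3 : (2 * Real.pi * Complex.I * η * (-X / 2 : ℝ) : ℂ)
      = -((Real.pi * X * η : ℝ) : ℂ) * Complex.I := by push_cast; ring
  have e4 : (2 * Real.pi * Complex.I * η * (X / 2 : ℝ) : ℂ)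
      = ((Real.pi * X * η : ℝ) : ℂ) * Complex.I := by push_cast; ring
  rw [e3, e4]
  ring

/-- The Fourier transformed density solves a Volterra equation in time. -/
theorem IsSolution.volterra {p q : ℝ} {P : 𝓢(ℝ, ℝ)} {w₀ : 𝓢(ℝ × ℝ, ℂ)} {w : ℝ → 𝓢(ℝ × ℝ, ℂ)}
    (hw : IsSolution p q P w₀ w) (X : ℝ) {t : ℝ} (ht : 0 ≤ t) :
    𝓕 (densityCLM (w t)) X = fourier₂ w₀ X (2 * Real.pi * p * X * t) +
      ∫ s in (0 : ℝ)..t, kernelH p q P (-X) (t - s) * 𝓕 (densityCLM (w s)) X := by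
  have hN := continuousOn_schwartz_apply hw.continuousOn_fourier_density X
  have hIcc : Set.Icc 0 t ⊆ Set.Ici (0 : ℝ) := Set.Icc_subset_Ici_self
  have hNint : IntegrableOn (fun s => 𝓕 (densityCLM (w s)) X) (Set.Ioc 0 t) :=
    ((hN.mono hIcc).integrableOn_Icc).mono_set Set.Ioc_subset_Icc_self
  set E : ℝ → ℝ → ℂ := fun k s =>
    Complex.exp (-2 * Real.pi * Complex.I * (2 * Real.pi * p * X * (t - s) : ℝ) * k) with hE
  have hslice : ∀ k : ℝ, 𝓕 (sliceX k (w t)) X =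
      Complex.exp (-2 * Real.pi * Complex.I * (2 * Real.pi * p * X * t : ℝ) * k) *
        𝓕 (sliceX k w₀) X + ∫ s in (0 : ℝ)..t, E k s *
          (q * Complex.I * gap P k X * 𝓕 (densityCLM (w s)) X) := by
    intro k
    have h := hw.duhamel k X ht
    have h1 : 𝓕 (sliceX k (w t)) X =
        Complex.exp (-2 * Real.pi * Complex.I * (2 * Real.pi * p * X * t : ℝ) * k) *
        (Complex.exp (4 * Real.pi ^ 2 * p * k * X * Complex.I * t) * 𝓕 (sliceX k (w t)) X) := by
      rw [← mul_assoc, ← Complex.exp_add]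
      have : (-2 * Real.pi * Complex.I * (2 * Real.pi * p * X * t : ℝ) * k +
        4 * Real.pi ^ 2 * p * k * X * Complex.I * t : ℂ) = 0 := by push_cast; ring
      rw [this, Complex.exp_zero, one_mul]
    rw [h1, h, mul_add, ← intervalIntegral.integral_const_mul]
    congr 1
    refine intervalIntegral.integral_congr fun s _ => ?_
    simp only [hE]
    rw [← mul_assoc, ← Complex.exp_add]
    congr 2; push_cast; ring
  have hprod : Integrable (fun z : ℝ × ℝ => E z.1 z.2 *
      (q * Complex.I * gap P z.1 X * 𝓕 (densityCLM (w z.2)) X))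
      (volume.prod (volume.restrict (Set.Ioc 0 t))) := by
    have h1 := ((integrable_gap P X).const_mul (q * Complex.I)).mul_prod hNint
    refine h1.norm.mono' ?_ (Filter.Eventually.of_forall fun z => ?_)
    · refine AEStronglyMeasurable.mul ?_ h1.aestronglyMeasurable
      exact Continuous.aestronglyMeasurable (by simp only [hE]; fun_prop)
    · rw [norm_mul, hE]
      simp only
      rw [norm_exp_of_re_eq_zero (by simp), one_mul]
  have hInt2 : Integrable fun k : ℝ => ∫ s in (0 : ℝ)..t, E k s *
      (q * Complex.I * gap P k X * 𝓕 (densityCLM (w s)) X) := by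
    simp only [intervalIntegral.integral_of_le ht]
    exact hprod.integral_prod_left
  -- On integrating over k, the transport phase places elapsed time in the variable dual to k: η =
  -- 2πpXt for the datum, and η = 2πpX(t-s) for the memory term, which is therefore a convolution.
  calc 𝓕 (densityCLM (w t)) X = ∫ k : ℝ, 𝓕 (sliceX k (w t)) X := by
        rw [fourier_density_eq, fourier₂]; simp
    _ = fourier₂ w₀ X (2 * Real.pi * p * X * t) + ∫ k : ℝ, ∫ s in (0 : ℝ)..t, E k s *
          (q * Complex.I * gap P k X * 𝓕 (densityCLM (w s)) X) := by
        simp only [hslice]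
        rw [integral_add (integrable_exp_mul_fourier_sliceX w₀ X _) hInt2]
        rfl
    _ = _ := by
        congr 1
        simp only [intervalIntegral.integral_of_le ht]
        rw [integral_integral_swap hprod]
        refine integral_congr_ae (Filter.Eventually.of_forall fun s => ?_)
        simp only
        rw [← integral_exp_mul_gap, mul_assoc, ← integral_mul_const, ← integral_const_mul]
        congr 1; ext k
        simp only [hE]; ring

end Alber

/-! ### Decay of the transformed datum and bounds on the kernel -/

namespace Alber

theorem fourier₂_dX (w : 𝓢(ℝ × ℝ, ℂ)) (X η : ℝ) :
    fourier₂ (dX w) X η = 2 * Real.pi * Complex.I * X * fourier₂ w X η := by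
  simp only [fourier₂, ← derivCLM_sliceX, fourier_derivCLM_apply]
  rw [← integral_const_mul]
  congr 1; ext k; ring

theorem fourier₂_dK (w : 𝓢(ℝ × ℝ, ℂ)) (X η : ℝ) :
    fourier₂ (dK w) X η = 2 * Real.pi * Complex.I * η * fourier₂ w X η := by
  simp only [fourier₂_eq, ← derivCLM_sliceK, fourier_derivCLM_apply]
  rw [← integral_const_mul]
  congr 1; ext k; ring

/-- The weights leave (1+x²)⁻¹(1+k²)⁻¹, whose integral is π². -/
theorem norm_fourier₂_le {w : 𝓢(ℝ × ℝ, ℂ)} {B : ℝ}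
    (hB : ∀ x k : ℝ, (1 + x ^ 2) * (1 + k ^ 2) * ‖w (x, k)‖ ≤ B) (X η : ℝ) :
    ‖fourier₂ w X η‖ ≤ Real.pi ^ 2 * B := by
  have h1 : ∀ k : ℝ, ‖𝓕 (sliceX k w) X‖ ≤ Real.pi * B * (1 + k ^ 2)⁻¹ := by
    intro k
    rw [fourier_sliceX_apply]
    refine (norm_integral_le_of_norm_le (g := fun x : ℝ => B * (1 + k ^ 2)⁻¹ * (1 + x ^ 2)⁻¹)
      (integrable_inv_one_add_sq.const_mul _) (Filter.Eventually.of_forall fun x => ?_)).trans ?_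
    · rw [norm_mul, norm_exp_of_re_eq_zero (by simp), one_mul, mul_assoc, ← mul_inv,
        ← div_eq_mul_inv, le_div_iff₀ (by positivity)]
      linarith [hB x k]
    · rw [integral_const_mul, integral_univ_inv_one_add_sq]
      exact le_of_eq (by ring)
  refine (norm_integral_le_of_norm_le (g := fun k : ℝ => Real.pi * B * (1 + k ^ 2)⁻¹)
      (integrable_inv_one_add_sq.const_mul _) (Filter.Eventually.of_forall fun k => ?_)).trans ?_
  · rw [norm_mul, norm_exp_of_re_eq_zero (by simp), one_mul]
    exact h1 k
  · rw [integral_const_mul, integral_univ_inv_one_add_sq]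
    exact le_of_eq (by ring)

/-- Decay of the phase-space Fourier transform in terms of finitely many weighted sup norms. -/
theorem norm_fourier₂_decay {w : 𝓢(ℝ × ℝ, ℂ)} {A : ℝ}
    (hA : ∀ a b c d : ℕ, a ≤ 2 → b ≤ 2 → c ≤ 2 → d ≤ 2 → ∀ x k : ℝ,
      |x| ^ a * |k| ^ b * ‖(dX^[c] (dK^[d] w)) (x, k)‖ ≤ A) (X η : ℝ) :
    ‖fourier₂ w X η‖ ≤ 16 * Real.pi ^ 2 * A * ((1 + X ^ 2)⁻¹ * (1 + η ^ 2)⁻¹) := by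
  -- The 4 counts the monomials of (1+x²)(1+k²). Below, F, X²F, η²F and X²η²F each obey this bound,
  -- and their sum is (1+X²)(1+η²)F, whence 16π²A.
  have hB : ∀ c d : ℕ, c ≤ 2 → d ≤ 2 → ‖fourier₂ (dX^[c] (dK^[d] w)) X η‖
      ≤ Real.pi ^ 2 * (4 * A) := by
    intro c d hc hd
    refine norm_fourier₂_le (fun x k => ?_) X η
    have h00 := hA 0 0 c d (by norm_num) (by norm_num) hc hd x k
    have h02 := hA 0 2 c d (by norm_num) (by norm_num) hc hd x k
    have h20 := hA 2 0 c d (by norm_num) (by norm_num) hc hd x k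
    have h22 := hA 2 2 c d (by norm_num) (by norm_num) hc hd x k
    simp only [pow_zero, one_mul, mul_one, sq_abs] at h00 h02 h20 h22
    nlinarith
  have h00 := hB 0 0 (by norm_num) (by norm_num)
  have h20 := hB 2 0 (by norm_num) (by norm_num)
  have h02 := hB 0 2 (by norm_num) (by norm_num)
  have h22 := hB 2 2 (by norm_num) (by norm_num)
  simp only [Function.iterate_succ, Function.iterate_zero, Function.comp, id, fourier₂_dX,
    fourier₂_dK, norm_mul, Complex.norm_real, Complex.norm_I, Real.norm_eq_abs, mul_one,
    Complex.norm_ofNat, abs_of_pos Real.pi_pos] at h00 h20 h02 h22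
  set F := ‖fourier₂ w X η‖
  have hF : 0 ≤ F := norm_nonneg _
  have hpi : 1 ≤ 2 * Real.pi := by linarith [Real.pi_gt_three]
  have hpi2 : 1 ≤ (2 * Real.pi) ^ 2 := one_le_pow₀ hpi
  have e1 : X ^ 2 * F ≤ Real.pi ^ 2 * (4 * A) := by
    calc X ^ 2 * F ≤ (2 * Real.pi) ^ 2 * (X ^ 2 * F) := le_mul_of_one_le_left (by positivity) hpi2
      _ = 2 * Real.pi * |X| * (2 * Real.pi * |X| * F) := by rw [← sq_abs X]; ring
      _ ≤ _ := h20
  have e2 : η ^ 2 * F ≤ Real.pi ^ 2 * (4 * A) := by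
    calc η ^ 2 * F ≤ (2 * Real.pi) ^ 2 * (η ^ 2 * F) := le_mul_of_one_le_left (by positivity) hpi2
      _ = 2 * Real.pi * |η| * (2 * Real.pi * |η| * F) := by rw [← sq_abs η]; ring
      _ ≤ _ := h02
  have e3 : X ^ 2 * (η ^ 2 * F) ≤ Real.pi ^ 2 * (4 * A) := by
    calc X ^ 2 * (η ^ 2 * F) ≤ (2 * Real.pi) ^ 2 * ((2 * Real.pi) ^ 2 * (X ^ 2 * (η ^ 2 * F))) :=
          (le_mul_of_one_le_left (by positivity) hpi2).trans
            (le_mul_of_one_le_left (by positivity) hpi2)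
      _ = 2 * Real.pi * |X| * (2 * Real.pi * |X| * (2 * Real.pi * |η| * (2 * Real.pi * |η| * F))) := by
          rw [← sq_abs η, ← sq_abs X]; ring
      _ ≤ _ := h22
  rw [← mul_inv, ← div_eq_mul_inv, le_div_iff₀ (by positivity)]
  nlinarith

theorem iteratedDeriv_snd (w : 𝓢(ℝ × ℝ, ℂ)) (d : ℕ) (x : ℝ) :
    iteratedDeriv d (fun k => w (x, k)) = fun k => (dK^[d] w) (x, k) := by
  induction d with
  | zero => simp
  | succ d ih =>
    rw [iteratedDeriv_succ, ih, Function.iterate_succ_apply']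
    ext k
    exact (hasDerivAt_snd _ x k).deriv

theorem iteratedDeriv_fst (w : 𝓢(ℝ × ℝ, ℂ)) (c : ℕ) (k : ℝ) :
    iteratedDeriv c (fun x => w (x, k)) = fun x => (dX^[c] w) (x, k) := by
  induction c with
  | zero => simp
  | succ c ih =>
    rw [iteratedDeriv_succ, ih, Function.iterate_succ_apply']
    ext x
    exact (hasDerivAt_fst _ x k).deriv

/-- The set where the bound holds is closed by continuity and dense because it has full measure. -/
theorem enorm_le_eLpNorm_top {f : ℝ × ℝ → ℂ} (hf : Continuous f) (z : ℝ × ℝ) :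
    ‖f z‖ₑ ≤ eLpNorm f ∞ volume := by
  have h1 : ∀ᵐ z : ℝ × ℝ, ‖f z‖ₑ ≤ eLpNorm f ∞ volume := by
    rw [eLpNorm_exponent_top]
    exact ae_le_eLpNormEssSup
  have h2 := Measure.dense_of_ae h1
  have h3 : IsClosed {z : ℝ × ℝ | ‖f z‖ₑ ≤ eLpNorm f ∞ volume} :=
    isClosed_le hf.enorm continuous_const
  have := h2.closure_eq
  rw [h3.closure_eq] at this
  exact (this.ge : Set.univ ⊆ _) (Set.mem_univ z)

/-- The order 8 is 2+2+2+2, the largest total weight and derivative count used in the decay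
estimate; the term in question is one summand of the norm. -/
theorem weighted_deriv_le_sigmaNorm (w : 𝓢(ℝ × ℝ, ℂ)) {a b c d : ℕ} (ha : a ≤ 2) (hb : b ≤ 2)
    (hc : c ≤ 2) (hd : d ≤ 2) (x k : ℝ) :
    ENNReal.ofReal (|x| ^ a * |k| ^ b * ‖(dX^[c] (dK^[d] w)) (x, k)‖) ≤ sigmaNorm 8 ∞ w := by
  set g : ℝ × ℝ → ℂ := fun z => (z.1 : ℂ) ^ a * (z.2 : ℂ) ^ b * (dX^[c] (dK^[d] w)) z with hg
  have hgc : Continuous g := by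
    have := (dX^[c] (dK^[d] w)).continuous
    fun_prop
  have h1 := enorm_le_eLpNorm_top hgc (x, k)
  have h2 : ENNReal.ofReal (|x| ^ a * |k| ^ b * ‖(dX^[c] (dK^[d] w)) (x, k)‖) = ‖g (x, k)‖ₑ := by
    rw [← ofReal_norm, hg]
    simp
  rw [h2]
  refine h1.trans ?_
  unfold sigmaNorm
  have m : ∀ {n : ℕ}, n ≤ 2 → n ∈ Finset.range (8 + 1) := fun h => Finset.mem_range.2 (by omega)
  refine le_trans ?_ (Finset.single_le_sum (fun _ _ => zero_le) (m ha))
  refine le_trans ?_ (Finset.single_le_sum (fun _ _ => zero_le) (m hb))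
  refine le_trans ?_ (Finset.single_le_sum (fun _ _ => zero_le) (m hc))
  refine le_trans ?_ (Finset.single_le_sum (fun _ _ => zero_le) (m hd))
  rw [if_pos (by omega)]
  simp only [iteratedDeriv_snd, iteratedDeriv_fst, hg]
  exact le_rfl

theorem sigmaNorm_top_ne_top (s : ℕ) (w : 𝓢(ℝ × ℝ, ℂ)) : sigmaNorm s ∞ w ≠ ∞ := by
  unfold sigmaNorm
  refine ENNReal.sum_ne_top.2 fun a _ => ENNReal.sum_ne_top.2 fun b _ =>
    ENNReal.sum_ne_top.2 fun c _ => ENNReal.sum_ne_top.2 fun d _ => ?_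
  split_ifs
  · simp only [iteratedDeriv_snd, iteratedDeriv_fst]
    set g := dX^[c] (dK^[d] w)
    refine (memLp_top_of_bound (C := SchwartzMap.seminorm ℂ (a + b) 0 g) ?_
      (Filter.Eventually.of_forall fun z => ?_)).2.ne
    · have := g.continuous
      exact Continuous.aestronglyMeasurable (by fun_prop)
    · refine le_trans ?_ (SchwartzMap.norm_pow_mul_le_seminorm ℂ g (a + b) z)
      rw [norm_mul, norm_mul, norm_pow, norm_pow, Complex.norm_real, Complex.norm_real, pow_add]
      gcongr
      · exact norm_fst_le z
      · exact norm_snd_le z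
  · exact ENNReal.zero_ne_top

theorem norm_fourier₂_le_sigmaNorm (w : 𝓢(ℝ × ℝ, ℂ)) (X η : ℝ) :
    ‖fourier₂ w X η‖ ≤ 16 * Real.pi ^ 2 * (sigmaNorm 8 ∞ w).toReal *
      ((1 + X ^ 2)⁻¹ * (1 + η ^ 2)⁻¹) :=
  norm_fourier₂_decay (fun _ _ _ _ ha hb hc hd x k =>
    (ENNReal.ofReal_le_iff_le_toReal (sigmaNorm_top_ne_top 8 w)).1 (weighted_deriv_le_sigmaNorm w ha hb hc hd x k)) X η

theorem exists_norm_fourier₂_le (w : 𝓢(ℝ × ℝ, ℂ)) :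
    ∃ A : ℝ, 0 ≤ A ∧ ∀ X η : ℝ, ‖fourier₂ w X η‖ ≤ A * ((1 + X ^ 2)⁻¹ * (1 + η ^ 2)⁻¹) :=
  ⟨16 * Real.pi ^ 2 * (sigmaNorm 8 ∞ w).toReal, by positivity, norm_fourier₂_le_sigmaNorm w⟩

theorem continuous_fourier₂ (w : 𝓢(ℝ × ℝ, ℂ)) :
    Continuous fun z : ℝ × ℝ => fourier₂ w z.1 z.2 := by
  have h : ∀ z : ℝ × ℝ, fourier₂ w z.1 z.2 = ∫ y : ℝ × ℝ,
      Complex.exp (-2 * Real.pi * Complex.I * z.2 * y.2) *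
      (Complex.exp (-2 * Real.pi * Complex.I * z.1 * y.1) * w y) := by
    intro z
    rw [Measure.volume_eq_prod, integral_prod_symm _ (integrable_exp_mul_prod w z.1 z.2)]
    simp only [fourier₂, fourier_sliceX_apply, integral_const_mul]
  simp only [h]
  refine continuous_of_dominated (bound := fun y => ‖w y‖) (fun z => ?_) (fun z => ?_)
    (w.integrable (μ := volume)).norm ?_
  · have := w.continuous
    exact Continuous.aestronglyMeasurable (by fun_prop)
  · refine Filter.Eventually.of_forall fun y => ?_
    rw [norm_mul, norm_mul, norm_exp_of_re_eq_zero (by simp), norm_exp_of_re_eq_zero (by simp),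
      one_mul, one_mul]
  · refine Filter.Eventually.of_forall fun y => ?_
    fun_prop

theorem fourier₂_add (v w : 𝓢(ℝ × ℝ, ℂ)) (X η : ℝ) :
    fourier₂ (v + w) X η = fourier₂ v X η + fourier₂ w X η := by
  simp only [fourier₂]
  rw [← integral_add (integrable_exp_mul_fourier_sliceX v X η)
    (integrable_exp_mul_fourier_sliceX w X η)]
  congr 1; ext k
  rw [map_add, FourierTransform.fourier_add, add_apply]; ring

theorem fourier₂_smul (c : ℂ) (w : 𝓢(ℝ × ℝ, ℂ)) (X η : ℝ) :
    fourier₂ (c • w) X η = c * fourier₂ w X η := by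
  simp only [fourier₂]
  rw [← integral_const_mul]
  congr 1; ext k
  rw [map_smul, FourierTransform.fourier_smul, smul_apply, smul_eq_mul]; ring

/-- The inverse Fourier transform of the spectrum, as a Schwartz function. -/
noncomputable def specInv (P : 𝓢(ℝ, ℝ)) : 𝓢(ℝ, ℂ) :=
  𝓕⁻ (SchwartzMap.postcompCLM (𝕜 := ℝ) Complex.ofRealCLM P)

theorem kernelH_eq (p q : ℝ) (P : 𝓢(ℝ, ℝ)) (X t : ℝ) :
    kernelH p q P X t = 2 * q * Real.sin (2 * Real.pi ^ 2 * p * X ^ 2 * t) *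
      specInv P (2 * Real.pi * p * X * t) := by
  rw [kernelH, specInv, SchwartzMap.fourierInv_coe]; rfl

theorem continuous_kernelH (p q : ℝ) (P : 𝓢(ℝ, ℝ)) :
    Continuous fun z : ℝ × ℝ => kernelH p q P z.1 z.2 := by
  simp only [kernelH_eq]
  have := (specInv P).continuous
  fun_prop

theorem norm_kernelH_le (p q : ℝ) (P : 𝓢(ℝ, ℝ)) (X t : ℝ) :
    ‖kernelH p q P X t‖ ≤ 2 * |q| * ‖specInv P (2 * Real.pi * p * X * t)‖ := by
  rw [kernelH_eq, norm_mul, norm_mul, norm_mul, Complex.norm_real, Complex.norm_real,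
    Complex.norm_ofNat, Real.norm_eq_abs, Real.norm_eq_abs]
  have h1 := Real.abs_sin_le_one (2 * Real.pi ^ 2 * p * X ^ 2 * t)
  exact mul_le_mul_of_nonneg_right (mul_le_of_le_one_right (by positivity) h1) (norm_nonneg _)

theorem exists_kernelH_bound (p q : ℝ) (P : 𝓢(ℝ, ℝ)) :
    ∃ M : ℝ, 0 < M ∧ ∀ X t, ‖kernelH p q P X t‖ ≤ M := by
  refine ⟨2 * |q| * SchwartzMap.seminorm ℂ 0 0 (specInv P) + 1, by positivity, fun X t => ?_⟩
  refine (norm_kernelH_le p q P X t).trans ?_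
  have := SchwartzMap.norm_le_seminorm ℂ (specInv P) (2 * Real.pi * p * X * t)
  have : 2 * |q| * ‖specInv P (2 * Real.pi * p * X * t)‖
    ≤ 2 * |q| * SchwartzMap.seminorm ℂ 0 0 (specInv P) := by gcongr
  linarith

theorem integrable_kernelH (p q : ℝ) (hp : p ≠ 0) (P : 𝓢(ℝ, ℝ)) {X : ℝ} (hX : X ≠ 0) :
    Integrable (kernelH p q P X) := by
  have hc : 2 * Real.pi * p * X ≠ 0 := by simp [hp, hX, Real.pi_ne_zero]
  have h1 : Integrable fun t => specInv P (2 * Real.pi * p * X * t) :=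
    ((specInv P).integrable (μ := volume)).comp_mul_left' hc
  refine (h1.norm.const_mul (2 * |q|)).mono' ?_ (Filter.Eventually.of_forall fun t =>
    norm_kernelH_le p q P X t)
  exact ((continuous_kernelH p q P).comp (by fun_prop :
    Continuous fun t : ℝ => (X, t))).aestronglyMeasurable

/-- The first moment of the kernel is `O(1/|X|)`. -/
theorem exists_moment_kernelH (p q : ℝ) (hp : p ≠ 0) (P : 𝓢(ℝ, ℝ)) :
    ∃ C : ℝ, 0 ≤ C ∧ ∀ X, X ≠ 0 → Integrable (fun t : ℝ => (t : ℂ) * kernelH p q P X t) ∧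
      ∫ t : ℝ, ‖(t : ℂ) * kernelH p q P X t‖ ≤ C / |X| := by
  set J : ℝ := ∫ y : ℝ, ‖y‖ ^ 2 * ‖specInv P y‖ with hJ
  have hJ0 : 0 ≤ J := by positivity
  refine ⟨|q| / (2 * Real.pi * |p|) / |p| * J, by positivity, fun X hX => ?_⟩
  set c : ℝ := 2 * Real.pi * p * X with hc'
  have hc : c ≠ 0 := by simp [hc', hp, hX, Real.pi_ne_zero]
  have hi : Integrable fun t : ℝ => ‖c * t‖ ^ 2 * ‖specInv P (c * t)‖ :=
    ((specInv P).integrable_pow_mul volume 2).comp_mul_left' hc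
  -- Bounding |sin| by its argument trades a factor X²|t|. Rescaling t by c ~ X then gives X²·|X|⁻³,
  -- one power better at small X than bounding the sine by 1.
  have hdom : ∀ t : ℝ, ‖(t : ℂ) * kernelH p q P X t‖
      ≤ (|q| / |p|) * (‖c * t‖ ^ 2 * ‖specInv P (c * t)‖) := by
    intro t
    rw [kernelH_eq, norm_mul, norm_mul, norm_mul, norm_mul, Complex.norm_real, Complex.norm_real,
      Complex.norm_real, Complex.norm_ofNat]
    simp only [Real.norm_eq_abs]
    have h1 : |Real.sin (2 * Real.pi ^ 2 * p * X ^ 2 * t)| ≤ 2 * Real.pi ^ 2 * |p| * X ^ 2 * |t| := by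
      refine Real.abs_sin_le_abs.trans (le_of_eq ?_)
      simp [abs_mul]
    have h2 : 2 * Real.pi * p * X * t = c * t := by rw [hc']
    rw [h2]
    have h3 : |c * t| ^ 2 = 4 * Real.pi ^ 2 * (|p| * |p|) * X ^ 2 * (|t| * |t|) := by
      rw [sq_abs, abs_mul_abs_self, abs_mul_abs_self, hc']; ring
    rw [h3]
    have hp' : 0 < |p| := abs_pos.2 hp
    calc |t| * (2 * |q| * |Real.sin (2 * Real.pi ^ 2 * p * X ^ 2 * t)| * ‖specInv P (c * t)‖)
        ≤ |t| * (2 * |q| * (2 * Real.pi ^ 2 * |p| * X ^ 2 * |t|) * ‖specInv P (c * t)‖) := by gcongr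
      _ = _ := by field_simp; ring
  have hmeas : AEStronglyMeasurable (fun t : ℝ => (t : ℂ) * kernelH p q P X t) volume :=
    (Complex.continuous_ofReal.mul ((continuous_kernelH p q P).comp (by fun_prop :
      Continuous fun t : ℝ => (X, t)))).aestronglyMeasurable
  have hInt : Integrable (fun t : ℝ => (t : ℂ) * kernelH p q P X t) :=
    (hi.const_mul _).mono' hmeas (Filter.Eventually.of_forall hdom)
  refine ⟨hInt, ?_⟩
  calc ∫ t : ℝ, ‖(t : ℂ) * kernelH p q P X t‖
      ≤ ∫ t : ℝ, (|q| / |p|) * (‖c * t‖ ^ 2 * ‖specInv P (c * t)‖) :=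
        integral_mono hInt.norm (hi.const_mul _) hdom
    _ = (|q| / |p|) * (|c⁻¹| * J) := by
        rw [integral_const_mul, Measure.integral_comp_mul_left
          (fun y => ‖y‖ ^ 2 * ‖specInv P y‖) c, smul_eq_mul]
    _ = _ := by
        have hp' : |p| ≠ 0 := abs_ne_zero.2 hp
        have hX' : |X| ≠ 0 := abs_ne_zero.2 hX
        rw [hc', abs_inv, abs_mul, abs_mul, abs_mul, abs_two, abs_of_pos Real.pi_pos]
        field_simp

end Alber

/-! ### Space-time estimate for the density gradient -/

namespace Alber

theorem aestronglyMeasurable_schwartz_uncurry {G : ℝ → 𝓢(ℝ, ℂ)} (hG : ContinuousOn G (Set.Ici 0)) :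
    AEStronglyMeasurable (fun z : ℝ × ℝ => G z.2 z.1)
      ((volume : Measure ℝ).prod ((volume : Measure ℝ).restrict (Set.Ioi 0))) := by
  have hm : (volume : Measure ℝ).prod ((volume : Measure ℝ).restrict (Set.Ioi 0))
      = ((volume : Measure (ℝ × ℝ))).restrict (Set.univ ×ˢ Set.Ioi 0) := by
    rw [Measure.volume_eq_prod, ← Measure.prod_restrict, Measure.restrict_univ]
  rw [hm]
  exact ((continuousOn_schwartz_uncurry hG).mono (Set.prod_mono_right Set.Ioi_subset_Ici_self)
    ).aestronglyMeasurable (MeasurableSet.univ.prod measurableSet_Ioi)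

/-- The `L²(0,∞)` stability estimate at a fixed nonzero frequency. -/
theorem eLpNorm_le_of_stableWith {p q κ : ℝ} (hp : p ≠ 0) {P : 𝓢(ℝ, ℝ)}
    (hs : StableWith p q P κ) {X : ℝ} (hX : X ≠ 0) {u f : ℝ → ℂ}
    (hu : ContinuousOn u (Set.Ici 0))
    (heq : ∀ t, 0 < t → u t = f t + ∫ s in (0 : ℝ)..t, kernelH p q P (-X) (t - s) * u s) :
    eLpNorm u 2 (volume.restrict (Set.Ioi 0)) ≤
      ENNReal.ofReal (1 / κ) * eLpNorm f 2 (volume.restrict (Set.Ioi 0)) := by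
  obtain ⟨M, _, hM⟩ := exists_kernelH_bound p q P
  obtain ⟨C, _, hC⟩ := exists_moment_kernelH p q hp P
  exact volterra_eLpNorm_le ((continuous_kernelH p q P).comp (by fun_prop :
      Continuous fun t : ℝ => (-X, t))) hu hs.1 (hM (-X))
    (integrable_kernelH p q hp P (neg_ne_zero.2 hX)).integrableOn
    (hC (-X) (neg_ne_zero.2 hX)).1.integrableOn (hs.2 (-X)) heq

theorem integrable_inv_one_add_mul_sq {c : ℝ} (hc : c ≠ 0) :
    Integrable fun t : ℝ => (1 + (c * t) ^ 2)⁻¹ :=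
  integrable_inv_one_add_sq.comp_mul_left' hc

theorem integral_inv_one_add_mul_sq (c : ℝ) :
    ∫ t : ℝ, (1 + (c * t) ^ 2)⁻¹ = Real.pi / |c| := by
  rw [Measure.integral_comp_mul_left (fun y : ℝ => (1 + y ^ 2)⁻¹) c,
    integral_univ_inv_one_add_sq, smul_eq_mul, abs_inv]
  ring

/-- Square integrability in time of the free evolution at fixed frequency. -/
theorem lintegral_sq_fourier₂_le {p A : ℝ} (hp : p ≠ 0) {w : 𝓢(ℝ × ℝ, ℂ)}
    (hA : ∀ X η : ℝ, ‖fourier₂ w X η‖ ≤ A * ((1 + X ^ 2)⁻¹ * (1 + η ^ 2)⁻¹)) {X : ℝ} (hX : X ≠ 0) :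
    ∫⁻ t in Set.Ioi (0 : ℝ), ‖fourier₂ w X (2 * Real.pi * p * X * t)‖ₑ ^ 2
      ≤ ENNReal.ofReal ((A * (1 + X ^ 2)⁻¹) ^ 2 / (2 * |p| * |X|)) := by
  set c : ℝ := 2 * Real.pi * p * X with hc'
  have hc : c ≠ 0 := by simp [hc', hp, hX, Real.pi_ne_zero]
  have hp' : 0 < |p| := abs_pos.2 hp
  have hX' : 0 < |X| := abs_pos.2 hX
  calc ∫⁻ t in Set.Ioi (0 : ℝ), ‖fourier₂ w X (c * t)‖ₑ ^ 2
      ≤ ∫⁻ t : ℝ, ‖fourier₂ w X (c * t)‖ₑ ^ 2 := setLIntegral_le_lintegral _ _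
    _ ≤ ∫⁻ t : ℝ, ENNReal.ofReal ((A * (1 + X ^ 2)⁻¹) ^ 2 * (1 + (c * t) ^ 2)⁻¹) := by
        refine lintegral_mono fun t => ?_
        simp only
        rw [← ofReal_norm, ← ENNReal.ofReal_pow (norm_nonneg _)]
        refine ENNReal.ofReal_le_ofReal ?_
        have h1 : (1 + (c * t) ^ 2)⁻¹ ≤ 1 := inv_le_one_of_one_le₀ (by nlinarith [sq_nonneg (c * t)])
        have h0 : 0 ≤ (1 + (c * t) ^ 2)⁻¹ := by positivity
        calc ‖fourier₂ w X (c * t)‖ ^ 2 ≤ (A * ((1 + X ^ 2)⁻¹ * (1 + (c * t) ^ 2)⁻¹)) ^ 2 := by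
              gcongr; exact hA X (c * t)
          _ = (A * (1 + X ^ 2)⁻¹) ^ 2 * ((1 + (c * t) ^ 2)⁻¹ * (1 + (c * t) ^ 2)⁻¹) := by ring
          _ ≤ (A * (1 + X ^ 2)⁻¹) ^ 2 * ((1 + (c * t) ^ 2)⁻¹ * 1) := by gcongr
          _ = _ := by ring
    _ = ENNReal.ofReal (∫ t : ℝ, (A * (1 + X ^ 2)⁻¹) ^ 2 * (1 + (c * t) ^ 2)⁻¹) := by
        rw [ofReal_integral_eq_lintegral_ofReal ((integrable_inv_one_add_mul_sq hc).const_mul _)]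
        exact Filter.Eventually.of_forall fun t => by positivity
    _ = _ := by
        rw [integral_const_mul, integral_inv_one_add_mul_sq, hc', abs_mul, abs_mul, abs_mul,
          abs_two, abs_of_pos Real.pi_pos]
        congr 1
        field_simp

theorem lintegral_sq_deriv_eq (n : 𝓢(ℝ, ℂ)) :
    ∫⁻ x : ℝ, ‖deriv n x‖ₑ ^ 2 = ∫⁻ X : ℝ, ‖2 * Real.pi * Complex.I * X * 𝓕 n X‖ₑ ^ 2 := by
  have h := eLpNorm_fourier_two (SchwartzMap.derivCLM ℂ ℂ n).integrable
    ((SchwartzMap.derivCLM ℂ ℂ n).memLp 2)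
  have h2 : eLpNorm (SchwartzMap.derivCLM ℂ ℂ n) 2 volume ^ 2
      = eLpNorm (𝓕 (SchwartzMap.derivCLM ℂ ℂ n : ℝ → ℂ)) 2 volume ^ 2 := by rw [h]
  rw [eLpNorm_two_sq, eLpNorm_two_sq, ← SchwartzMap.fourier_coe] at h2
  simp only [fourier_derivCLM_apply] at h2
  exact h2

/-- Plancherel in x at each time and Tonelli reduce the claim to the Volterra estimate at each X.
The factor (2πX)² from the derivative against 1/|X| from the time integral leaves a multiple of
|X|(1+X²)⁻², which is at most (1+X²)⁻¹. -/
theorem lintegral_sq_deriv_density_le {p q κ : ℝ} (hp : p ≠ 0) {P : 𝓢(ℝ, ℝ)}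
    (hs : StableWith p q P κ) {w₀ : 𝓢(ℝ × ℝ, ℂ)} {w : ℝ → 𝓢(ℝ × ℝ, ℂ)}
    (hw : IsSolution p q P w₀ w) {A : ℝ}
    (hA : ∀ X η : ℝ, ‖fourier₂ w₀ X η‖ ≤ A * ((1 + X ^ 2)⁻¹ * (1 + η ^ 2)⁻¹)) :
    ∫⁻ z : ℝ × ℝ, ‖deriv (density (w z.2)) z.1‖ₑ ^ 2
        ∂((volume : Measure ℝ).prod ((volume : Measure ℝ).restrict (Set.Ioi 0)))
      ≤ ENNReal.ofReal ((A / κ) ^ 2 * (2 * Real.pi ^ 3 / |p|)) := by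
  have hκ := hs.1
  have hp' : 0 < |p| := abs_pos.2 hp
  have hm1 := aestronglyMeasurable_schwartz_uncurry
    (G := fun t => SchwartzMap.derivCLM ℂ ℂ (densityCLM (w t)))
    ((SchwartzMap.derivCLM ℂ ℂ ∘L densityCLM).continuous.comp_continuousOn hw.continuousOn)
  have hm2 := aestronglyMeasurable_schwartz_uncurry hw.continuousOn_fourier_density
  have hX : ∀ X : ℝ, X ≠ 0 → ∫⁻ t in Set.Ioi (0 : ℝ), ‖𝓕 (densityCLM (w t)) X‖ₑ ^ 2 ≤
      ENNReal.ofReal ((1 / κ) ^ 2 * ((A * (1 + X ^ 2)⁻¹) ^ 2 / (2 * |p| * |X|))) := by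
    intro X hX
    have h := eLpNorm_le_of_stableWith hp hs hX
      (continuousOn_schwartz_apply hw.continuousOn_fourier_density X)
      (f := fun t => fourier₂ w₀ X (2 * Real.pi * p * X * t)) (fun t ht => hw.volterra X ht.le)
    have h2 := pow_le_pow_left' h 2
    rw [mul_pow, eLpNorm_two_sq, eLpNorm_two_sq, ← ENNReal.ofReal_pow (by positivity)] at h2
    rw [ENNReal.ofReal_mul (by positivity)]
    refine h2.trans ?_
    gcongr
    exact lintegral_sq_fourier₂_le hp hA hX
  calc ∫⁻ z : ℝ × ℝ, ‖deriv (density (w z.2)) z.1‖ₑ ^ 2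
        ∂((volume : Measure ℝ).prod ((volume : Measure ℝ).restrict (Set.Ioi 0)))
      = ∫⁻ t in Set.Ioi (0 : ℝ), ∫⁻ x : ℝ, ‖deriv (density (w t)) x‖ₑ ^ 2 :=
        lintegral_prod_symm _ (hm1.enorm.pow_const 2)
    _ = ∫⁻ t in Set.Ioi (0 : ℝ), ∫⁻ X : ℝ,
          ‖2 * Real.pi * Complex.I * X * 𝓕 (densityCLM (w t)) X‖ₑ ^ 2 := by
        refine lintegral_congr fun t => ?_
        exact lintegral_sq_deriv_eq (densityCLM (w t))
    _ = ∫⁻ X : ℝ, ∫⁻ t in Set.Ioi (0 : ℝ),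
          ‖2 * Real.pi * Complex.I * X * 𝓕 (densityCLM (w t)) X‖ₑ ^ 2 := by
        have hm3 : AEStronglyMeasurable (fun z : ℝ × ℝ =>
            2 * Real.pi * Complex.I * z.1 * 𝓕 (densityCLM (w z.2)) z.1)
            ((volume : Measure ℝ).prod ((volume : Measure ℝ).restrict (Set.Ioi 0))) :=
          (Continuous.aestronglyMeasurable (by fun_prop)).mul hm2
        exact (lintegral_lintegral_swap (hm3.enorm.pow_const 2)).symm
    _ ≤ ∫⁻ X : ℝ, ENNReal.ofReal ((A / κ) ^ 2 * (2 * Real.pi ^ 2 / |p|) * (1 + X ^ 2)⁻¹) := by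
        have hne : ∀ᵐ X : ℝ, X ≠ 0 := by simp [ae_iff]
        refine lintegral_mono_ae ?_
        filter_upwards [hne] with X hX0
        have hX' : 0 < |X| := abs_pos.2 hX0
        have e1 : ∀ t : ℝ, ‖2 * Real.pi * Complex.I * X * 𝓕 (densityCLM (w t)) X‖ₑ ^ 2
            = ENNReal.ofReal ((2 * Real.pi * |X|) ^ 2) * ‖𝓕 (densityCLM (w t)) X‖ₑ ^ 2 := by
          intro t
          rw [enorm_mul, mul_pow]
          congr 1
          rw [← ofReal_norm, ← ENNReal.ofReal_pow (norm_nonneg _)]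
          simp [abs_of_pos Real.pi_pos]
        simp only [e1]
        rw [lintegral_const_mul' _ _ ENNReal.ofReal_ne_top]
        refine (mul_le_mul_right (hX X hX0) _).trans ?_
        rw [← ENNReal.ofReal_mul (by positivity)]
        refine ENNReal.ofReal_le_ofReal ?_
        have h1 : |X| * (1 + X ^ 2)⁻¹ ≤ 1 := by
          rw [← div_eq_mul_inv, div_le_one (by positivity), ← sq_abs]
          nlinarith [sq_nonneg (|X| - 1)]
        calc (2 * Real.pi * |X|) ^ 2 *
              ((1 / κ) ^ 2 * ((A * (1 + X ^ 2)⁻¹) ^ 2 / (2 * |p| * |X|)))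
            = (A / κ) ^ 2 * (2 * Real.pi ^ 2 / |p|) * (1 + X ^ 2)⁻¹ * (|X| * (1 + X ^ 2)⁻¹) := by
              field_simp
          _ ≤ _ := mul_le_of_le_one_right (by positivity) h1
    _ = _ := by
        rw [← ofReal_integral_eq_lintegral_ofReal (integrable_inv_one_add_sq.const_mul _)
          (Filter.Eventually.of_forall fun X => by positivity), integral_const_mul,
          integral_univ_inv_one_add_sq]
        congr 1; ring

/-- Space-time square integrability of the gradient of the density. -/
theorem eLpNorm_deriv_density_le {p q κ : ℝ} (hp : p ≠ 0) {P : 𝓢(ℝ, ℝ)}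
    (hs : StableWith p q P κ) {w₀ : 𝓢(ℝ × ℝ, ℂ)} {w : ℝ → 𝓢(ℝ × ℝ, ℂ)}
    (hw : IsSolution p q P w₀ w) :
    eLpNorm (fun z : ℝ × ℝ => deriv (density (w z.2)) z.1) 2
        ((volume : Measure ℝ).prod ((volume : Measure ℝ).restrict (Set.Ioi 0)))
      ≤ ENNReal.ofReal (16 * Real.pi ^ 2 * √(2 * Real.pi ^ 3 / |p|) / κ) *
        sigmaNorm 8 ∞ w₀ := by
  have hκ := hs.1
  have h := lintegral_sq_deriv_density_le hp hs hw (norm_fourier₂_le_sigmaNorm w₀)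
  have h2 := eLpNorm_nnreal_pow_eq_lintegral
    (f := fun z : ℝ × ℝ => deriv (density (w z.2)) z.1)
    (μ := (volume : Measure ℝ).prod ((volume : Measure ℝ).restrict (Set.Ioi 0))) (p := 2)
    (by norm_num)
  simp only [NNReal.coe_ofNat, ENNReal.rpow_ofNat, ENNReal.coe_ofNat] at h2
  rw [← ENNReal.pow_le_pow_left_iff (n := 2) (by norm_num), h2]
  refine h.trans (le_of_eq ?_)
  conv_rhs => rw [← ENNReal.ofReal_toReal (sigmaNorm_top_ne_top 8 w₀)]
  rw [← ENNReal.ofReal_mul (by positivity), ← ENNReal.ofReal_pow (by positivity)]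
  congr 1
  have : √(2 * Real.pi ^ 3 / |p|) ^ 2 = 2 * Real.pi ^ 3 / |p| := Real.sq_sqrt (by positivity)
  linear_combination (-(16 * Real.pi ^ 2 * (sigmaNorm 8 ∞ w₀).toReal / κ) ^ 2) * this

end Alber

/-! ### Linear construction of the frequency-side density -/

namespace Alber

open scoped BoundedContinuousFunction

/-- The gain 1/σ, uniform in T, that makes the weighted Volterra operator small. -/
theorem integral_exp_weight_le {σ T : ℝ} (hσ : 0 < σ) :
    ∫ s in (0 : ℝ)..T, Real.exp (-σ * (T - s)) ≤ 1 / σ := by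
  have hd : ∀ s ∈ Set.uIcc 0 T, HasDerivAt (fun s => Real.exp (-σ * (T - s)) / σ)
      (Real.exp (-σ * (T - s))) s := by
    intro s _
    have h1 : HasDerivAt (fun s => -σ * (T - s)) (-σ * (0 - 1)) s :=
      ((hasDerivAt_const s T).sub (hasDerivAt_id s)).const_mul (-σ)
    refine (h1.exp.div_const σ).congr_deriv ?_
    field_simp
    ring
  rw [intervalIntegral.integral_eq_sub_of_hasDerivAt hd
    (Continuous.intervalIntegrable (by fun_prop) _ _)]
  have : 0 ≤ Real.exp (-σ * (T - 0)) / σ := by positivity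
  simp only [sub_self, mul_zero, Real.exp_zero]
  linarith

/-- The exponentially weighted Volterra integral of a bounded continuous function. -/
noncomputable def volterraFun (p q : ℝ) (P : 𝓢(ℝ, ℝ)) (σ : ℝ) (v : ℝ × ℝ → ℂ) (z : ℝ × ℝ) : ℂ :=
  -- Clamping time at 0 freezes the function for negative times, so that it is bounded and
  -- continuous on the whole plane; only t ≥ 0 is used later.
  ∫ s in (0 : ℝ)..max z.2 0, kernelH p q P (-z.1) (max z.2 0 - s) *
    (Real.exp (-σ * (max z.2 0 - s)) : ℂ) * v (z.1, s)

theorem continuous_volterraFun (p q : ℝ) (P : 𝓢(ℝ, ℝ)) (σ : ℝ) {v : ℝ × ℝ → ℂ}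
    (hv : Continuous v) : Continuous (volterraFun p q P σ v) := by
  have h1 : Continuous fun y : (ℝ × ℝ) × ℝ => kernelH p q P (-y.1.1) (max y.1.2 0 - y.2) :=
    (continuous_kernelH p q P).comp (f := fun y : (ℝ × ℝ) × ℝ => (-y.1.1, max y.1.2 0 - y.2))
      (by fun_prop)
  have h2 : Continuous fun y : (ℝ × ℝ) × ℝ => v (y.1.1, y.2) := hv.comp (by fun_prop)
  have h3 : Continuous fun y : (ℝ × ℝ) × ℝ => (Real.exp (-σ * (max y.1.2 0 - y.2)) : ℂ) := by
    fun_prop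
  have h4 : Continuous (Function.uncurry fun (z : ℝ × ℝ) (s : ℝ) =>
      kernelH p q P (-z.1) (max z.2 0 - s) * (Real.exp (-σ * (max z.2 0 - s)) : ℂ) * v (z.1, s)) :=
    (h1.mul h3).mul h2
  exact intervalIntegral.continuous_parametric_intervalIntegral_of_continuous h4
    (s := fun z : ℝ × ℝ => max z.2 0) (by fun_prop)

theorem norm_volterraFun_le {p q : ℝ} {P : 𝓢(ℝ, ℝ)} {M σ B : ℝ} (hσ : 0 < σ) (hB : 0 ≤ B)
    (hM : ∀ X t, ‖kernelH p q P X t‖ ≤ M) {v : ℝ × ℝ → ℂ} (hvB : ∀ z, ‖v z‖ ≤ B) (z : ℝ × ℝ) :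
    ‖volterraFun p q P σ v z‖ ≤ M / σ * B := by
  have hM0 : 0 ≤ M := (norm_nonneg _).trans (hM 0 0)
  set T := max z.2 0 with hT
  have hT0 : 0 ≤ T := le_max_right _ _
  refine (intervalIntegral.norm_integral_le_of_norm_le hT0
    (g := fun s => M * B * Real.exp (-σ * (T - s)))
    (Filter.Eventually.of_forall fun s _ => ?_)
    (Continuous.intervalIntegrable (by fun_prop) _ _)).trans ?_
  · rw [norm_mul, norm_mul, Complex.norm_real, Real.norm_eq_abs, Real.abs_exp]
    calc _ ≤ M * Real.exp (-σ * (T - s)) * B := by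
          gcongr
          · exact hM _ _
          · exact hvB _
      _ = _ := by ring
  · rw [intervalIntegral.integral_const_mul]
    calc M * B * ∫ s in (0 : ℝ)..T, Real.exp (-σ * (T - s)) ≤ M * B * (1 / σ) := by
          gcongr; exact integral_exp_weight_le hσ
      _ = _ := by ring

/-- The weighted Volterra integral as a bounded operator. -/
noncomputable def volterraCLM {p q : ℝ} {P : 𝓢(ℝ, ℝ)} {M σ : ℝ} (hσ : 0 < σ)
    (hM : ∀ X t, ‖kernelH p q P X t‖ ≤ M) : (ℝ × ℝ →ᵇ ℂ) →L[ℂ] (ℝ × ℝ →ᵇ ℂ) :=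
  LinearMap.mkContinuous
    { toFun := fun v => BoundedContinuousFunction.ofNormedAddCommGroup
        (volterraFun p q P σ v) (continuous_volterraFun p q P σ v.continuous) (M / σ * ‖v‖)
        (norm_volterraFun_le hσ (norm_nonneg _) hM v.norm_coe_le_norm)
      map_add' := fun v w => by
        ext z
        simp only [BoundedContinuousFunction.coe_ofNormedAddCommGroup, volterraFun,
          BoundedContinuousFunction.coe_add, Pi.add_apply, mul_add]
        have hc : ∀ v : ℝ × ℝ →ᵇ ℂ, Continuous fun s : ℝ => kernelH p q P (-z.1) (max z.2 0 - s) *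
            (Real.exp (-σ * (max z.2 0 - s)) : ℂ) * v (z.1, s) := by
          intro v
          have h1 : Continuous fun s : ℝ => kernelH p q P (-z.1) (max z.2 0 - s) :=
            (continuous_kernelH p q P).comp (f := fun s : ℝ => (-z.1, max z.2 0 - s)) (by fun_prop)
          exact (h1.mul (by fun_prop)).mul (v.continuous.comp (by fun_prop))
        exact intervalIntegral.integral_add ((hc v).intervalIntegrable _ _)
          ((hc w).intervalIntegrable _ _)
      map_smul' := fun c v => by
        ext z
        simp only [BoundedContinuousFunction.coe_ofNormedAddCommGroup, volterraFun,
          BoundedContinuousFunction.coe_smul, smul_eq_mul, RingHom.id_apply]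
        rw [← intervalIntegral.integral_const_mul]
        congr 1; ext s; ring }
    (M / σ) (fun v => BoundedContinuousFunction.norm_ofNormedAddCommGroup_le _
      (mul_nonneg (div_nonneg ((norm_nonneg _).trans (hM 0 0)) hσ.le) (norm_nonneg _))
      (norm_volterraFun_le hσ (norm_nonneg _) hM v.norm_coe_le_norm))

theorem norm_volterraCLM_le {p q : ℝ} {P : 𝓢(ℝ, ℝ)} {M σ : ℝ} (hσ : 0 < σ)
    (hM : ∀ X t, ‖kernelH p q P X t‖ ≤ M) : ‖volterraCLM hσ hM‖ ≤ M / σ :=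
  LinearMap.mkContinuous_norm_le _ (div_nonneg ((norm_nonneg _).trans (hM 0 0)) hσ.le) _

/-- The weighted free evolution as a bounded continuous function of frequency and time. -/
noncomputable def freeBCF (p σ : ℝ) (hσ : 0 < σ) : 𝓢(ℝ × ℝ, ℂ) →ₗ[ℂ] (ℝ × ℝ →ᵇ ℂ) where
  toFun w := BoundedContinuousFunction.ofNormedAddCommGroup
    (fun z : ℝ × ℝ => (Real.exp (-σ * max z.2 0) : ℂ) *
      fourier₂ w z.1 (2 * Real.pi * p * z.1 * z.2))
    ((by fun_prop : Continuous fun z : ℝ × ℝ => (Real.exp (-σ * max z.2 0) : ℂ)).mul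
      ((continuous_fourier₂ w).comp (f := fun z : ℝ × ℝ => (z.1, 2 * Real.pi * p * z.1 * z.2))
        (by fun_prop)))
    (exists_norm_fourier₂_le w).choose
    (fun z => by
      obtain ⟨h0, h⟩ := (exists_norm_fourier₂_le w).choose_spec
      set A := (exists_norm_fourier₂_le w).choose
      set η := 2 * Real.pi * p * z.1 * z.2
      have h1 : (1 + z.1 ^ 2)⁻¹ ≤ 1 := inv_le_one_of_one_le₀ (by nlinarith [sq_nonneg z.1])
      have h2 : (1 + η ^ 2)⁻¹ ≤ 1 := inv_le_one_of_one_le₀ (by nlinarith [sq_nonneg η])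
      have h3 : Real.exp (-σ * max z.2 0) ≤ 1 :=
        Real.exp_le_one_iff.2 (by nlinarith [le_max_right z.2 0])
      rw [norm_mul, Complex.norm_real, Real.norm_eq_abs, Real.abs_exp]
      calc _ ≤ 1 * (A * (1 * 1)) := by
            gcongr
            refine (h z.1 η).trans ?_
            gcongr
        _ = A := by ring)
  map_add' v w := by
    ext z
    simp [fourier₂_add, mul_add]
  map_smul' c w := by
    ext z
    simp [fourier₂_smul]
    ring

/-- The frequency-side density equation is solvable, continuously in frequency and time, and
linearly in the initial datum. -/
theorem exists_volterra_solution (p q : ℝ) (P : 𝓢(ℝ, ℝ)) :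
    ∃ U : 𝓢(ℝ × ℝ, ℂ) →ₗ[ℂ] (ℝ × ℝ → ℂ), (∀ w, Continuous (U w)) ∧
      ∀ w X t, 0 ≤ t → U w (X, t) = fourier₂ w X (2 * Real.pi * p * X * t) +
        ∫ s in (0 : ℝ)..t, kernelH p q P (-X) (t - s) * U w (X, s) := by
  obtain ⟨M, hM0, hM⟩ := exists_kernelH_bound p q P
  -- With σ = 2M the operator norm is at most M/σ = 1/2, so 1 - K is invertible. Stability plays no
  -- role in existence.
  have hσ : 0 < 2 * M := by linarith
  set σ := 2 * M with hσdef
  set K := volterraCLM hσ hM with hK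
  have hKn : ‖K‖ < 1 := by
    refine lt_of_le_of_lt (norm_volterraCLM_le hσ hM) ?_
    rw [hσdef, div_lt_one hσ]; linarith
  set R : (ℝ × ℝ →ᵇ ℂ) →L[ℂ] (ℝ × ℝ →ᵇ ℂ) := ↑(Units.oneSub K hKn)⁻¹ with hR
  have hsolve : ∀ F, R F = F + K (R F) := by
    intro F
    have h1 : (1 - K) * R = 1 := by
      exact (Units.oneSub K hKn).mul_inv
    have h2 := congrArg (fun L : (ℝ × ℝ →ᵇ ℂ) →L[ℂ] (ℝ × ℝ →ᵇ ℂ) => L F) h1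
    simp only [mul_apply_eq_comp, sub_apply, one_apply_eq_self] at h2
    exact sub_eq_iff_eq_add.1 h2
  let U : 𝓢(ℝ × ℝ, ℂ) →ₗ[ℂ] (ℝ × ℝ → ℂ) :=
    { toFun := fun w z => (Real.exp (σ * z.2) : ℂ) * R (freeBCF p σ hσ w) z
      map_add' := fun v w => by
        ext z
        simp [mul_add]
      map_smul' := fun c w => by
        ext z
        simp
        ring }
  refine ⟨U, fun w => ?_, fun w X t ht => ?_⟩
  · exact (by fun_prop : Continuous fun z : ℝ × ℝ => (Real.exp (σ * z.2) : ℂ)).mul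
      (R (freeBCF p σ hσ w)).continuous
  · have h1 := congrArg (fun v : ℝ × ℝ →ᵇ ℂ => v (X, t)) (hsolve (freeBCF p σ hσ w))
    set v := R (freeBCF p σ hσ w) with hv
    have h2 : v (X, t) = (Real.exp (-σ * t) : ℂ) * fourier₂ w X (2 * Real.pi * p * X * t) +
        ∫ s in (0 : ℝ)..t, kernelH p q P (-X) (t - s) * (Real.exp (-σ * (t - s)) : ℂ) * v (X, s) := by
      have e : K v (X, t) = volterraFun p q P σ v (X, t) := rfl
      have e' : freeBCF p σ hσ w (X, t) = (Real.exp (-σ * max t 0) : ℂ) *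
        fourier₂ w X (2 * Real.pi * p * X * t) := rfl
      simp only [BoundedContinuousFunction.coe_add, Pi.add_apply] at h1
      rw [h1, e, e', volterraFun]
      simp only [max_eq_left ht]
    change (Real.exp (σ * t) : ℂ) * v (X, t) = _ + ∫ s in (0 : ℝ)..t, kernelH p q P (-X) (t - s) *
      ((Real.exp (σ * s) : ℂ) * v (X, s))
    rw [h2, mul_add, ← mul_assoc, ← intervalIntegral.integral_const_mul]
    congr 1
    · rw [← Complex.ofReal_mul, ← Real.exp_add]; simp
    · refine intervalIntegral.integral_congr fun s _ => ?_
      have : Real.exp (σ * s) = Real.exp (σ * t) * Real.exp (-σ * (t - s)) := by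
        rw [← Real.exp_add]; congr 1; ring
      rw [this]; push_cast; ring

end Alber

/-! ### Time decay at fixed frequency: from weighted L² to L¹ -/

namespace Alber

theorem continuous_volterra_integral {k v : ℝ → ℂ} (hk : Continuous k) (hv : Continuous v) :
    Continuous fun t => ∫ s in (0 : ℝ)..t, k (t - s) * v s := by
  have h : Continuous (Function.uncurry fun t s : ℝ => k (t - s) * v s) := by
    have h1 : Continuous fun y : ℝ × ℝ => k (y.1 - y.2) := hk.comp (by fun_prop)
    have h2 : Continuous fun y : ℝ × ℝ => v y.2 := hv.comp (by fun_prop)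
    exact h1.mul h2
  exact intervalIntegral.continuous_parametric_intervalIntegral_of_continuous h
    (s := fun t : ℝ => t) (by fun_prop)

/-- Young's inequality for Volterra integrals on the half line. -/
theorem eLpNorm_volterra_integral_le {k v : ℝ → ℂ} (hk : Continuous k) (hv : Continuous v) :
    eLpNorm (fun t => ∫ s in (0 : ℝ)..t, k (t - s) * v s) 2 (volume.restrict (Set.Ioi 0)) ≤
      (∫⁻ t, ‖k t‖ₑ) * eLpNorm v 2 (volume.restrict (Set.Ioi 0)) := by
  set I : Set ℝ := Set.Ioi 0
  have hI : MeasurableSet I := measurableSet_Ioi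
  rw [← eLpNorm_indicator_eq_eLpNorm_restrict hI, ← eLpNorm_indicator_eq_eLpNorm_restrict hI]
  refine eLpNorm_two_le_of_enorm_le_conv (A := fun t => ‖k t‖ₑ) hk.enorm.measurable
    (hv.measurable.indicator hI) fun t => ?_
  by_cases ht : t ∈ I
  · have ht' : 0 < t := ht
    rw [Set.indicator_of_mem ht, intervalIntegral.integral_of_le ht'.le]
    refine (enorm_integral_le_lintegral_enorm _).trans ?_
    rw [← lintegral_indicator measurableSet_Ioc]
    refine lintegral_mono fun s => ?_
    by_cases hs : s ∈ Set.Ioc 0 t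
    · rw [Set.indicator_of_mem hs, Set.indicator_of_mem (show s ∈ I from hs.1), enorm_mul]
    · rw [Set.indicator_of_notMem hs]; exact zero_le
  · rw [Set.indicator_of_notMem ht]; simp

theorem eLpNorm_two_le_ofReal {f : ℝ → ℂ} {μ : Measure ℝ} {y : ℝ} (hy : 0 ≤ y)
    (h : ∫⁻ t, ‖f t‖ₑ ^ 2 ∂μ ≤ ENNReal.ofReal (y ^ 2)) : eLpNorm f 2 μ ≤ ENNReal.ofReal y := by
  rw [← ENNReal.pow_le_pow_left_iff (n := 2) (by norm_num), eLpNorm_two_sq,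
    ← ENNReal.ofReal_pow hy]
  exact h

/-- One of the two factors (1+(ct)²)⁻¹ absorbs t² at the price c⁻², and the other is integrated. -/
theorem lintegral_sq_mul_fourier₂_le {p A : ℝ} (hp : p ≠ 0) {w : 𝓢(ℝ × ℝ, ℂ)}
    (hA : ∀ X η : ℝ, ‖fourier₂ w X η‖ ≤ A * ((1 + X ^ 2)⁻¹ * (1 + η ^ 2)⁻¹)) {X : ℝ} (hX : X ≠ 0) :
    ∫⁻ t in Set.Ioi (0 : ℝ), ‖(t : ℂ) * fourier₂ w X (2 * Real.pi * p * X * t)‖ₑ ^ 2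
      ≤ ENNReal.ofReal ((A * (1 + X ^ 2)⁻¹ / (2 * Real.pi * p * X)) ^ 2 / (2 * |p| * |X|)) := by
  set c : ℝ := 2 * Real.pi * p * X with hc'
  have hc : c ≠ 0 := by simp [hc', hp, hX, Real.pi_ne_zero]
  have hp' : 0 < |p| := abs_pos.2 hp
  have hX' : 0 < |X| := abs_pos.2 hX
  calc ∫⁻ t in Set.Ioi (0 : ℝ), ‖(t : ℂ) * fourier₂ w X (c * t)‖ₑ ^ 2
      ≤ ∫⁻ t : ℝ, ‖(t : ℂ) * fourier₂ w X (c * t)‖ₑ ^ 2 := setLIntegral_le_lintegral _ _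
    _ ≤ ∫⁻ t : ℝ, ENNReal.ofReal ((A * (1 + X ^ 2)⁻¹ / c) ^ 2 * (1 + (c * t) ^ 2)⁻¹) := by
        refine lintegral_mono fun t => ?_
        simp only
        rw [← ofReal_norm, ← ENNReal.ofReal_pow (norm_nonneg _)]
        refine ENNReal.ofReal_le_ofReal ?_
        have h1 : (c * t) ^ 2 * (1 + (c * t) ^ 2)⁻¹ ≤ 1 := by
          rw [← div_eq_mul_inv, div_le_one (by positivity)]; linarith
        rw [norm_mul, Complex.norm_real, Real.norm_eq_abs, mul_pow, sq_abs]
        calc t ^ 2 * ‖fourier₂ w X (c * t)‖ ^ 2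
            ≤ t ^ 2 * (A * ((1 + X ^ 2)⁻¹ * (1 + (c * t) ^ 2)⁻¹)) ^ 2 := by
              gcongr; exact hA X (c * t)
          _ = (A * (1 + X ^ 2)⁻¹ / c) ^ 2 * (1 + (c * t) ^ 2)⁻¹ *
              ((c * t) ^ 2 * (1 + (c * t) ^ 2)⁻¹) := by
              field_simp
          _ ≤ _ := mul_le_of_le_one_right (by positivity) h1
    _ = ENNReal.ofReal (∫ t : ℝ, (A * (1 + X ^ 2)⁻¹ / c) ^ 2 * (1 + (c * t) ^ 2)⁻¹) := by
        rw [ofReal_integral_eq_lintegral_ofReal ((integrable_inv_one_add_mul_sq hc).const_mul _)]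
        exact Filter.Eventually.of_forall fun t => by positivity
    _ = _ := by
        rw [integral_const_mul, integral_inv_one_add_mul_sq]
        congr 1
        have : |c| = 2 * Real.pi * |p| * |X| := by
          rw [hc', abs_mul, abs_mul, abs_mul, abs_two, abs_of_pos Real.pi_pos]
        rw [this]
        field_simp

/-- Weighted `L²` bounds in time at a fixed frequency. -/
theorem eLpNorm_solution_le {p q κ : ℝ} (hp : p ≠ 0) {P : 𝓢(ℝ, ℝ)} (hs : StableWith p q P κ)
    {w : 𝓢(ℝ × ℝ, ℂ)} {A : ℝ} (hA0 : 0 ≤ A)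
    (hA : ∀ X η : ℝ, ‖fourier₂ w X η‖ ≤ A * ((1 + X ^ 2)⁻¹ * (1 + η ^ 2)⁻¹)) {C : ℝ} (hC0 : 0 ≤ C)
    (hC : ∀ X, X ≠ 0 → Integrable (fun t : ℝ => (t : ℂ) * kernelH p q P X t) ∧
      ∫ t : ℝ, ‖(t : ℂ) * kernelH p q P X t‖ ≤ C / |X|) {X : ℝ} (hX : X ≠ 0) {u : ℝ → ℂ}
    (hu : Continuous u)
    (heq : ∀ t, 0 ≤ t → u t = fourier₂ w X (2 * Real.pi * p * X * t) +
      ∫ s in (0 : ℝ)..t, kernelH p q P (-X) (t - s) * u s) :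
    eLpNorm u 2 (volume.restrict (Set.Ioi 0)) ≤
        ENNReal.ofReal (A / κ * ((1 + X ^ 2)⁻¹ / √(2 * |p| * |X|))) ∧
      eLpNorm (fun t : ℝ => (t : ℂ) * u t) 2 (volume.restrict (Set.Ioi 0)) ≤
        ENNReal.ofReal ((A / (2 * Real.pi * |p|) + C * (A / κ)) / κ *
          ((1 + X ^ 2)⁻¹ / √(2 * |p| * |X|)) / |X|) := by
  have hκ := hs.1
  have hp' : 0 < |p| := abs_pos.2 hp
  have hX' : 0 < |X| := abs_pos.2 hX
  set m : ℝ := (1 + X ^ 2)⁻¹ / √(2 * |p| * |X|) with hm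
  have hm0 : 0 ≤ m := by positivity
  have hsq : √(2 * |p| * |X|) ^ 2 = 2 * |p| * |X| := Real.sq_sqrt (by positivity)
  set f : ℝ → ℂ := fun t => fourier₂ w X (2 * Real.pi * p * X * t) with hf
  have hfc : Continuous f := (continuous_fourier₂ w).comp
    (f := fun t : ℝ => (X, 2 * Real.pi * p * X * t)) (by fun_prop)
  set h : ℝ → ℂ := kernelH p q P (-X) with hh
  have hhc : Continuous h := (continuous_kernelH p q P).comp (f := fun t : ℝ => (-X, t))
    (by fun_prop)
  have hf1 : eLpNorm f 2 (volume.restrict (Set.Ioi 0)) ≤ ENNReal.ofReal (A * m) := by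
    refine eLpNorm_two_le_ofReal (by positivity) ((lintegral_sq_fourier₂_le hp hA hX).trans
      (le_of_eq ?_))
    rw [hm, ← mul_div_assoc, div_pow, hsq]
  have hf2 : eLpNorm (fun t : ℝ => (t : ℂ) * f t) 2 (volume.restrict (Set.Ioi 0)) ≤
      ENNReal.ofReal (A * m / (2 * Real.pi * |p| * |X|)) := by
    refine eLpNorm_two_le_ofReal (by positivity) ((lintegral_sq_mul_fourier₂_le hp hA hX).trans
      (le_of_eq ?_))
    have : (2 * Real.pi * |p| * |X|) ^ 2 = (2 * Real.pi * p * X) ^ 2 := by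
      simp only [mul_pow, sq_abs]
    rw [div_pow _ (2 * Real.pi * |p| * |X|), this, div_pow _ (2 * Real.pi * p * X), hm,
      ← mul_div_assoc, div_pow, hsq]
    congr 1
    ring
  have hu1 : eLpNorm u 2 (volume.restrict (Set.Ioi 0)) ≤ ENNReal.ofReal (A / κ * m) := by
    refine (eLpNorm_le_of_stableWith hp hs hX hu.continuousOn fun t ht => heq t ht.le).trans ?_
    refine (mul_le_mul_right hf1 _).trans (le_of_eq ?_)
    rw [← ENNReal.ofReal_mul (by positivity)]
    congr 1; ring
  refine ⟨hu1, ?_⟩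
  set k : ℝ → ℂ := fun t => (t : ℂ) * h t with hk
  have hkc : Continuous k := by fun_prop
  have hk1 : ∫⁻ t, ‖k t‖ₑ ≤ ENNReal.ofReal (C / |X|) := by
    obtain ⟨i1, i2⟩ := hC (-X) (neg_ne_zero.2 hX)
    rw [← ofReal_integral_norm_eq_lintegral_enorm i1]
    rw [abs_neg] at i2
    exact ENNReal.ofReal_le_ofReal i2
  -- Writing t = (t-s) + s under the integral shows that t u solves the same equation with an extra
  -- forcing (t h) * u.
  have htu : ∀ t : ℝ, 0 < t → (t : ℂ) * u t =
      ((t : ℂ) * f t + ∫ s in (0 : ℝ)..t, k (t - s) * u s) +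
        ∫ s in (0 : ℝ)..t, h (t - s) * ((s : ℂ) * u s) := by
    intro t ht
    have i1 : IntervalIntegrable (fun s => k (t - s) * u s) volume 0 t :=
      Continuous.intervalIntegrable (by fun_prop) _ _
    have i2 : IntervalIntegrable (fun s : ℝ => h (t - s) * ((s : ℂ) * u s)) volume 0 t :=
      Continuous.intervalIntegrable (by fun_prop) _ _
    rw [add_assoc, ← intervalIntegral.integral_add i1 i2]
    conv_lhs => rw [heq t ht.le, mul_add, ← intervalIntegral.integral_const_mul]
    congr 2; ext s
    simp only [hk]; push_cast; ring
  -- Only continuity of t u is required, so square integrability of t u is a conclusion here, not an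
  -- assumption.
  have h1 := eLpNorm_le_of_stableWith hp hs hX (u := fun t : ℝ => (t : ℂ) * u t)
    (by fun_prop : Continuous _).continuousOn htu
  refine h1.trans ?_
  have h2 : eLpNorm (fun t : ℝ => (t : ℂ) * f t + ∫ s in (0 : ℝ)..t, k (t - s) * u s) 2
      (volume.restrict (Set.Ioi 0)) ≤
      ENNReal.ofReal (A * m / (2 * Real.pi * |p| * |X|) + C / |X| * (A / κ * m)) := by
    refine (eLpNorm_add_le (by fun_prop : Continuous fun t : ℝ => (t : ℂ) * f t).aestronglyMeasurable
      (continuous_volterra_integral hkc hu).aestronglyMeasurable (by norm_num)).trans ?_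
    rw [ENNReal.ofReal_add (by positivity) (by positivity),
      ENNReal.ofReal_mul (by positivity : 0 ≤ C / |X|)]
    refine add_le_add hf2 ((eLpNorm_volterra_integral_le hkc hu).trans ?_)
    exact mul_le_mul' hk1 hu1
  refine (mul_le_mul_right h2 _).trans (le_of_eq ?_)
  rw [← ENNReal.ofReal_mul (by positivity)]
  congr 1
  field_simp

/-- Integrability in time of the solution at a fixed frequency, with an explicit dependence on
the frequency. -/
theorem exists_lintegral_solution_le {p q κ : ℝ} (hp : p ≠ 0) {P : 𝓢(ℝ, ℝ)}
    (hs : StableWith p q P κ) (w : 𝓢(ℝ × ℝ, ℂ)) :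
    ∃ B : ℝ, 0 ≤ B ∧ ∀ X, X ≠ 0 → ∀ u : ℝ → ℂ, Continuous u →
      (∀ t, 0 ≤ t → u t = fourier₂ w X (2 * Real.pi * p * X * t) +
        ∫ s in (0 : ℝ)..t, kernelH p q P (-X) (t - s) * u s) →
      ∫⁻ t in Set.Ioi (0 : ℝ), ‖u t‖ₑ ≤ ENNReal.ofReal (B * ((1 + X ^ 2)⁻¹ / |X|)) := by
  obtain ⟨A, hA0, hA⟩ := exists_norm_fourier₂_le w
  obtain ⟨C, hC0, hC⟩ := exists_moment_kernelH p q hp P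
  have hκ := hs.1
  have hp' : 0 < |p| := abs_pos.2 hp
  set b₁ : ℝ := A / κ with hb₁
  set b₂ : ℝ := (A / (2 * Real.pi * |p|) + C * (A / κ)) / κ with hb₂
  have hb₁0 : 0 ≤ b₁ := by positivity
  have hb₂0 : 0 ≤ b₂ := by positivity
  -- π comes from integrating (1+(Xt)²)⁻¹, and the other two terms from the squared L² norms of u
  -- and t u; all three share the factor (1+X²)⁻¹/|X|.
  refine ⟨Real.pi + (b₁ ^ 2 + b₂ ^ 2) / (2 * |p|), by positivity, fun X hX u hu heq => ?_⟩
  obtain ⟨h1, h2⟩ := eLpNorm_solution_le hp hs hA0 hA hC0 hC hX hu heq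
  have hX' : 0 < |X| := abs_pos.2 hX
  set m : ℝ := (1 + X ^ 2)⁻¹ / √(2 * |p| * |X|) with hm
  have hm0 : 0 ≤ m := by positivity
  have hmsq : m ^ 2 = ((1 + X ^ 2)⁻¹) ^ 2 / (2 * |p| * |X|) := by
    rw [hm, div_pow, Real.sq_sqrt (by positivity)]
  have s1 : ∫⁻ t in Set.Ioi (0 : ℝ), ‖u t‖ₑ ^ 2 ≤ ENNReal.ofReal ((b₁ * m) ^ 2) := by
    rw [← eLpNorm_two_sq, ENNReal.ofReal_pow (by positivity)]
    gcongr
  have s2 : ∫⁻ t in Set.Ioi (0 : ℝ), ‖(t : ℂ) * u t‖ₑ ^ 2 ≤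
      ENNReal.ofReal ((b₂ * m / |X|) ^ 2) := by
    rw [← eLpNorm_two_sq, ENNReal.ofReal_pow (by positivity)]
    gcongr
  set a : ℝ := (1 + X ^ 2)⁻¹ with ha
  have ha0 : 0 < a := by positivity
  -- Weighted arithmetic–geometric inequality y ≤ c + y²/c with c = a/(1+(Xt)²), adapted to the
  -- natural time scale 1/|X|.
  have hpt : ∀ t : ℝ, ‖u t‖ₑ ≤ ENNReal.ofReal (a * (1 + (X * t) ^ 2)⁻¹) +
      (ENNReal.ofReal a⁻¹ * ‖u t‖ₑ ^ 2 + ENNReal.ofReal (a⁻¹ * X ^ 2) * ‖(t : ℂ) * u t‖ₑ ^ 2) := by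
    intro t
    simp only [← ofReal_norm]
    rw [← ENNReal.ofReal_pow (norm_nonneg _), ← ENNReal.ofReal_pow (norm_nonneg _),
      ← ENNReal.ofReal_mul (by positivity), ← ENNReal.ofReal_mul (by positivity),
      ← ENNReal.ofReal_add (by positivity) (by positivity),
      ← ENNReal.ofReal_add (by positivity) (by positivity)]
    refine ENNReal.ofReal_le_ofReal ?_
    rw [norm_mul, Complex.norm_real, Real.norm_eq_abs, mul_pow |t|, sq_abs]
    set y := ‖u t‖
    set r := 1 + (X * t) ^ 2 with hr
    have hr0 : 0 < r := by positivity
    have e : a⁻¹ * y ^ 2 + a⁻¹ * X ^ 2 * (t ^ 2 * y ^ 2) = (a * r⁻¹)⁻¹ * y ^ 2 := by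
      rw [mul_inv, inv_inv r, hr]; ring
    rw [e]
    have hc0 : 0 < a * r⁻¹ := by positivity
    set c := a * r⁻¹
    have hy : 0 ≤ y := norm_nonneg _
    have : 0 ≤ c⁻¹ * (y - c) ^ 2 := by positivity
    have e2 : c⁻¹ * (y - c) ^ 2 = c⁻¹ * y ^ 2 - 2 * y + c := by field_simp; ring
    rw [e2] at this
    linarith
  have hum : Measurable u := hu.measurable
  calc ∫⁻ t in Set.Ioi (0 : ℝ), ‖u t‖ₑ
      ≤ ∫⁻ t in Set.Ioi (0 : ℝ), (ENNReal.ofReal (a * (1 + (X * t) ^ 2)⁻¹) +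
        (ENNReal.ofReal a⁻¹ * ‖u t‖ₑ ^ 2 + ENNReal.ofReal (a⁻¹ * X ^ 2) * ‖(t : ℂ) * u t‖ₑ ^ 2)) :=
        lintegral_mono hpt
    _ = (∫⁻ t in Set.Ioi (0 : ℝ), ENNReal.ofReal (a * (1 + (X * t) ^ 2)⁻¹)) +
        (ENNReal.ofReal a⁻¹ * (∫⁻ t in Set.Ioi (0 : ℝ), ‖u t‖ₑ ^ 2) +
          ENNReal.ofReal (a⁻¹ * X ^ 2) * ∫⁻ t in Set.Ioi (0 : ℝ), ‖(t : ℂ) * u t‖ₑ ^ 2) := by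
        rw [lintegral_add_left (by fun_prop), lintegral_add_left (by fun_prop),
          lintegral_const_mul _ (by fun_prop), lintegral_const_mul _ (by fun_prop)]
    _ ≤ ENNReal.ofReal (a * (Real.pi / |X|)) + (ENNReal.ofReal a⁻¹ * ENNReal.ofReal ((b₁ * m) ^ 2) +
          ENNReal.ofReal (a⁻¹ * X ^ 2) * ENNReal.ofReal ((b₂ * m / |X|) ^ 2)) := by
        gcongr
        refine (setLIntegral_le_lintegral _ _).trans (le_of_eq ?_)
        rw [← ofReal_integral_eq_lintegral_ofReal ((integrable_inv_one_add_mul_sq hX).const_mul _)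
          (Filter.Eventually.of_forall fun t => by positivity), integral_const_mul,
          integral_inv_one_add_mul_sq]
    _ = _ := by
        rw [← ENNReal.ofReal_mul (by positivity), ← ENNReal.ofReal_mul (by positivity),
          ← ENNReal.ofReal_add (by positivity) (by positivity),
          ← ENNReal.ofReal_add (by positivity) (by positivity)]
        congr 1
        clear_value b₁ b₂
        have e1 : (b₁ * m) ^ 2 = b₁ ^ 2 * m ^ 2 := mul_pow ..
        have e2 : (b₂ * m / |X|) ^ 2 = b₂ ^ 2 * m ^ 2 / X ^ 2 := by rw [div_pow, mul_pow, sq_abs]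
        rw [e1, e2, hmsq]
        have hX2 : X ^ 2 ≠ 0 := pow_ne_zero 2 hX
        field_simp

end Alber

/-! ### Scattering and the wave operator -/

namespace Alber

/-- Mean value theorem. The factor |X| cancels the singularity 1/|X| of the L¹ bound in time. -/
theorem exists_norm_gap_le (P : 𝓢(ℝ, ℝ)) : ∃ L : ℝ, 0 ≤ L ∧ ∀ k X, ‖gap P k X‖ ≤ L * |X| := by
  refine ⟨SchwartzMap.seminorm ℝ 0 0 (SchwartzMap.derivCLM ℝ ℝ P), apply_nonneg _ _,
    fun k X => ?_⟩
  have h := convex_univ.norm_image_sub_le_of_norm_deriv_le (𝕜 := ℝ) (f := P)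
    (C := SchwartzMap.seminorm ℝ 0 0 (SchwartzMap.derivCLM ℝ ℝ P))
    (fun x _ => P.differentiableAt)
    (fun x _ => SchwartzMap.norm_le_seminorm ℝ (SchwartzMap.derivCLM ℝ ℝ P) x)
    (Set.mem_univ (k + X / 2)) (Set.mem_univ (k - X / 2))
  have e : k - X / 2 - (k + X / 2) = -X := by ring
  rwa [e, norm_neg, Real.norm_eq_abs X, ← Complex.norm_real] at h

/-- Lebesgue measure on frequency and positive time. -/
noncomputable abbrev freqTime : Measure (ℝ × ℝ) :=
  (volume : Measure ℝ).prod ((volume : Measure ℝ).restrict (Set.Ioi 0))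

/-- The oscillating amplitude that scatters the frequency `X` at time `s`, evaluated at the point
`z` of phase space. -/
noncomputable def amplitude (p : ℝ) (P : ℝ → ℝ) (z ζ : ℝ × ℝ) : ℂ :=
  Complex.exp (2 * Real.pi * Complex.I * ζ.1 * z.1) *
    Complex.exp (4 * Real.pi ^ 2 * p * z.2 * ζ.1 * Complex.I * ζ.2) * gap P z.2 ζ.1

theorem norm_amplitude (p : ℝ) (P : ℝ → ℝ) (z ζ : ℝ × ℝ) :
    ‖amplitude p P z ζ‖ = ‖gap P z.2 ζ.1‖ := by
  have e : (4 * Real.pi ^ 2 * p * z.2 * ζ.1 * Complex.I * ζ.2 : ℂ) =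
      ((4 * Real.pi ^ 2 * p * z.2 * ζ.1 * ζ.2 : ℝ) : ℂ) * Complex.I := by push_cast; ring
  have e' : (2 * Real.pi * Complex.I * ζ.1 * z.1 : ℂ) =
      ((2 * Real.pi * ζ.1 * z.1 : ℝ) : ℂ) * Complex.I := by push_cast; ring
  rw [amplitude, e, e', norm_mul, norm_mul, Complex.norm_exp_ofReal_mul_I,
    Complex.norm_exp_ofReal_mul_I, one_mul, one_mul]

theorem continuous_amplitude (p : ℝ) (P : 𝓢(ℝ, ℝ)) :
    Continuous fun y : (ℝ × ℝ) × (ℝ × ℝ) => amplitude p P y.1 y.2 := by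
  have h : Continuous fun y : (ℝ × ℝ) × (ℝ × ℝ) => gap P y.1.2 y.2.1 :=
    (continuous_gap P).comp (f := fun y : (ℝ × ℝ) × (ℝ × ℝ) => (y.1.2, y.2.1)) (by fun_prop)
  unfold amplitude
  fun_prop

/-- A continuous solution of the Volterra equations has an integrable first frequency moment. -/
theorem integrable_abs_mul_norm_solution {p q κ : ℝ} (hp : p ≠ 0) {P : 𝓢(ℝ, ℝ)}
    (hs : StableWith p q P κ) (w : 𝓢(ℝ × ℝ, ℂ)) {u : ℝ × ℝ → ℂ} (hu : Continuous u)
    (heq : ∀ X t, 0 ≤ t → u (X, t) = fourier₂ w X (2 * Real.pi * p * X * t) +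
      ∫ s in (0 : ℝ)..t, kernelH p q P (-X) (t - s) * u (X, s)) :
    Integrable (fun ζ : ℝ × ℝ => |ζ.1| * ‖u ζ‖) freqTime := by
  obtain ⟨B, hB0, hB⟩ := exists_lintegral_solution_le hp hs w
  have hc : Continuous fun ζ : ℝ × ℝ => |ζ.1| * ‖u ζ‖ := by fun_prop
  refine ⟨hc.aestronglyMeasurable, ?_⟩
  rw [HasFiniteIntegral, lintegral_prod _ hc.enorm.measurable.aemeasurable]
  calc ∫⁻ X, ∫⁻ t in Set.Ioi (0 : ℝ), ‖|X| * ‖u (X, t)‖‖ₑ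
      ≤ ∫⁻ X, ENNReal.ofReal (B * (1 + X ^ 2)⁻¹) := by
        refine lintegral_mono_ae ((Measure.ae_ne volume (0 : ℝ)).mono fun X hX => ?_)
        have hX' : 0 < |X| := abs_pos.2 hX
        have hux : Continuous fun t : ℝ => u (X, t) := by fun_prop
        simp only [enorm_mul, enorm_norm]
        rw [lintegral_const_mul _ hux.enorm.measurable]
        refine (mul_le_mul_right (hB X hX _ hux (heq X)) _).trans (le_of_eq ?_)
        rw [← ofReal_norm, norm_abs_eq_norm, Real.norm_eq_abs,
          ← ENNReal.ofReal_mul hX'.le]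
        congr 1
        field_simp
    _ < ∞ := by
        have := (integrable_inv_one_add_sq.const_mul B).lintegral_lt_top
        exact this

/-- At nonzero frequencies the density of a solution is determined by the Volterra equation. -/
theorem IsSolution.fourier_density_eq_of_volterra {p q κ : ℝ} (hp : p ≠ 0) {P : 𝓢(ℝ, ℝ)}
    (hs : StableWith p q P κ) {w₀ : 𝓢(ℝ × ℝ, ℂ)} {w : ℝ → 𝓢(ℝ × ℝ, ℂ)}
    (hw : IsSolution p q P w₀ w) {X : ℝ} (hX : X ≠ 0) {u : ℝ → ℂ} (hu : Continuous u)
    (heq : ∀ t, 0 ≤ t → u t = fourier₂ w₀ X (2 * Real.pi * p * X * t) +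
      ∫ s in (0 : ℝ)..t, kernelH p q P (-X) (t - s) * u s) {t : ℝ} (ht : 0 < t) :
    𝓕 (densityCLM (w t)) X = u t := by
  have hn := continuousOn_schwartz_apply hw.continuousOn_fourier_density X
  have hk : Continuous fun t : ℝ => kernelH p q P (-X) t :=
    (continuous_kernelH p q P).comp (f := fun t : ℝ => (-X, t)) (by fun_prop)
  set d : ℝ → ℂ := fun t => 𝓕 (densityCLM (w t)) X - u t with hd
  have hdc : ContinuousOn d (Set.Ici 0) := hn.sub hu.continuousOn
  have hde : ∀ t, 0 < t → d t = (0 : ℝ → ℂ) t +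
      ∫ s in (0 : ℝ)..t, kernelH p q P (-X) (t - s) * d s := by
    intro t ht
    have hkt : Continuous fun s : ℝ => kernelH p q P (-X) (t - s) := hk.comp (by fun_prop)
    have i1 : IntervalIntegrable (fun s => kernelH p q P (-X) (t - s) * 𝓕 (densityCLM (w s)) X)
        volume 0 t := by
      refine ContinuousOn.intervalIntegrable ?_
      rw [Set.uIcc_of_le ht.le]
      exact hkt.continuousOn.mul (hn.mono Set.Icc_subset_Ici_self)
    have i2 : IntervalIntegrable (fun s => kernelH p q P (-X) (t - s) * u s) volume 0 t :=
      (hkt.mul hu).intervalIntegrable _ _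
    simp only [hd, mul_sub, Pi.zero_apply, zero_add]
    rw [intervalIntegral.integral_sub i1 i2, hw.volterra X ht.le, heq t ht.le]
    simp only [add_sub_add_left_eq_sub]
  -- Uniqueness: with zero forcing the stability estimate makes the difference vanish almost
  -- everywhere, and continuity on the open half line makes it vanish at every positive time.
  have h0 := eLpNorm_le_of_stableWith hp hs hX hdc hde
  rw [eLpNorm_zero, mul_zero, nonpos_iff_eq_zero] at h0
  have hdi : ContinuousOn d (Set.Ioi 0) := hdc.mono Set.Ioi_subset_Ici_self
  rw [eLpNorm_eq_zero_iff (hdi.aestronglyMeasurable measurableSet_Ioi) (by norm_num)] at h0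
  have := Measure.eqOn_open_of_ae_eq h0 isOpen_Ioi hdi continuousOn_const ht
  exact sub_eq_zero.1 this

/-- The phases are unimodular, so the majorant L|X||u| does not depend on the phase-space point. -/
theorem integrable_amplitude_mul {p : ℝ} {P : 𝓢(ℝ, ℝ)} {u : ℝ × ℝ → ℂ} (hu : Continuous u)
    (hi : Integrable (fun ζ : ℝ × ℝ => |ζ.1| * ‖u ζ‖) freqTime) (z : ℝ × ℝ) :
    Integrable (fun ζ => amplitude p P z ζ * u ζ) freqTime := by
  obtain ⟨L, hL0, hL⟩ := exists_norm_gap_le P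
  have ha : Continuous fun ζ => amplitude p P z ζ :=
    (continuous_amplitude p P).comp (f := fun ζ => (z, ζ)) (by fun_prop)
  refine (hi.const_mul L).mono' (ha.mul hu).aestronglyMeasurable
    (Filter.Eventually.of_forall fun ζ => ?_)
  rw [norm_mul, norm_amplitude, ← mul_assoc]
  gcongr
  exact hL _ _

theorem freqTime_restrict (t : ℝ) :
    freqTime.restrict (Set.univ ×ˢ Set.Iic t) = volume.prod (volume.restrict (Set.Ioc 0 t)) := by
  rw [← Measure.prod_restrict, Measure.restrict_univ, Measure.restrict_restrict measurableSet_Iic,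
    Set.inter_comm, Set.Ioi_inter_Iic]

/-- The Duhamel formula on phase space. -/
theorem IsSolution.apply_eq {p q : ℝ} {P : 𝓢(ℝ, ℝ)} {w₀ : 𝓢(ℝ × ℝ, ℂ)} {w : ℝ → 𝓢(ℝ × ℝ, ℂ)}
    (hw : IsSolution p q P w₀ w) {u : ℝ × ℝ → ℂ} (hu : Continuous u)
    (hi : Integrable (fun ζ : ℝ × ℝ => |ζ.1| * ‖u ζ‖) freqTime)
    (hwu : ∀ X t, X ≠ 0 → 0 < t → 𝓕 (densityCLM (w t)) X = u (X, t)) {t : ℝ} (ht : 0 ≤ t)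
    (x k : ℝ) :
    w t (x, k) = w₀ (x - 2 * Real.pi * p * k * t, k) + q * Complex.I *
      ∫ ζ in Set.univ ×ˢ Set.Iic t,
        amplitude p P (x - 2 * Real.pi * p * k * t, k) ζ * u ζ ∂freqTime := by
  set x' : ℝ := x - 2 * Real.pi * p * k * t with hx'
  have hinv : ∀ (f : 𝓢(ℝ × ℝ, ℂ)) (y : ℝ), f (y, k) =
      ∫ X : ℝ, Complex.exp (2 * Real.pi * Complex.I * X * y) * 𝓕 (sliceX k f) X := by
    intro f y
    have h1 : 𝓕⁻ (𝓕 (sliceX k f)) = sliceX k f := FourierTransform.fourierInv_fourier_eq _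
    rw [← sliceX_apply k f y]
    conv_lhs => rw [← h1]
    rw [SchwartzMap.fourierInv_coe, fourierInv_eq_integral]
  have hI := (integrable_amplitude_mul (p := p) (P := P) hu hi (x', k)).restrict
    (s := Set.univ ×ˢ Set.Iic t)
  rw [freqTime_restrict] at hI ⊢
  rw [hinv (w t) x, hinv w₀ x', integral_prod _ hI, ← integral_const_mul, ← integral_add]
  -- The density is identified with u only for X ≠ 0; the excluded frequency is a null set.
  · refine integral_congr_ae ((Measure.ae_ne volume (0 : ℝ)).mono fun X hX => ?_)
    have hd := hw.duhamel k X ht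
    have hs : ∫ s in (0 : ℝ)..t, Complex.exp (4 * Real.pi ^ 2 * p * k * X * Complex.I * s) *
        (q * Complex.I * gap P k X * 𝓕 (densityCLM (w s)) X) =
        ∫ s in Set.Ioc 0 t, Complex.exp (4 * Real.pi ^ 2 * p * k * X * Complex.I * s) *
        (q * Complex.I * gap P k X * u (X, s)) := by
      rw [intervalIntegral.integral_of_le ht]
      refine setIntegral_congr_fun measurableSet_Ioc fun s hs => ?_
      rw [hwu X s hX hs.1]
    rw [hs] at hd
    -- The transport phase in the Duhamel formula is the translation carrying x' to x, so everything
    -- is evaluated at the transported point.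
    have hE : Complex.exp (2 * Real.pi * Complex.I * X * x) =
        Complex.exp (2 * Real.pi * Complex.I * X * x') *
          Complex.exp (4 * Real.pi ^ 2 * p * k * X * Complex.I * t) := by
      rw [← Complex.exp_add]
      congr 1
      rw [hx']; push_cast; ring
    simp only
    rw [hE, mul_assoc, hd, mul_add, ← integral_const_mul, ← integral_const_mul]
    congr 2; ext s
    simp only [amplitude]; ring
  · refine ((𝓕 (sliceX k w₀)).integrable (μ := volume)).norm.mono' ?_
      (Filter.Eventually.of_forall fun X => ?_)
    · have := (𝓕 (sliceX k w₀)).continuous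
      exact Continuous.aestronglyMeasurable (by fun_prop)
    · rw [norm_mul, norm_exp_of_re_eq_zero (by simp), one_mul]
  · exact hI.integral_prod_left.const_mul _

/-- The wave operator. -/
theorem exists_waveOperator {p q κ : ℝ} (hp : p ≠ 0) {P : 𝓢(ℝ, ℝ)} (hs : StableWith p q P κ) :
    ∃ W : 𝓢(ℝ × ℝ, ℂ) →ₗ[ℂ] (ℝ × ℝ → ℂ),
      (∀ w₀ : 𝓢(ℝ × ℝ, ℂ), MemLp (W w₀) ∞ volume) ∧
      ∀ (w₀ : 𝓢(ℝ × ℝ, ℂ)) (w : ℝ → 𝓢(ℝ × ℝ, ℂ)), IsSolution p q P w₀ w →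
        Filter.Tendsto (fun t : ℝ => eLpNorm
            (fun z : ℝ × ℝ => w t z - freeTransport p t (W w₀) z) ∞ volume)
          Filter.atTop (nhds 0) := by
  obtain ⟨U, hUc, hU⟩ := exists_volterra_solution p q P
  obtain ⟨L, hL0, hL⟩ := exists_norm_gap_le P
  have hi := fun w => integrable_abs_mul_norm_solution hp hs w (hUc w) (hU w)
  have hI := fun w => integrable_amplitude_mul (p := p) (P := P) (hUc w) (hi w)
  have hbound : ∀ w z ζ, ‖amplitude p P z ζ * U w ζ‖ ≤ L * (|ζ.1| * ‖U w ζ‖) := by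
    intro w z ζ
    rw [norm_mul, norm_amplitude, ← mul_assoc]
    gcongr
    exact hL _ _
  -- The Duhamel formula along free trajectories with the time integral extended to infinity.
  let W : 𝓢(ℝ × ℝ, ℂ) →ₗ[ℂ] (ℝ × ℝ → ℂ) :=
    { toFun := fun w z => w z + q * Complex.I * ∫ ζ, amplitude p P z ζ * U w ζ ∂freqTime
      map_add' := fun v w => by
        ext z
        simp only [map_add, Pi.add_apply, mul_add, add_apply]
        rw [integral_add (hI v z) (hI w z)]
        ring
      map_smul' := fun c w => by
        ext z
        simp only [map_smul, Pi.smul_apply, smul_eq_mul, smul_apply, RingHom.id_apply,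
          mul_left_comm _ c]
        rw [integral_const_mul]
        ring }
  have hW : ∀ w z, W w z = w z + q * Complex.I * ∫ ζ, amplitude p P z ζ * U w ζ ∂freqTime :=
    fun w z => rfl
  refine ⟨W, fun w => ?_, fun w₀ w hw => ?_⟩
  · have hc : Continuous (W w) := by
      have h1 : Continuous fun z => ∫ ζ, amplitude p P z ζ * U w ζ ∂freqTime := by
        refine continuous_of_dominated (fun z => (hI w z).aestronglyMeasurable)
          (fun z => Filter.Eventually.of_forall (hbound w z)) ((hi w).const_mul L)
          (Filter.Eventually.of_forall fun ζ => ?_)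
        exact ((continuous_amplitude p P).comp (f := fun z => (z, ζ)) (by fun_prop)).mul
          continuous_const
      have h2 := w.continuous
      exact h2.add (continuous_const.mul h1)
    refine memLp_top_of_bound hc.aestronglyMeasurable (SchwartzMap.seminorm ℝ 0 0 w +
      |q| * ∫ ζ : ℝ × ℝ, L * (|ζ.1| * ‖U w ζ‖) ∂freqTime) (Filter.Eventually.of_forall fun z => ?_)
    rw [hW]
    refine (norm_add_le _ _).trans (add_le_add (SchwartzMap.norm_le_seminorm ℝ w z) ?_)
    rw [norm_mul, norm_mul, Complex.norm_I, mul_one, Complex.norm_real, Real.norm_eq_abs]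
    gcongr
    exact norm_integral_le_of_norm_le ((hi w).const_mul L)
      (Filter.Eventually.of_forall (hbound w z))
  · set S : ℝ → Set (ℝ × ℝ) := fun t => (Set.univ ×ˢ Set.Iic t)ᶜ with hS
    have hSm : ∀ t, MeasurableSet (S t) := fun t =>
      (MeasurableSet.univ.prod measurableSet_Iic).compl
    -- A bound on the tail s > t that does not involve the phase-space point, hence one for the
    -- supremum norm.
    set G : ℝ → ℝ := fun t => |q| * ∫ ζ in S t, L * (|ζ.1| * ‖U w₀ ζ‖) ∂freqTime with hG
    have hG0 : Filter.Tendsto G Filter.atTop (nhds 0) := by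
      have h := tendsto_setIntegral_of_antitone (μ := freqTime)
        (f := fun ζ : ℝ × ℝ => L * (|ζ.1| * ‖U w₀ ζ‖)) hSm
        (fun s t hst => Set.compl_subset_compl.2
          (Set.prod_mono le_rfl (Set.Iic_subset_Iic.2 hst)))
        ⟨0, ((hi w₀).const_mul L).integrableOn⟩
      have he : ⋂ t, S t = ∅ := by
        ext ζ
        simp only [hS, Set.mem_iInter, Set.mem_compl_iff, Set.mem_prod, Set.mem_univ, Set.mem_Iic,
          true_and, not_le, Set.mem_empty_iff_false, iff_false, not_forall, not_lt]
        exact ⟨ζ.2, le_rfl⟩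
      rw [he, setIntegral_empty] at h
      simpa using h.const_mul |q|
    have hle : ∀ t, 0 ≤ t → eLpNorm (fun z : ℝ × ℝ => w t z - freeTransport p t (W w₀) z) ∞ volume ≤
        ENNReal.ofReal (G t) := by
      intro t ht
      refine eLpNormEssSup_le_of_ae_bound (Filter.Eventually.of_forall fun z => ?_)
      set z' : ℝ × ℝ := (z.1 - 2 * Real.pi * p * z.2 * t, z.2) with hz'
      have h1 : w t z = w₀ z' + q * Complex.I *
          ∫ ζ in Set.univ ×ˢ Set.Iic t, amplitude p P z' ζ * U w₀ ζ ∂freqTime :=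
        hw.apply_eq (hUc w₀) (hi w₀) (fun X s hX hs' =>
          hw.fourier_density_eq_of_volterra hp hs hX
            ((hUc w₀).comp (f := fun s : ℝ => (X, s)) (by fun_prop)) (hU w₀ X) hs') ht z.1 z.2
      have h2 : w t z - freeTransport p t (W w₀) z =
          -(q * Complex.I * ∫ ζ in S t, amplitude p P z' ζ * U w₀ ζ ∂freqTime) := by
        rw [freeTransport, ← hz', hW, h1,
          ← integral_add_compl (MeasurableSet.univ.prod (measurableSet_Iic (a := t))) (hI w₀ z')]
        ring
      rw [h2, norm_neg, norm_mul, norm_mul, Complex.norm_I, mul_one, Complex.norm_real,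
        Real.norm_eq_abs]
      simp only [hG]
      gcongr
      exact norm_integral_le_of_norm_le ((hi w₀).const_mul L).integrableOn
        (Filter.Eventually.of_forall (hbound w₀ z'))
    have hlim : Filter.Tendsto (fun t => ENNReal.ofReal (G t)) Filter.atTop (nhds 0) := by
      simpa using ENNReal.tendsto_ofReal hG0
    exact tendsto_of_tendsto_of_tendsto_of_le_of_le' tendsto_const_nhds hlim
      (Filter.Eventually.of_forall fun _ => zero_le)
      ((Filter.eventually_ge_atTop 0).mono hle)

end Alber

theorem theorem3p4 (p q : ℝ) (hp : p ≠ 0) (P : 𝓢(ℝ, ℝ)) (hP : HasCompactSupport P)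
    (hstable : ∃ κ : ℝ, Alber.StableWith p q P κ) :
    (∃ r : ℕ, ∃ C : ℝ, 0 < C ∧ ∀ κ : ℝ, Alber.StableWith p q P κ →
      ∀ (w₀ : 𝓢(ℝ × ℝ, ℂ)) (w : ℝ → 𝓢(ℝ × ℝ, ℂ)), Alber.IsSolution p q P w₀ w →
        eLpNorm (fun z : ℝ × ℝ => deriv (Alber.density (w z.2)) z.1) 2
            ((volume : Measure ℝ).prod ((volume : Measure ℝ).restrict (Set.Ioi 0)))
          ≤ ENNReal.ofReal (C / κ) * Alber.sigmaNorm r ∞ w₀) ∧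
    (∃ W : 𝓢(ℝ × ℝ, ℂ) →ₗ[ℂ] (ℝ × ℝ → ℂ),
      (∀ w₀ : 𝓢(ℝ × ℝ, ℂ), MemLp (W w₀) ∞ volume) ∧
      ∀ (w₀ : 𝓢(ℝ × ℝ, ℂ)) (w : ℝ → 𝓢(ℝ × ℝ, ℂ)), Alber.IsSolution p q P w₀ w →
        Filter.Tendsto
          (fun t : ℝ => eLpNorm
            (fun z : ℝ × ℝ => w t z - Alber.freeTransport p t (W w₀) z) ∞ volume)
          Filter.atTop (nhds 0)) := by
  obtain ⟨κ, hκ⟩ := hstable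
  -- The constant in (i) contains only p. In (ii) any stability constant serves: the operator is
  -- built without κ, which enters only the convergence bounds.
  refine ⟨⟨8, 16 * Real.pi ^ 2 * √(2 * Real.pi ^ 3 / |p|), ?_, fun κ' hκ' w₀ w hw =>
    Alber.eLpNorm_deriv_density_le hp hκ' hw⟩, Alber.exists_waveOperator hp hκ⟩
  have := abs_pos.2 hp
  positivity
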